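/- Let $n\ge 2$, let $L^n$ be the space of real $n\times n$ matrices, let $\Sigma\subset\mathbb R^n$ be the simplex of probability vectors, $T\Sigma=\{v\in\mathbb R^n:\sum_i v_i=0\}$ and $\underline 1=(1,\dots,1)$; a prime denotes transposition of vectors and matrices. Let $LI^n\subset L^n$ be the set of matrices $M$ with a completely mixed Nash equilibrium, i.e. such that there is exactly one pair $(\bar p,\bar q)\in\Sigma\times\Sigma$ with all components strictly positive and $\bar p'M=\lambda\underline 1'$, $M\bar q=\mu\underline 1$ for some $\lambda,\mu\in\mathbb R$. For $M\in L^n$ put $$H(p,q)=\max_i (Mq)_i-\min_j (p'M)_j ,\qquad BR_p(q)=\operatorname{argmax}_{p\in\Sigma}p'Mq,\qquad BR_q(p)=\operatorname{argmin}_{q\in\Sigma}p'Mq ,$$ and let $H^{-1}(\rho)$ be the level set of $H$ in $\Sigma\times\Sigma$. For $A=(a_{ij})\in L^n$ let $\omega=\sum_{ij}a_{ij}\,dp_i\wedge dq_j$. The Hamiltonian vector field $X_H$ is the set-valued field on $\Sigma\times\Sigma$ for which $X_H(p,q)$ consists of all $v\in T\Sigma\times T\Sigma$ such that, for some $\xi$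 in the subdifferential of the convex function $H$ at $(p,q)$ along the directions in $T\Sigma\times T\Sigma$ (where the formula for $H$ is used outside $\Sigma\times\Sigma$ as well), $\omega(v,Y)=\xi(Y)$ for all $Y\in T\Sigma\times T\Sigma$. For $I,J\subset\{1,\dots,n\}$ let $C_{I,J}$ be the set of $(p,q)\in\Sigma\times\Sigma$ such that $I$ is the set of positions of the largest components of $Mq$ and $J$ the set of positions of the smallest components of $p'M$. **Theorem.** There is a set $V\subset LI^n\times L^n$ that is open, is dense in $LI^n\times L^n$, and whose complement in $LI^n\times L^n$ has Lebesgue measure zero, such that for every $(M,A)\in V$ the following holds. 1. For all sufficiently small $\rho>0$ the level set $H^{-1}(\rho)$ is homeomorphic to the sphere $S^{2n-3}$, and it is a finite union of compact convex polytopes of dimension $2n-3$ (pieces of hyperplanes of the $(2n-2)$-dimensional $\Sigma\times\Sigma$). 2. The form $\omega$ is symplectic on $\Sigma\times\Sigma$. The field $X_H$ is piecewise constant: on each of the finitely many convex pieces $C_{I,J}$ partitioning $\Sigma\times\Sigma$ it takes one constant non-empty value. On the pieces $C_{\{i\},\{j\}}$ the function $H$ is differentiable and $X_H=\{v\}$,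 where $v\in T\Sigma\times T\Sigma$ is the usual Hamiltonian vector, $\omega(v,Y)=dH(Y)$ for all $Y\in T\Sigma\times T\Sigma$. The set of points of $\Sigma\times\Sigma$ at which $X_H$ has more than one value is a finite union of compact convex polytopes of codimension one, i.e. of dimension $2n-3$. 3. Correspondingly there is a differential inclusion $$\Big(\frac{dp}{dt},\frac{dq}{dt}\Big)\in X_H(p,q)$$ with set-valued, piecewise constant right-hand side. Explicitly, $A$ is invertible, $\underline 1'A^{-1}\underline 1\ne 0$, and for all $(p,q)\in\Sigma\times\Sigma$ $$X_H(p,q)=P_pA'^{-1}M'BR_p(q)\times P_qA^{-1}M\,BR_q(p),$$ where $P_p,P_q$ are the projections of $\mathbb R^n$ onto $T\Sigma$ along $A'^{-1}\underline 1$ and $A^{-1}\underline 1$ respectively. 4. For every sufficiently small $\rho>0$ the differential inclusion induces a unique continuous flow $(\phi_t)_{t\in\mathbb R}$ on $H^{-1}(\rho)$: the orbits of $\phi$ are absolutely continuous solutions (the inclusion holds for almost every $t$), and every absolutely continuous solution in $\Sigma\times\Sigma$, on a compact time interval containing $0$, that starts at time $0$ at a point $x\in H^{-1}(\rho)$ equals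 $t\mapsto\phi_t(x)$. The flow is piecewise a translation flow: for each $I,J$ there are vectors $v^+_{I,J},v^-_{I,J}$ such that for every $x\in C_{I,J}\cap H^{-1}(\rho)$ there is $\varepsilon>0$ with $\phi_t(x)=x+t\,v^+_{I,J}$ and $\phi_{-t}(x)=x-t\,v^-_{I,J}$ for $0\le t\le\varepsilon$. The flow has no stationary point: for every $x\in H^{-1}(\rho)$ we have $0\notin X_H(x)$, and $\phi_t(x)\neq x$ for some $t$. 5. For this flow, first return maps between hyperplanes are piecewise affine: if $P$ and $Q$ are hyperplanes, then the set of those $x\in P\cap H^{-1}(\rho)$ for which there is a first time $t(x)>0$ with $\phi_{t(x)}(x)\in Q$ is a countable union of convex polyhedral sets (solution sets of finitely many weak and strict affine inequalities), on each of which the map $x\mapsto\phi_{t(x)}(x)$ is the restriction of an affine map. -/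

import Mathlib

open Matrix MeasureTheory Set

namespace HamGame

/-- Pairs `(p, q)` of vectors in `ℝⁿ`. -/
abbrev Pt (n : ℕ) : Type := (Fin n → ℝ) × (Fin n → ℝ)

abbrev Mat (n : ℕ) : Type := Matrix (Fin n) (Fin n) ℝ

/-- The product `Σ × Σ` of two copies of the simplex of probability vectors. -/
def simplexProd (n : ℕ) : Set (Pt n) :=
  stdSimplex ℝ (Fin n) ×ˢ stdSimplex ℝ (Fin n)

/-- The tangent space `TΣ × TΣ`: both components have coordinate sum zero. -/
def tangentProd (n : ℕ) : Set (Pt n) :=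
  {v | ∑ i, v.1 i = 0 ∧ ∑ i, v.2 i = 0}

/-- The `n × n` matrices with a completely mixed Nash equilibrium: there is exactly one pair of
strictly positive probability vectors `p̄, q̄` with `p̄' M = lam 1` and `M q̄ = mu 1`. -/
def LI (n : ℕ) : Set (Mat n) :=
  {M | ∃! x : Pt n, x ∈ simplexProd n ∧ (∀ i, 0 < x.1 i) ∧ (∀ j, 0 < x.2 j) ∧
    (∃ lam : ℝ, x.1 ᵥ* M = fun _ => lam) ∧ (∃ mu : ℝ, M *ᵥ x.2 = fun _ => mu)}

/-- `H(p, q) = max_i (M q)_i - min_j (p' M)_j`. The formula makes sense on all of `ℝⁿ × ℝⁿ`. -/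
noncomputable def ham {n : ℕ} (M : Mat n) (x : Pt n) : ℝ :=
  (⨆ i, (M *ᵥ x.2) i) - ⨅ j, (x.1 ᵥ* M) j

/-- The level set `H⁻¹(ρ)` of `H : Σ × Σ → ℝ`. -/
def levelSet {n : ℕ} (M : Mat n) (ρ : ℝ) : Set (Pt n) :=
  {x | x ∈ simplexProd n ∧ ham M x = ρ}

/-- `BR_p(q) = argmax_{p ∈ Σ} p' M q`. -/
def bestP {n : ℕ} (M : Mat n) (q : Fin n → ℝ) : Set (Fin n → ℝ) :=
  {p | p ∈ stdSimplex ℝ (Fin n) ∧ ∀ p' ∈ stdSimplex ℝ (Fin n), p' ⬝ᵥ M *ᵥ q ≤ p ⬝ᵥ M *ᵥ q}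

/-- `BR_q(p) = argmin_{q ∈ Σ} p' M q`. -/
def bestQ {n : ℕ} (M : Mat n) (p : Fin n → ℝ) : Set (Fin n → ℝ) :=
  {q | q ∈ stdSimplex ℝ (Fin n) ∧ ∀ q' ∈ stdSimplex ℝ (Fin n), p ⬝ᵥ M *ᵥ q ≤ p ⬝ᵥ M *ᵥ q'}

/-- The positions of the largest components of `M q`. -/
def topRows {n : ℕ} (M : Mat n) (q : Fin n → ℝ) : Set (Fin n) :=
  {i | ∀ k, (M *ᵥ q) k ≤ (M *ᵥ q) i}

/-- The positions of the smallest components of `p' M`. -/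
def bottomCols {n : ℕ} (M : Mat n) (p : Fin n → ℝ) : Set (Fin n) :=
  {j | ∀ k, (p ᵥ* M) j ≤ (p ᵥ* M) k}

/-- The piece of `Σ × Σ` on which `I` is the set of positions of the largest components of `M q`
and `J` is the set of positions of the smallest components of `p' M`. These finitely many convex
sets partition `Σ × Σ`. -/
def cell {n : ℕ} (M : Mat n) (I J : Set (Fin n)) : Set (Pt n) :=
  {x | x ∈ simplexProd n ∧ topRows M x.2 = I ∧ bottomCols M x.1 = J}

/-- The constant two-form `ω = ∑ a_ij dp_i ∧ dq_j`. -/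
def symp {n : ℕ} (A : Mat n) (v w : Pt n) : ℝ :=
  ∑ i, ∑ j, A i j * (v.1 i * w.2 j - w.1 i * v.2 j)

/-- `ω` is nondegenerate on `Σ × Σ` (it has constant coefficients, hence is closed). -/
def IsSymplectic {n : ℕ} (A : Mat n) : Prop :=
  ∀ v ∈ tangentProd n, (∀ w ∈ tangentProd n, symp A v w = 0) → v = 0

/-- The set-valued differential of the convex function `H` along `Σ × Σ`: its subdifferential, that
is the set of all linear functionals supporting `H` at `x` in the directions tangent to `Σ × Σ`. -/
def diffHam {n : ℕ} (M : Mat n) (x : Pt n) : Set (Pt n →ₗ[ℝ] ℝ) :=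
  {ξ | ∀ Y ∈ tangentProd n, ham M x + ξ Y ≤ ham M (x + Y)}

/-- The (set-valued) Hamiltonian vector field `X_H`: all `v` tangent to `Σ × Σ` with
`ω(v, Y) = dH(Y)` for all tangent `Y`, for some value of the set-valued differential `dH`. -/
def hamField {n : ℕ} (M A : Mat n) (x : Pt n) : Set (Pt n) :=
  {v | v ∈ tangentProd n ∧ ∃ ξ ∈ diffHam M x, ∀ Y ∈ tangentProd n, symp A v Y = ξ Y}

/-- The projection of `ℝⁿ` onto `TΣ` along the vector `a` (used when the sum of `a` is nonzero). -/
noncomputable def projAlong {n : ℕ} (a z : Fin n → ℝ) : Fin n → ℝ :=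
  z - ((∑ i, z i) / ∑ i, a i) • a

/-- The set `P_p A'⁻¹ M' BR_p(q) × P_q A⁻¹ M BR_q(p)`, where `P_p` and `P_q` are the projections
onto `TΣ` along `A'⁻¹ 1` and `A⁻¹ 1`. -/
noncomputable def brField {n : ℕ} (M A : Mat n) (x : Pt n) : Set (Pt n) :=
  ((fun c => projAlong ((Aᵀ)⁻¹ *ᵥ 1) ((Aᵀ)⁻¹ *ᵥ (Mᵀ *ᵥ c))) '' bestP M x.2) ×ˢ
  ((fun d => projAlong (A⁻¹ *ᵥ 1) (A⁻¹ *ᵥ (M *ᵥ d))) '' bestQ M x.1)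

/-- `C` is a compact convex polytope of dimension `d`. -/
def IsPolytopeOfDim {n : ℕ} (d : ℕ) (C : Set (Pt n)) : Prop :=
  C.Nonempty ∧ (∃ F : Finset (Pt n), C = convexHull ℝ (F : Set (Pt n))) ∧
    Module.finrank ℝ (vectorSpan ℝ C) = d

/-- `C` is a finite union of compact convex polytopes of dimension `d`. -/
def IsPolyhedralOfDim {n : ℕ} (d : ℕ) (C : Set (Pt n)) : Prop :=
  ∃ Fam : Set (Set (Pt n)), Fam.Finite ∧ (∀ P ∈ Fam, IsPolytopeOfDim d P) ∧ C = ⋃₀ Fam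

/-- `C` is the solution set of finitely many weak and strict affine inequalities. -/
def IsConvexPolyhedral {n : ℕ} (C : Set (Pt n)) : Prop :=
  ∃ F G : Finset (Pt n →ᵃ[ℝ] ℝ), C = {x | (∀ f ∈ F, 0 ≤ f x) ∧ ∀ g ∈ G, 0 < g x}

/-- `γ` is, on the time interval `[a, b]`, a (Carathéodory) solution in `Σ × Σ` of the differential
inclusion `(dp/dt, dq/dt) ∈ X_H(p, q)`. -/
def IsSolutionOn {n : ℕ} (M A : Mat n) (γ : ℝ → Pt n) (a b : ℝ) : Prop :=
  (∀ t ∈ Icc a b, γ t ∈ simplexProd n) ∧ AbsolutelyContinuousOnInterval γ a b ∧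
    ∀ᵐ t ∂(volume.restrict (Icc a b)), ∃ v ∈ hamField M A (γ t), HasDerivAt γ v t

/-- Orbits of `φ` are solutions of the differential inclusion, and every solution starting in the
level set, on any time interval around `0`, is a piece of an orbit of `φ`. -/
def IsUniqueFlow {n : ℕ} (M A : Mat n) (ρ : ℝ) (φ : Flow ℝ (levelSet M ρ)) : Prop :=
  ∀ x : levelSet M ρ,
    (∀ a b : ℝ, a ≤ b → IsSolutionOn M A (fun t => (φ t x : Pt n)) a b) ∧
    ∀ a b : ℝ, a ≤ 0 → 0 ≤ b → ∀ γ : ℝ → Pt n, IsSolutionOn M A γ a b → γ 0 = x →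
      ∀ t ∈ Icc a b, γ t = φ t x

/-- `φ` is piecewise a translation flow: to each of the finitely many pieces of the level set there
belong two constant vectors, so that every point of the piece is, for a short time, translated
along the first one in forward time and along the second one in backward time. (By compactness of
time intervals, each orbit is a broken line with finitely many corners in every bounded time
interval.) -/
def IsPiecewiseTranslation {n : ℕ} (M : Mat n) (ρ : ℝ) (φ : Flow ℝ (levelSet M ρ)) : Prop :=
  ∃ vf vb : Set (Fin n) → Set (Fin n) → Pt n, ∀ (I J : Set (Fin n)) (x : levelSet M ρ),
    (x : Pt n) ∈ cell M I J → ∃ ε > 0, ∀ t ∈ Icc (0 : ℝ) ε,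
      (φ t x : Pt n) = x + t • vf I J ∧ (φ (-t) x : Pt n) = x - t • vb I J

/-- `t` is the first positive time at which the orbit of `x` is in `Q`. -/
def IsFirstHit {n : ℕ} {S : Set (Pt n)} (φ : Flow ℝ S) (Q : Set (Pt n)) (x : S) (t : ℝ) : Prop :=
  0 < t ∧ (φ t x : Pt n) ∈ Q ∧ ∀ s, 0 < s → s < t → (φ s x : Pt n) ∉ Q

/-- The domain of the first return (or first passage) map from `P` to `Q`: the points of `P` whose
orbit has a first positive time in `Q`. -/
def returnDomain {n : ℕ} {S : Set (Pt n)} (φ : Flow ℝ S) (P Q : Set (Pt n)) : Set (Pt n) :=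
  {y | y ∈ P ∧ ∃ x : S, (x : Pt n) = y ∧ ∃ t, IsFirstHit φ Q x t}

/-- The first return map from `P` to `Q` is piecewise affine: its domain is a countable union of
convex polyhedral pieces, on each of which it is the restriction of an affine map. -/
def ReturnPiecewiseAffine {n : ℕ} {S : Set (Pt n)} (φ : Flow ℝ S) (P Q : Set (Pt n)) : Prop :=
  ∃ Fam : Set (Set (Pt n)), Fam.Countable ∧ returnDomain φ P Q = ⋃₀ Fam ∧
    ∀ C ∈ Fam, IsConvexPolyhedral C ∧ ∃ L : Pt n →ᵃ[ℝ] Pt n,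
      ∀ (x : S) (t : ℝ), (x : Pt n) ∈ C → IsFirstHit φ Q x t → (φ t x : Pt n) = L x

end HamGame

/-! The matrix `projInv A` inverts the bilinear form `A` on `TΣ`, and `K = M * projInv A * M`
governs the dynamics. By Hahn–Banach, a subgradient of `H` is a convex combination of the gradients
of its active linear pieces. So the values of `X_H` at a point are the vectors `vel M A c d`, with
`c` a probability vector on the top rows `I` and `d` one on the bottom columns `J` (`hamField_eq`).
Along such a velocity `M q` moves at rate `K d` and `p' M` at rate `c' K`.

Since `ω(v, v) = 0`, solutions preserve `H` (`IsSolutionOn.ham_eq`). A short displacement by `vel M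
A c d` that preserves `H` makes the largest `(K d)_i` on `I` equal to the smallest `(c' K)_j` on
`J`, so `(c, d)` is a pair of optimal strategies of the game `K` restricted to `I × J`
(`vel_eq_dir`). Such a pair exists by minimax (`exists_isNash`), and moving along its velocity keeps
it optimal for a short time (`exists_translate_dir`). If `K` is nondegenerate the pair is unique
(`IsNash.right_unique`), so the inclusion has exactly one forward direction, `dir`. An absolutely
continuous solution follows it because its mean velocity over a short interval is again admissible
(`average_mem`). Backward time is forward time for `-A`.

Nondegeneracy means that finitely many bordered minors of `K` do not vanish. After clearing
denominators these are nonzero polynomials in `(M, A)`, so they exclude only a closed null set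
(`PolyOnLines.measure_zeroSet`). The set `LI` is open by Cramer's rule for a bordered matrix
(`LI_eq`).

Seen from the equilibrium, `H` is positively homogeneous and positive on nonzero tangent vectors
(`IsEquil.ham_pos`). Small level sets are therefore radial graphs over a sphere inside the open
simplices.

The forward flow is assembled from translations. A common speed bound lets orbits pass possible
accumulation points of corners (`IsOrbit.exists_of_forall_lt`), and compactness of the level set
together with uniqueness of the direction gives continuity.

For return maps, the signs of finitely many affine functions determine the level set and the
direction of motion. An orbit up to its first hit is a finite chain of segments with constant signs
(`IsSignFlow.exists_mem_hitSet`). For each of the countably many combinatorial types of chains, the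
starting points form a polyhedral set and the segment lengths are affine in the starting point. -/

namespace HamGame

/-! ### Zero sets of functions that are polynomial along lines -/

/-- `f` restricted to every line is given by a polynomial in the parameter of the line. -/
def PolyOnLines {E : Type*} [AddCommGroup E] [Module ℝ E] (f : E → ℝ) : Prop :=
  ∀ x y : E, ∃ P : Polynomial ℝ, ∀ t : ℝ, f (x + t • y) = P.eval t

namespace PolyOnLines

variable {E : Type*} [AddCommGroup E] [Module ℝ E]

lemma const (c : ℝ) : PolyOnLines (fun _ : E => c) := fun _ _ => ⟨Polynomial.C c, by simp⟩

lemma linear (f : E →ₗ[ℝ] ℝ) : PolyOnLines (fun x => f x) := fun x y =>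
  ⟨Polynomial.C (f x) + Polynomial.X * Polynomial.C (f y), fun t => by simp; ring⟩

lemma mul {f g : E → ℝ} (hf : PolyOnLines f) (hg : PolyOnLines g) :
    PolyOnLines (fun x => f x * g x) := fun x y => by
  obtain ⟨P, hP⟩ := hf x y
  obtain ⟨Q, hQ⟩ := hg x y
  exact ⟨P * Q, fun t => by simp [hP, hQ]⟩

lemma sub {f g : E → ℝ} (hf : PolyOnLines f) (hg : PolyOnLines g) :
    PolyOnLines (fun x => f x - g x) := fun x y => by
  obtain ⟨P, hP⟩ := hf x y
  obtain ⟨Q, hQ⟩ := hg x y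
  exact ⟨P - Q, fun t => by simp [hP, hQ]⟩

lemma sum {ι : Type*} (s : Finset ι) {f : ι → E → ℝ} (hf : ∀ i ∈ s, PolyOnLines (f i)) :
    PolyOnLines (fun x => ∑ i ∈ s, f i x) := fun x y => by
  classical
  choose! P hP using fun i hi => hf i hi x y
  refine ⟨∑ i ∈ s, P i, fun t => ?_⟩
  rw [Polynomial.eval_finsetSum]
  exact Finset.sum_congr rfl fun i hi => hP i hi t

lemma prod {ι : Type*} (s : Finset ι) {f : ι → E → ℝ} (hf : ∀ i ∈ s, PolyOnLines (f i)) :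
    PolyOnLines (fun x => ∏ i ∈ s, f i x) := fun x y => by
  classical
  choose! P hP using fun i hi => hf i hi x y
  refine ⟨∏ i ∈ s, P i, fun t => ?_⟩
  rw [Polynomial.eval_prod]
  exact Finset.prod_congr rfl fun i hi => hP i hi t

lemma det {m : Type*} [Fintype m] [DecidableEq m] {B : E → Matrix m m ℝ}
    (hB : ∀ i j, PolyOnLines (fun x => B x i j)) : PolyOnLines (fun x => (B x).det) := by
  simp only [Matrix.det_apply']
  exact sum _ fun σ _ => (const _).mul (prod _ fun i _ => hB _ _)

lemma adjugate {m : Type*} [Fintype m] [DecidableEq m] {B : E → Matrix m m ℝ}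
    (hB : ∀ i j, PolyOnLines (fun x => B x i j)) (i j : m) :
    PolyOnLines (fun x => (B x).adjugate i j) := by
  simp only [Matrix.adjugate_apply]
  refine det fun k l => ?_
  by_cases h : k = j
  · subst h
    simpa using const _
  · simpa [Matrix.updateRow_ne h] using hB k l

lemma matrix_mul {m : Type*} [Fintype m] {B C : E → Matrix m m ℝ}
    (hB : ∀ i j, PolyOnLines (fun x => B x i j)) (hC : ∀ i j, PolyOnLines (fun x => C x i j))
    (i j : m) : PolyOnLines (fun x => (B x * C x) i j) := by
  simp only [Matrix.mul_apply]
  exact sum _ fun k _ => (hB _ _).mul (hC _ _)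

end PolyOnLines

/-- Scale the part `Z` of the zero set in a ball about `x₀` by infinitely many distinct factors `r k
≥ 1`. As `f x₀ ≠ 0`, a line through `x₀` meets the zero set finitely often, so each point lies in
finitely many scaled copies. The copies share a bounded region, hence their measures tend to zero,
yet none is smaller than that of `Z`. -/
lemma PolyOnLines.measure_zeroSet {E : Type*} [NormedAddCommGroup E] [NormedSpace ℝ E]
    [FiniteDimensional ℝ E] [MeasurableSpace E] [BorelSpace E] (μ : Measure E)
    [μ.IsAddHaarMeasure] {f : E → ℝ} (hf : PolyOnLines f) (hc : Continuous f)
    (x₀ : E) (h₀ : f x₀ ≠ 0) : μ {x | f x = 0} = 0 := by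
  have hclosed : IsClosed {x | f x = 0} := isClosed_eq hc continuous_const
  have key : ∀ N : ℕ, μ ({x | f x = 0} ∩ Metric.closedBall x₀ N) = 0 := by
    intro N
    set Z := {x | f x = 0} ∩ Metric.closedBall x₀ N with hZ
    have hZc : IsCompact Z := by
      rw [hZ, inter_comm]
      exact (isCompact_closedBall x₀ (N : ℝ)).inter_right hclosed
    set r : ℕ → ℝ := fun k => 1 + 1 / ((k : ℝ) + 1) with hr
    have hr1 : ∀ k, 1 ≤ r k := fun k => by
      have : (0 : ℝ) ≤ 1 / ((k : ℝ) + 1) := by positivity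
      simp only [hr]; linarith
    have hr2 : ∀ k, r k ≤ 2 := fun k => by
      have : 1 / ((k : ℝ) + 1) ≤ 1 := by
        rw [div_le_one (by positivity)]
        have : (0 : ℝ) ≤ k := by positivity
        linarith
      simp only [hr]; linarith
    have hrinj : Function.Injective r := fun a b hab => by
      simp only [hr, add_right_inj, one_div, _root_.inv_inj] at hab
      have : a + 1 = b + 1 := by exact_mod_cast hab
      omega
    set W : ℕ → Set E := fun k => AffineMap.homothety x₀ (r k) '' Z with hW
    have hWc : ∀ k, IsCompact (W k) := fun k =>
      hZc.image (AffineMap.continuous_of_finiteDimensional _)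
    have hlow : ∀ k, μ Z ≤ μ (W k) := fun k => by
      rw [hW, Measure.addHaar_image_homothety]
      have h1 : (1 : ℝ) ≤ |r k ^ Module.finrank ℝ E| := by
        rw [abs_of_nonneg (by have := hr1 k; positivity)]
        exact one_le_pow₀ (hr1 k)
      calc μ Z = 1 * μ Z := (one_mul _).symm
        _ ≤ _ := by
          gcongr
          rw [← ENNReal.ofReal_one]
          exact ENNReal.ofReal_le_ofReal h1
    have hsub : ∀ k, W k ⊆ Metric.closedBall x₀ (2 * N) := fun k => by
      rintro _ ⟨z, hz, rfl⟩
      have hz2 : ‖z - x₀‖ ≤ N := by simpa [dist_eq_norm] using hz.2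
      rw [Metric.mem_closedBall, dist_eq_norm]
      simp only [AffineMap.homothety_apply, vsub_eq_sub, vadd_eq_add, add_sub_cancel_right,
        norm_smul, Real.norm_eq_abs]
      rw [abs_of_nonneg (by linarith [hr1 k])]
      exact mul_le_mul (hr2 k) hz2 (norm_nonneg _) (by norm_num)
    have hfin : ∀ x, {k | x ∈ W k}.Finite := fun x => by
      obtain ⟨P, hP⟩ := hf x₀ (x - x₀)
      have hP0 : P ≠ 0 := by
        rintro rfl
        have := hP 0
        simp at this
        exact h₀ this
      have hroots : (P.rootSet ℝ).Finite := Polynomial.rootSet_finite P ℝ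
      -- If `x ∈ W k`, then `f` vanishes at the parameter `(r k)⁻¹` of the line from `x₀` to `x`.
      refine (hroots.preimage (f := fun k => (r k)⁻¹)
        (fun a _ b _ hab => hrinj (inv_injective hab))).subset ?_
      rintro k ⟨z, hz, rfl⟩
      have hrk : r k ≠ 0 := by linarith [hr1 k]
      rw [mem_preimage, Polynomial.mem_rootSet]
      refine ⟨hP0, ?_⟩
      have := hP (r k)⁻¹
      simp only [AffineMap.homothety_apply, vsub_eq_sub, vadd_eq_add, add_sub_cancel_right,
        smul_smul, inv_mul_cancel₀ hrk, one_smul, add_sub_cancel] at this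
      rw [Polynomial.coe_aeval_eq_eval, ← this]
      exact hz.1
    have hlim : Filter.Tendsto (fun k => μ (W k)) Filter.atTop (nhds (μ ∅)) := by
      refine tendsto_measure_of_tendsto_indicator Filter.atTop (fun k => (hWc k).measurableSet)
        Metric.isClosed_closedBall.measurableSet
        (isCompact_closedBall x₀ (2 * (N : ℝ))).measure_lt_top.ne
        (Filter.Eventually.of_forall hsub) fun x => ?_
      have hev : ∀ᶠ k in Filter.atTop, x ∉ W k := by
        have := (hfin x).isCompact.compl_mem_cocompact
        rw [Filter.cocompact_eq_cofinite, Nat.cofinite_eq_atTop] at this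
        exact this
      simpa using hev
    rw [measure_empty] at hlim
    exact le_antisymm (ge_of_tendsto' hlim hlow) zero_le
  have hcov : {x | f x = 0} ⊆ ⋃ N : ℕ, {x | f x = 0} ∩ Metric.closedBall x₀ N := fun x hx => by
    obtain ⟨N, hN⟩ := exists_nat_ge (dist x x₀)
    exact mem_iUnion.2 ⟨N, hx, hN⟩
  exact measure_mono_null hcov (measure_iUnion_null key)

variable {n : ℕ}

/-! ### The reduced payoff matrix and its nondegeneracy -/

/-- The sum of all entries of `A⁻¹`. -/
noncomputable def invSum (A : Mat n) : ℝ := ∑ i, (A⁻¹ *ᵥ 1) i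

/-- The matrix `A⁻¹` followed by the projection onto `TΣ` along `A⁻¹ 1`. -/
noncomputable def projInv (A : Mat n) : Mat n :=
  A⁻¹ - (invSum A)⁻¹ • vecMulVec (A⁻¹ *ᵥ 1) (1 ᵥ* A⁻¹)

/-- The matrix `K` with `(M q)' = K d`, `(p' M)' = c' K` along the velocity given by `(c, d)`. -/
noncomputable def velMat (M A : Mat n) : Mat n := M * projInv A * M

/-- A matrix with as many or more equations than unknowns in `K d = v 1` only has the trivial
solution. -/
def RowNondeg (K : Mat n) : Prop :=
  ∀ (S T : Finset (Fin n)) (d : Fin n → ℝ) (v : ℝ), S.card = T.card + 1 →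
    (∀ j, j ∉ T → d j = 0) → (∀ i ∈ S, (K *ᵥ d) i = v) → d = 0

/-- Nondegeneracy for the row and the column player. -/
def Nondeg (K : Mat n) : Prop := RowNondeg K ∧ RowNondeg Kᵀ

lemma RowNondeg.neg {K : Mat n} (h : RowNondeg K) : RowNondeg (-K) := fun S T d v hc hd hv =>
  h S T d (-v) hc hd fun i hi => by
    have := hv i hi
    rw [neg_mulVec, Pi.neg_apply] at this
    linarith

lemma Nondeg.neg {K : Mat n} (h : Nondeg K) : Nondeg (-K) :=
  ⟨h.1.neg, by rw [transpose_neg]; exact h.2.neg⟩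

lemma Nondeg.transpose {K : Mat n} (h : Nondeg K) : Nondeg Kᵀ :=
  ⟨h.2, by rw [transpose_transpose]; exact h.1⟩

lemma invSum_transpose (A : Mat n) : invSum Aᵀ = invSum A := by
  simp only [invSum, ← transpose_nonsing_inv, mulVec, dotProduct, transpose_apply, Pi.one_apply,
    mul_one]
  exact Finset.sum_comm

lemma projInv_transpose (A : Mat n) : projInv Aᵀ = (projInv A)ᵀ := by
  rw [projInv, projInv, transpose_sub, transpose_smul, transpose_vecMulVec, invSum_transpose,
    ← transpose_nonsing_inv, mulVec_transpose, vecMul_transpose]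

/-- Hence the column player's half of `Nondeg` is the row player's half for the transposed pair. -/
lemma velMat_transpose (M A : Mat n) : velMat Mᵀ Aᵀ = (velMat M A)ᵀ := by
  simp only [velMat, transpose_mul, projInv_transpose, Matrix.mul_assoc]

lemma inv_neg_of_det_ne_zero {A : Mat n} (hA : A.det ≠ 0) : (-A)⁻¹ = - A⁻¹ :=
  inv_eq_right_inv (by rw [neg_mul_neg, mul_nonsing_inv _ hA.isUnit])

lemma invSum_neg {A : Mat n} (hA : A.det ≠ 0) : invSum (-A) = - invSum A := by
  simp [invSum, inv_neg_of_det_ne_zero hA, neg_mulVec]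

lemma projInv_neg {A : Mat n} (hA : A.det ≠ 0) : projInv (-A) = - projInv A := by
  rw [projInv, projInv, inv_neg_of_det_ne_zero hA, invSum_neg hA, neg_mulVec, vecMul_neg,
    neg_vecMulVec, vecMulVec_neg, neg_neg, _root_.inv_neg, neg_smul]
  abel

lemma velMat_neg (M : Mat n) {A : Mat n} (hA : A.det ≠ 0) : velMat M (-A) = - velMat M A := by
  simp [velMat, projInv_neg hA]

/-! ### Clearing denominators, and bordered minors -/

/-- A polynomial multiple of `velMat`. -/
noncomputable def polyMat (M A : Mat n) : Mat n :=
  M * ((∑ i, ∑ j, A.adjugate i j) • A.adjugate -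
    Matrix.of fun i j => (∑ k, A.adjugate i k) * ∑ k, A.adjugate k j) * M

lemma adjugate_eq_smul_inv {A : Mat n} (hA : A.det ≠ 0) : A.adjugate = A.det • A⁻¹ := by
  rw [inv_def, Ring.inverse_eq_inv', smul_smul, mul_inv_cancel₀ hA, one_smul]

lemma polyMat_eq {M A : Mat n} (hA : A.det ≠ 0) (hs : invSum A ≠ 0) :
    polyMat M A = (A.det ^ 2 * invSum A) • velMat M A := by
  have h1 : (∑ i, ∑ j, A.adjugate i j) = A.det * invSum A := by
    simp [adjugate_eq_smul_inv hA, invSum, mulVec, dotProduct, Finset.mul_sum]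
  have h2 : (Matrix.of fun i j => (∑ k, A.adjugate i k) * ∑ k, A.adjugate k j) =
      (A.det ^ 2) • vecMulVec (A⁻¹ *ᵥ 1) (1 ᵥ* A⁻¹) := by
    ext i j
    simp only [adjugate_eq_smul_inv hA, of_apply, Matrix.smul_apply, vecMulVec_apply, mulVec, vecMul,
      dotProduct, Pi.one_apply, mul_one, one_mul, smul_eq_mul, ← Finset.mul_sum]
    ring
  rw [polyMat, h1, h2, velMat, projInv, adjugate_eq_smul_inv hA, smul_smul,
    ← Matrix.smul_mul, ← Matrix.mul_smul, _root_.smul_sub, smul_smul]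
  congr 4
  · ring
  · field_simp

/-- The bordered minor of `K` with columns `T` and one more row than columns, given by `e`. -/
noncomputable def borderedMinor (K : Mat n) (T : Finset (Fin n)) (e : Option T ↪ Fin n) : ℝ :=
  (Matrix.of fun i j : Option T => Option.elim j (1 : ℝ) fun k => K (e i) k).det

lemma sum_of_support {T : Finset (Fin n)} {d : Fin n → ℝ} (hd : ∀ j, j ∉ T → d j = 0)
    (a : Fin n → ℝ) : ∑ j : T, a j * d j = ∑ j, a j * d j := by
  rw [Finset.univ_eq_attach, Finset.sum_attach T (fun j => a j * d j)]
  exact Finset.sum_subset (Finset.subset_univ _) fun j _ hj => by simp [hd j hj]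

/-- The equations in `RowNondeg` are a homogeneous square system in `v` and the `d j` with `j ∈ T`;
its matrix is the bordered minor. The factor `κ` allows `polyMat` to stand in for `velMat`. -/
lemma rowNondeg_of_borderedMinor {K : Mat n} {κ : ℝ}
    (h : ∀ T e, borderedMinor (κ • K) T e ≠ 0) : RowNondeg K := by
  intro S T d v hc hd hv
  have hcard : Fintype.card (Option T) = Fintype.card S := by simp [hc]
  let φ : Option T ≃ S := Fintype.equivOfCardEq hcard
  let e : Option T ↪ Fin n := φ.toEmbedding.trans (Function.Embedding.subtype _)
  have hdet := h T e
  by_contra hne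
  apply hdet
  rw [borderedMinor, ← exists_mulVec_eq_zero_iff]
  -- The border unknown absorbs the common value, scaled by `κ` like the matrix.
  refine ⟨fun j => Option.elim j (-(κ * v)) fun k => d k, fun h0 => hne ?_, ?_⟩
  · funext j
    by_cases hj : j ∈ T
    · exact congrFun h0 (some ⟨j, hj⟩)
    · exact hd j hj
  · funext i
    have := hv (e i) (φ i).2
    simp only [mulVec, dotProduct, Fintype.sum_option, of_apply, Option.elim, Matrix.smul_apply,
      smul_eq_mul, one_mul, Pi.zero_apply]
    rw [sum_of_support hd (fun j => κ * K (e i) j)]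
    simp only [mul_assoc]
    rw [← Finset.mul_sum]
    simp only [mulVec, dotProduct] at this
    rw [this]
    ring

/-- For `M = 1` and `A` the inverse of a permutation matrix `W`, `projInv A` is `W` with `1 / n`
subtracted from every entry. The permutation sends each column `j ∈ T` to the row `e (some j)`. So
`W` is the identity on these rows and the columns `T`, and its row `e none` vanishes there.
Subtracting that row from the others leaves a nonzero multiple of the identity. -/
lemma exists_borderedMinor_ne_zero (hn : 2 ≤ n) (T : Finset (Fin n)) (e : Option T ↪ Fin n) :
    ∃ A : Mat n, A.det ≠ 0 ∧ invSum A ≠ 0 ∧ borderedMinor (polyMat 1 A) T e ≠ 0 := by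
  classical
  let e' : {x // x ∈ T} ≃ {x // x ∈ Set.range fun j : T => e (some j)} :=
    Equiv.ofInjective _ fun a b hab => by simpa using e.injective hab
  let σ : Equiv.Perm (Fin n) := Equiv.extendSubtype e'
  have hσ : ∀ j : T, σ j = e (some j) := fun j => Equiv.extendSubtype_apply_of_mem e' _ j.2
  let W : Mat n := Matrix.of fun i j => if i = σ j then (1 : ℝ) else 0
  have hW1 : Wᵀ * W = 1 := by
    ext i j
    simp [W, mul_apply, one_apply, eq_comm]
  have hinv : (Wᵀ)⁻¹ = W := inv_eq_right_inv hW1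
  have hdet : (Wᵀ).det ≠ 0 := fun h0 => by
    have := congrArg det hW1
    rw [det_mul, h0] at this
    simp at this
  have hrow : W *ᵥ 1 = 1 := by
    funext i
    simp only [W, mulVec, dotProduct, of_apply, Pi.one_apply, mul_one]
    rw [Finset.sum_eq_single (σ.symm i)] <;> simp
    intro b hb hbi
    exact hb (by simp [hbi])
  have hcol : 1 ᵥ* W = 1 := by
    funext j
    simp [W, vecMul, dotProduct]
  have hn0 : (n : ℝ) ≠ 0 := by
    have : n ≠ 0 := by omega
    exact_mod_cast this
  have hs : invSum Wᵀ = n := by simp [invSum, hinv, hrow]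
  have hs0 : invSum Wᵀ ≠ 0 := by rw [hs]; exact hn0
  refine ⟨Wᵀ, hdet, hs0, fun h0 => ?_⟩
  rw [borderedMinor, ← exists_mulVec_eq_zero_iff] at h0
  obtain ⟨w, hw0, hw⟩ := h0
  set κ := (Wᵀ).det ^ 2 * invSum Wᵀ with hκ
  have hκ0 : κ ≠ 0 := mul_ne_zero (pow_ne_zero _ hdet) hs0
  have hent : ∀ i j, polyMat 1 Wᵀ i j = κ * ((if i = σ j then 1 else 0) - (n : ℝ)⁻¹) := by
    intro i j
    rw [polyMat_eq hdet hs0, velMat, projInv, hinv, hrow, hcol, hs]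
    simp [W, hκ, hs]
  have hrows : ∀ i : Option T, w none + ∑ k : T, κ * ((if e i = e (some k) then 1 else 0) -
      (n : ℝ)⁻¹) * w (some k) = 0 := fun i => by
    have := congrFun hw i
    simpa only [mulVec, dotProduct, Fintype.sum_option, of_apply, Option.elim, one_mul,
      Pi.zero_apply, hent, hσ] using this
  have hn' := hrows none
  simp only [EmbeddingLike.apply_eq_iff_eq, reduceCtorEq, if_false, zero_sub] at hn'
  have hsome : ∀ j : T, w (some j) = 0 := fun j => by
    have := hrows (some j)
    simp only [EmbeddingLike.apply_eq_iff_eq, Option.some.injEq, mul_sub, sub_mul,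
      Finset.sum_sub_distrib] at this
    have h2 : ∑ k : T, κ * (if j = k then 1 else 0) * w (some k) = κ * w (some j) := by
      rw [Finset.sum_eq_single j] <;> simp +contextual [eq_comm]
    rw [h2] at this
    have h3 : κ * w (some j) = 0 := by
      have h4 : ∑ k : T, κ * -(n : ℝ)⁻¹ * w (some k) =
        - ∑ k : T, κ * (n : ℝ)⁻¹ * w (some k) := by
        rw [← Finset.sum_neg_distrib]
        exact Finset.sum_congr rfl fun k _ => by ring
      rw [h4] at hn'
      linarith
    exact (mul_eq_zero.1 h3).resolve_left hκ0
  apply hw0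
  funext i
  cases i with
  | none => simpa [hsome] using hn'
  | some j => exact hsome j

/-! ### Matrices with a completely mixed equilibrium -/

/-- `(p, q)` is a completely mixed equilibrium of `M` of value `μ`, and `M` and its transpose are
injective on `TΣ` modulo constants. -/
structure IsEquil (M : Mat n) (p q : Fin n → ℝ) (μ : ℝ) : Prop where
  p_pos : ∀ i, 0 < p i
  q_pos : ∀ j, 0 < q j
  p_sum : ∑ i, p i = 1
  q_sum : ∑ j, q j = 1
  vecMul_eq : p ᵥ* M = fun _ => μ
  mulVec_eq : M *ᵥ q = fun _ => μ
  inj_right : ∀ v : Fin n → ℝ, ∑ j, v j = 0 → ∀ ν : ℝ, (M *ᵥ v = fun _ => ν) → v = 0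
  inj_left : ∀ u : Fin n → ℝ, ∑ i, u i = 0 → ∀ ν : ℝ, (u ᵥ* M = fun _ => ν) → u = 0

lemma exists_pos_add_smul (q v : Fin n → ℝ) (hq : ∀ j, 0 < q j) :
    ∃ ε > 0, ∀ j, 0 < q j + ε * v j := by
  have h : ∀ᶠ ε : ℝ in nhds 0, ∀ j, 0 < q j + ε * v j := by
    rw [Filter.eventually_all]
    intro j
    have : Filter.Tendsto (fun ε : ℝ => q j + ε * v j) (nhds 0) (nhds (q j + 0 * v j)) :=
      (Continuous.tendsto (by fun_prop) 0)
    rw [zero_mul, add_zero] at this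
    exact this.eventually_const_lt (hq j)
  have h2 : ∀ᶠ ε : ℝ in nhdsWithin 0 (Ioi 0), 0 < ε ∧ ∀ j, 0 < q j + ε * v j :=
    (eventually_mem_nhdsWithin).and (h.filter_mono nhdsWithin_le_nhds)
  exact h2.exists

/-- A tangent vector that `M` maps to a constant could be added, scaled down, to the positive
strategy; uniqueness makes it zero. The two values agree because both equal `p' M q`. -/
lemma exists_equil {M : Mat n} (hM : M ∈ LI n) : ∃ p q μ, IsEquil M p q μ := by
  obtain ⟨⟨p, q⟩, ⟨hmem, hp, hq, ⟨lam, hlam⟩, ⟨mu, hmu⟩⟩, huniq⟩ := hM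
  simp only at hp hq hlam hmu
  have hps : ∑ i, p i = 1 := hmem.1.2
  have hqs : ∑ i, q i = 1 := hmem.2.2
  have hlm : lam = mu := by
    have h1 : (p ᵥ* M) ⬝ᵥ q = lam := by
      rw [hlam]; simp [dotProduct, ← Finset.mul_sum, hqs]
    have h2 : p ⬝ᵥ (M *ᵥ q) = mu := by
      rw [hmu]; simp [dotProduct, ← Finset.sum_mul, hps]
    rw [← h1, ← h2, dotProduct_mulVec]
  subst hlm
  refine ⟨p, q, lam, hp, hq, hps, hqs, hlam, hmu, fun v hv ν hν => ?_, fun u hu ν hν => ?_⟩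
  · obtain ⟨ε, hε, hpos⟩ := exists_pos_add_smul q v hq
    have h := huniq (p, q + ε • v) ⟨⟨hmem.1, fun j => (hpos j).le, by
      simp [Finset.sum_add_distrib, ← Finset.mul_sum, hv, hqs]⟩, hp, hpos, ⟨lam, hlam⟩,
      ⟨lam + ε * ν, by
        simp only [mulVec_add, mulVec_smul, hmu, hν]
        rfl⟩⟩
    have h2 : ε • v = 0 := by simpa using congrArg Prod.snd h
    exact (smul_eq_zero.1 h2).resolve_left hε.ne'
  · obtain ⟨ε, hε, hpos⟩ := exists_pos_add_smul p u hp
    have h := huniq (p + ε • u, q) ⟨⟨⟨fun j => (hpos j).le, by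
      simp [Finset.sum_add_distrib, ← Finset.mul_sum, hu, hps]⟩, hmem.2⟩, hpos, hq,
      ⟨lam + ε * ν, by
        simp only [add_vecMul, smul_vecMul, hlam, hν]
        rfl⟩, ⟨lam, hmu⟩⟩
    have h2 : ε • u = 0 := by simpa using congrArg Prod.fst h
    exact (smul_eq_zero.1 h2).resolve_left hε.ne'

/-! ### Cramer's rule for the equilibrium, and openness of `LI` -/

/-- The matrix `M` bordered by ones. -/
def bordered (M : Mat n) : Matrix (Option (Fin n)) (Option (Fin n)) ℝ :=
  Matrix.of fun i j => Option.elim i (Option.elim j 0 fun _ => 1)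
    fun i => Option.elim j 1 fun j => M i j

lemma bordered_mulVec_some (M : Mat n) (w : Option (Fin n) → ℝ) (i : Fin n) :
    (bordered M *ᵥ w) (some i) = w none + (M *ᵥ fun j => w (some j)) i := by
  simp [bordered, mulVec, dotProduct, Fintype.sum_option]

lemma bordered_mulVec_none (M : Mat n) (w : Option (Fin n) → ℝ) :
    (bordered M *ᵥ w) none = ∑ j, w (some j) := by
  simp [bordered, mulVec, dotProduct, Fintype.sum_option]

lemma IsEquil.transpose {M : Mat n} {p q : Fin n → ℝ} {μ : ℝ} (h : IsEquil M p q μ) :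
    IsEquil Mᵀ q p μ where
  p_pos := h.q_pos
  q_pos := h.p_pos
  p_sum := h.q_sum
  q_sum := h.p_sum
  vecMul_eq := by rw [vecMul_transpose]; exact h.mulVec_eq
  mulVec_eq := by rw [mulVec_transpose]; exact h.vecMul_eq
  inj_right := fun v hv ν hν => h.inj_left v hv ν (by rwa [mulVec_transpose] at hν)
  inj_left := fun v hv ν hν => h.inj_right v hv ν (by rwa [vecMul_transpose] at hν)

lemma IsEquil.neg {M : Mat n} {p q : Fin n → ℝ} {μ : ℝ} (h : IsEquil M p q μ) :
    IsEquil (-M) p q (-μ) where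
  p_pos := h.p_pos
  q_pos := h.q_pos
  p_sum := h.p_sum
  q_sum := h.q_sum
  vecMul_eq := by rw [vecMul_neg, h.vecMul_eq]; rfl
  mulVec_eq := by rw [neg_mulVec, h.mulVec_eq]; rfl
  inj_right := fun v hv ν hν => h.inj_right v hv (-ν) (by
    rw [neg_mulVec] at hν; rw [← neg_neg (M *ᵥ v), hν]; rfl)
  inj_left := fun v hv ν hν => h.inj_left v hv (-ν) (by
    rw [vecMul_neg] at hν; rw [← neg_neg (v ᵥ* M), hν]; rfl)

lemma IsEquil.det_bordered_ne_zero {M : Mat n} {p q : Fin n → ℝ} {μ : ℝ} (h : IsEquil M p q μ) :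
    (bordered M).det ≠ 0 := by
  rw [Ne, ← exists_mulVec_eq_zero_iff]
  rintro ⟨w, hw0, hw⟩
  have h1 : ∑ j, w (some j) = 0 := by rw [← bordered_mulVec_none M, hw]; rfl
  have h2 : ∀ i, (M *ᵥ fun j => w (some j)) i = - w none := fun i => by
    have := congrFun hw (some i)
    rw [bordered_mulVec_some, Pi.zero_apply] at this
    linarith
  have h3 := h.inj_right _ h1 (- w none) (funext h2)
  have hnn : w none = 0 := by
    have hp := h.p_sum
    rcases isEmpty_or_nonempty (Fin n) with he | ⟨⟨i⟩⟩
    · simp at hp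
    · have := h2 i
      rw [h3] at this
      simp at this
      linarith
  apply hw0
  funext i
  cases i with
  | none => exact hnn
  | some j => exact congrFun h3 j

/-- The vector `(-μ, q)` solves the bordered system whose right-hand side is the unit vector at
`none`. Cramer's rule gives `q j` as adjugate entry over determinant, and multiplying by the squared
determinant turns positivity into a polynomial inequality. -/
lemma IsEquil.adjugate_pos {M : Mat n} {p q : Fin n → ℝ} {μ : ℝ} (h : IsEquil M p q μ)
    (j : Fin n) : 0 < (bordered M).det * (bordered M).adjugate (some j) none := by
  set w : Option (Fin n) → ℝ := fun j => Option.elim j (-μ) q with hw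
  have h1 : bordered M *ᵥ w = Pi.single none 1 := by
    funext i
    cases i with
    | none => rw [bordered_mulVec_none]; simp [hw, h.q_sum]
    | some i =>
      rw [bordered_mulVec_some]
      have : (M *ᵥ fun j => w (some j)) i = μ := congrFun h.mulVec_eq i
      rw [this]; simp [hw]
  have h2 : (bordered M).adjugate *ᵥ (bordered M *ᵥ w) = (bordered M).det • w := by
    rw [mulVec_mulVec, adjugate_mul, smul_mulVec, one_mulVec]
  rw [h1, mulVec_single_one] at h2
  have h3 := congrFun h2 (some j)
  simp only [col_apply, Pi.smul_apply, smul_eq_mul, hw, Option.elim] at h3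
  rw [h3, ← mul_assoc]
  have h4 := h.det_bordered_ne_zero
  have h5 := h.q_pos j
  have : 0 < (bordered M).det * (bordered M).det := mul_self_pos.2 h4
  positivity

lemma exists_of_adjugate_pos (hn : 2 ≤ n) {M : Mat n}
    (h : ∀ j, 0 < (bordered M).det * (bordered M).adjugate (some j) none) :
    (bordered M).det ≠ 0 ∧ ∃ q : Fin n → ℝ, (∀ j, 0 < q j) ∧ ∑ j, q j = 1 ∧
      ∃ μ : ℝ, M *ᵥ q = fun _ => μ := by
  have hdet : (bordered M).det ≠ 0 := fun h0 => by
    have := h ⟨0, by omega⟩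
    rw [h0, zero_mul] at this
    exact lt_irrefl _ this
  refine ⟨hdet, ?_⟩
  set w : Option (Fin n) → ℝ := (bordered M)⁻¹ *ᵥ Pi.single none 1 with hw
  have hwj : ∀ j, w j = ((bordered M).det)⁻¹ * (bordered M).adjugate j none := fun j => by
    rw [hw, mulVec_single_one, inv_def, Ring.inverse_eq_inv']
    rfl
  have h1 : bordered M *ᵥ w = Pi.single none 1 := by
    rw [hw, mulVec_mulVec, mul_nonsing_inv _ hdet.isUnit, one_mulVec]
  refine ⟨fun j => w (some j), fun j => ?_, ?_, - w none, ?_⟩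
  · have h2 := h j
    change 0 < w (some j)
    rw [hwj]
    have : ((bordered M).det)⁻¹ * (bordered M).adjugate (some j) none =
      ((bordered M).det * (bordered M).adjugate (some j) none) / ((bordered M).det ^ 2) := by
      field_simp
    rw [this]
    positivity
  · rw [← bordered_mulVec_none M, h1]; simp
  · funext i
    have := congrFun h1 (some i)
    rw [bordered_mulVec_some] at this
    simp at this
    linarith

lemma eq_of_det_bordered_ne_zero {M : Mat n} (h : (bordered M).det ≠ 0) {q q' : Fin n → ℝ}
    {μ μ' : ℝ} (hq : ∑ j, q j = 1) (hq' : ∑ j, q' j = 1) (hM : M *ᵥ q = fun _ => μ)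
    (hM' : M *ᵥ q' = fun _ => μ') : q = q' := by
  by_contra hne
  apply h
  rw [← exists_mulVec_eq_zero_iff]
  refine ⟨fun j => Option.elim j (μ' - μ) (q - q'), fun h0 => hne ?_, ?_⟩
  · funext j
    have := congrFun h0 (some j)
    simp at this
    linarith
  · funext i
    cases i with
    | none => rw [bordered_mulVec_none]; simp [hq, hq']
    | some i =>
      rw [bordered_mulVec_some]
      have h1 := congrFun hM i
      have h2 := congrFun hM' i
      have : (M *ᵥ (q - q')) i = μ - μ' := by rw [mulVec_sub, Pi.sub_apply, h1, h2]
      change (μ' - μ) + (M *ᵥ (q - q')) i = 0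
      rw [this]; ring

/-- Cramer's rule reads `q` off `M` and `p` off `Mᵀ`. The description consists of strict polynomial
inequalities, whence openness. -/
lemma LI_eq (hn : 2 ≤ n) : LI n =
    {M | (∀ j, 0 < (bordered M).det * (bordered M).adjugate (some j) none) ∧
      ∀ j, 0 < (bordered Mᵀ).det * (bordered Mᵀ).adjugate (some j) none} := by
  ext M
  constructor
  · intro hM
    obtain ⟨p, q, μ, h⟩ := exists_equil hM
    exact ⟨h.adjugate_pos, h.transpose.adjugate_pos⟩
  · rintro ⟨h1, h2⟩
    obtain ⟨hd, q, hq, hqs, μ, hμ⟩ := exists_of_adjugate_pos hn h1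
    obtain ⟨hd', p, hp, hps, lam, hlam⟩ := exists_of_adjugate_pos hn h2
    refine ⟨(p, q), ⟨⟨⟨fun i => (hp i).le, hps⟩, ⟨fun i => (hq i).le, hqs⟩⟩, hp, hq,
      ⟨lam, by rwa [mulVec_transpose] at hlam⟩, ⟨μ, hμ⟩⟩, ?_⟩
    rintro ⟨p', q'⟩ ⟨hmem, -, -, ⟨lam', hlam'⟩, ⟨μ', hμ'⟩⟩
    refine Prod.ext ?_ ?_
    · refine (eq_of_det_bordered_ne_zero hd' hps hmem.1.2 hlam (μ' := lam') ?_).symm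
      rw [mulVec_transpose]; exact hlam'
    · exact (eq_of_det_bordered_ne_zero hd hqs hmem.2.2 hμ hμ').symm

lemma continuous_bordered : Continuous (bordered : Mat n → _) := by
  refine continuous_matrix fun i j => ?_
  cases i <;> cases j
  · exact continuous_const
  · exact continuous_const
  · exact continuous_const
  · exact continuous_id.matrix_elem _ _

lemma isOpen_LI (hn : 2 ≤ n) : IsOpen (LI n) := by
  rw [LI_eq hn]
  have key : ∀ j : Fin n, Continuous fun M : Mat n =>
      (bordered M).det * (bordered M).adjugate (some j) none := fun j =>
    continuous_bordered.matrix_det.mul (continuous_bordered.matrix_adjugate.matrix_elem _ _)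
  simp only [ofPred_and, ofPred_forall]
  refine IsOpen.inter (isOpen_iInter_of_finite fun j => ?_) (isOpen_iInter_of_finite fun j => ?_)
  · exact isOpen_lt continuous_const (key j)
  · exact isOpen_lt continuous_const ((key j).comp continuous_id.matrix_transpose)

/-! ### The generic set of pairs of matrices -/

/-- The genericity conditions on a pair of matrices under which the theorem holds. -/
structure Good (M A : Mat n) : Prop where
  mem_LI : M ∈ LI n
  det_ne_zero : A.det ≠ 0
  invSum_ne_zero : invSum A ≠ 0
  nondeg : Nondeg (velMat M A)

/-- Changing the sign of `A` reverses `ω` and the field, so every result on forward time also serves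
backward time. -/
lemma Good.neg {M A : Mat n} (h : Good M A) : Good M (-A) where
  mem_LI := h.mem_LI
  det_ne_zero := by
    rw [det_neg]
    exact mul_ne_zero (pow_ne_zero _ (by norm_num)) h.det_ne_zero
  invSum_ne_zero := by rw [invSum_neg h.det_ne_zero]; exact neg_ne_zero.2 h.invSum_ne_zero
  nondeg := by rw [velMat_neg M h.det_ne_zero]; exact h.nondeg.neg

/-- The index set of the polynomials that have to be nonzero. -/
abbrev MinorIndex (n : ℕ) : Type :=
  Option ((Σ T : Finset (Fin n), (Option T ↪ Fin n)) × Bool)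

/-- The polynomials in the entries of `M` and `A` that have to be nonzero. -/
noncomputable def minorPoly (k : MinorIndex n) (B : Mat n × Mat n) : ℝ :=
  match k with
  | none => B.2.det * ∑ i, ∑ j, B.2.adjugate i j
  | some (⟨T, e⟩, true) => borderedMinor (polyMat B.1 B.2) T e
  | some (⟨T, e⟩, false) => borderedMinor (polyMat B.1ᵀ B.2ᵀ) T e

lemma sum_adjugate {A : Mat n} (hA : A.det ≠ 0) :
    (∑ i, ∑ j, A.adjugate i j) = A.det * invSum A := by
  simp [adjugate_eq_smul_inv hA, invSum, mulVec, dotProduct, Finset.mul_sum]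

lemma good_of_minorPoly {M A : Mat n} (hM : M ∈ LI n) (h : ∀ k, minorPoly k (M, A) ≠ 0) :
    Good M A := by
  -- This polynomial equals `A.det ^ 2 * invSum A` once `A` is invertible, so it yields two of the
  -- conditions at once.
  have h0 : A.det * ∑ i, ∑ j, A.adjugate i j ≠ 0 := h none
  have hA : A.det ≠ 0 := left_ne_zero_of_mul h0
  have hs : invSum A ≠ 0 := by
    rw [sum_adjugate hA] at h0
    exact right_ne_zero_of_mul (right_ne_zero_of_mul h0)
  refine ⟨hM, hA, hs, rowNondeg_of_borderedMinor (κ := A.det ^ 2 * invSum A) fun T e => ?_, ?_⟩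
  · rw [← polyMat_eq hA hs]
    exact h (some (⟨T, e⟩, true))
  · rw [← velMat_transpose]
    refine rowNondeg_of_borderedMinor (κ := Aᵀ.det ^ 2 * invSum Aᵀ) fun T e => ?_
    rw [← polyMat_eq (by rwa [det_transpose]) (by rwa [invSum_transpose])]
    exact h (some (⟨T, e⟩, false))

lemma minorPoly_exists_ne_zero (hn : 2 ≤ n) (k : MinorIndex n) : ∃ B, minorPoly k B ≠ 0 := by
  match k with
  | none =>
    obtain ⟨A, hA, hs, -⟩ := exists_borderedMinor_ne_zero hn ∅
      ⟨fun _ => (⟨0, by omega⟩ : Fin n), fun a b _ => Subsingleton.elim a b⟩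
    refine ⟨(1, A), mul_ne_zero hA ?_⟩
    rw [sum_adjugate hA]
    exact mul_ne_zero hA hs
  | some (⟨T, e⟩, true) =>
    obtain ⟨A, -, -, h⟩ := exists_borderedMinor_ne_zero hn T e
    exact ⟨(1, A), h⟩
  | some (⟨T, e⟩, false) =>
    obtain ⟨A, -, -, h⟩ := exists_borderedMinor_ne_zero hn T e
    refine ⟨(1, Aᵀ), ?_⟩
    simpa [minorPoly] using h

lemma continuous_polyMat : Continuous fun B : Mat n × Mat n => polyMat B.1 B.2 := by
  have hadj : ∀ i j, Continuous fun B : Mat n × Mat n => B.2.adjugate i j := fun i j =>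
    continuous_snd.matrix_adjugate.matrix_elem _ _
  have h0 : Continuous fun B : Mat n × Mat n => ∑ i, ∑ j, B.2.adjugate i j :=
    continuous_finsetSum _ fun i _ => continuous_finsetSum _ fun j _ => hadj i j
  have h1 : Continuous fun B : Mat n × Mat n => (∑ i, ∑ j, B.2.adjugate i j) • B.2.adjugate :=
    h0.smul continuous_snd.matrix_adjugate
  have h2 : Continuous fun B : Mat n × Mat n => (Matrix.of fun i j =>
      (∑ k, B.2.adjugate i k) * ∑ k, B.2.adjugate k j : Mat n) :=
    continuous_matrix fun i j => Continuous.mul (continuous_finsetSum _ fun _ _ => hadj _ _)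
      (continuous_finsetSum _ fun _ _ => hadj _ _)
  exact (continuous_fst.matrix_mul (h1.sub h2)).matrix_mul continuous_fst

lemma continuous_borderedMinor (T : Finset (Fin n)) (e : Option T ↪ Fin n) :
    Continuous fun K : Mat n => borderedMinor K T e := by
  refine Continuous.matrix_det (continuous_matrix fun i j => ?_)
  cases j
  · exact continuous_const
  · exact continuous_id.matrix_elem _ _

lemma continuous_minorPoly (k : MinorIndex n) : Continuous (minorPoly k) := by
  match k with
  | none =>
    have h0 : Continuous fun B : Mat n × Mat n => ∑ i, ∑ j, B.2.adjugate i j :=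
      continuous_finsetSum _ fun i _ => continuous_finsetSum _ fun j _ =>
        continuous_snd.matrix_adjugate.matrix_elem i j
    have h1 : Continuous fun B : Mat n × Mat n => B.2.det := continuous_snd.matrix_det
    exact h1.mul h0
  | some (⟨T, e⟩, true) => exact (continuous_borderedMinor T e).comp continuous_polyMat
  | some (⟨T, e⟩, false) =>
    have h0 : Continuous fun B : Mat n × Mat n => (B.1ᵀ, B.2ᵀ) :=
      continuous_fst.matrix_transpose.prodMk continuous_snd.matrix_transpose
    exact (continuous_borderedMinor T e).comp (continuous_polyMat.comp h0)

section Poly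

variable {E : Type*} [AddCommGroup E] [Module ℝ E] {B C : E → Mat n}

lemma PolyOnLines.polyMat (hB : ∀ i j, PolyOnLines fun x => B x i j)
    (hC : ∀ i j, PolyOnLines fun x => C x i j) (i j : Fin n) :
    PolyOnLines fun x => polyMat (B x) (C x) i j := by
  refine PolyOnLines.matrix_mul (PolyOnLines.matrix_mul hB fun i j => ?_) hB i j
  simp only [Matrix.sub_apply, Matrix.smul_apply, smul_eq_mul, of_apply]
  exact ((PolyOnLines.sum _ fun _ _ => PolyOnLines.sum _ fun _ _ => PolyOnLines.adjugate hC _ _).mul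
    (PolyOnLines.adjugate hC _ _)).sub ((PolyOnLines.sum _ fun _ _ => PolyOnLines.adjugate hC _ _).mul
    (PolyOnLines.sum _ fun _ _ => PolyOnLines.adjugate hC _ _))

lemma PolyOnLines.borderedMinor (hB : ∀ i j, PolyOnLines fun x => B x i j)
    (T : Finset (Fin n)) (e : Option T ↪ Fin n) :
    PolyOnLines fun x => borderedMinor (B x) T e := by
  refine PolyOnLines.det fun i j => ?_
  cases j
  · exact PolyOnLines.const _
  · exact hB _ _

lemma PolyOnLines.minorPoly (hB : ∀ i j, PolyOnLines fun x => B x i j)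
    (hC : ∀ i j, PolyOnLines fun x => C x i j) (k : MinorIndex n) :
    PolyOnLines fun x => minorPoly k (B x, C x) := by
  match k with
  | none =>
    exact (PolyOnLines.det hC).mul
      (PolyOnLines.sum _ fun _ _ => PolyOnLines.sum _ fun _ _ => PolyOnLines.adjugate hC _ _)
  | some (⟨T, e⟩, true) => exact PolyOnLines.borderedMinor (PolyOnLines.polyMat hB hC) T e
  | some (⟨T, e⟩, false) =>
    exact PolyOnLines.borderedMinor (PolyOnLines.polyMat (B := fun x => (B x)ᵀ)
      (C := fun x => (C x)ᵀ) (fun i j => hB j i) (fun i j => hC j i)) T e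

end Poly

/-- The generic set of the theorem. -/
def genericSet (n : ℕ) : Set (Mat n × Mat n) :=
  {B | B.1 ∈ LI n ∧ ∀ k, minorPoly k B ≠ 0}

lemma isOpen_genericSet (hn : 2 ≤ n) : IsOpen (genericSet n) := by
  simp only [genericSet, ofPred_and, ofPred_forall]
  exact ((isOpen_LI hn).preimage continuous_fst).inter
    (isOpen_iInter_of_finite fun k => isOpen_ne_fun (continuous_minorPoly k) continuous_const)

-- Outside the generic set one of finitely many polynomials vanishes, and none of them is
-- identically zero.
set_option synthInstance.maxSize 1000 in
lemma volume_compl_genericSet (hn : 2 ≤ n) :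
    volume {B : (Fin n → Fin n → ℝ) × (Fin n → Fin n → ℝ) |
      (Matrix.of B.1, Matrix.of B.2) ∈ (LI n ×ˢ univ) \ genericSet n} = 0 := by
  have hsub : {B : (Fin n → Fin n → ℝ) × (Fin n → Fin n → ℝ) |
      (Matrix.of B.1, Matrix.of B.2) ∈ (LI n ×ˢ univ) \ genericSet n} ⊆
      ⋃ k : MinorIndex n, {B | minorPoly k (Matrix.of B.1, Matrix.of B.2) = 0} := by
    rintro B ⟨⟨h1, -⟩, h2⟩
    by_contra h3
    simp only [mem_iUnion, mem_ofPred_eq, not_exists] at h3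
    exact h2 ⟨h1, h3⟩
  refine measure_mono_null hsub (measure_iUnion_null fun k => ?_)
  obtain ⟨B, hB⟩ := minorPoly_exists_ne_zero hn k
  have hHaar : (volume : Measure (Fin n → Fin n → ℝ)).IsAddHaarMeasure := inferInstance
  have hHaar' : (volume : Measure ((Fin n → Fin n → ℝ) × (Fin n → Fin n → ℝ))).IsAddHaarMeasure :=
    Measure.prod.instIsAddHaarMeasure volume volume
  refine PolyOnLines.measure_zeroSet volume (PolyOnLines.minorPoly (fun i j => ?_)
    (fun i j => ?_) k) ?_ (Matrix.of.symm B.1, Matrix.of.symm B.2) hB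
  · exact PolyOnLines.linear ((LinearMap.proj j).comp ((LinearMap.proj i).comp
      (LinearMap.fst ℝ (Fin n → Fin n → ℝ) (Fin n → Fin n → ℝ))))
  · exact PolyOnLines.linear ((LinearMap.proj j).comp ((LinearMap.proj i).comp
      (LinearMap.snd ℝ (Fin n → Fin n → ℝ) (Fin n → Fin n → ℝ))))
  · exact (continuous_minorPoly k).comp continuous_id

-- A nonempty open subset of `LI n ×ˢ univ` has positive volume and cannot lie in the null
-- complement.
set_option synthInstance.maxSize 1000 in
lemma subset_closure_genericSet (hn : 2 ≤ n) : LI n ×ˢ univ ⊆ closure (genericSet n) := by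
  intro B hB
  rw [mem_closure_iff]
  intro U hU hBU
  have hopen : IsOpen (U ∩ (LI n ×ˢ univ)) := hU.inter ((isOpen_LI hn).prod isOpen_univ)
  let ι : (Fin n → Fin n → ℝ) × (Fin n → Fin n → ℝ) → Mat n × Mat n :=
    fun B => (Matrix.of B.1, Matrix.of B.2)
  have hι : Continuous ι := continuous_id
  have hpos := (hopen.preimage hι).measure_pos volume
    ⟨(Matrix.of.symm B.1, Matrix.of.symm B.2), hBU, hB⟩
  by_contra hne
  have : ι ⁻¹' (U ∩ (LI n ×ˢ univ)) ⊆ {B | (Matrix.of B.1, Matrix.of B.2) ∈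
      (LI n ×ˢ univ) \ genericSet n} := fun C hC =>
    ⟨hC.2, fun hV => hne ⟨_, hC.1, hV⟩⟩
  exact hpos.ne' (measure_mono_null this (volume_compl_genericSet hn))

/-! ### Zero-sum games on a face of the simplex -/

/-- The face of the simplex spanned by the vertices in `I`. -/
def face (I : Set (Fin n)) : Set (Fin n → ℝ) :=
  {c | c ∈ stdSimplex ℝ (Fin n) ∧ ∀ i, i ∉ I → c i = 0}

lemma isCompact_face (I : Set (Fin n)) : IsCompact (face I) := by
  have h : face I = stdSimplex ℝ (Fin n) ∩ ⋂ i, {c | i ∉ I → c i = 0} := by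
    ext c; simp [face]
  rw [h]
  refine (isCompact_stdSimplex ℝ (Fin n)).inter_right (isClosed_iInter fun i => ?_)
  by_cases hi : i ∈ I
  · simp [hi]
  · simpa [hi] using isClosed_eq (continuous_apply i) continuous_const

lemma convex_face (I : Set (Fin n)) : Convex ℝ (face I) := by
  intro x hx y hy a b ha hb hab
  refine ⟨convex_stdSimplex ℝ (Fin n) hx.1 hy.1 ha hb hab, fun i hi => ?_⟩
  simp [hx.2 i hi, hy.2 i hi]

lemma single_mem_face {I : Set (Fin n)} {i : Fin n} (hi : i ∈ I) : Pi.single i 1 ∈ face I :=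
  ⟨single_mem_stdSimplex ℝ i, fun k hk =>
    Pi.single_eq_of_ne (fun h : k = i => hk (h ▸ hi)) _⟩

lemma face_mono {I I' : Set (Fin n)} (h : I ⊆ I') : face I ⊆ face I' := fun _ hc =>
  ⟨hc.1, fun i hi => hc.2 i fun h' => hi (h h')⟩

lemma face_nonempty {I : Set (Fin n)} (h : I.Nonempty) : (face I).Nonempty :=
  ⟨_, single_mem_face h.some_mem⟩

lemma face_singleton (i : Fin n) : face {i} = {Pi.single i (1 : ℝ)} := by
  refine Subset.antisymm (fun c hc => ?_) (singleton_subset_iff.2 (single_mem_face rfl))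
  have h1 : ∀ k, k ≠ i → c k = 0 := fun k hk => hc.2 k hk
  have h2 : c i = 1 := by
    rw [← hc.1.2, Finset.sum_eq_single i (fun k _ hk => h1 k hk) (by simp)]
  rw [mem_singleton_iff]
  funext k
  by_cases hk : k = i
  · subst hk; simp [h2]
  · simp [h1 k hk, hk]

lemma dotProduct_le_of_mem_face {I : Set (Fin n)} {c y : Fin n → ℝ} {v : ℝ} (hc : c ∈ face I)
    (hy : ∀ i ∈ I, y i ≤ v) : c ⬝ᵥ y ≤ v := by
  calc c ⬝ᵥ y ≤ ∑ i, c i * v := Finset.sum_le_sum fun i _ => by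
        by_cases hi : i ∈ I
        · exact mul_le_mul_of_nonneg_left (hy i hi) (hc.1.1 i)
        · simp [hc.2 i hi]
    _ = v := by rw [← Finset.sum_mul, hc.1.2, one_mul]

lemma le_dotProduct_of_mem_face {I : Set (Fin n)} {c y : Fin n → ℝ} {v : ℝ} (hc : c ∈ face I)
    (hy : ∀ i ∈ I, v ≤ y i) : v ≤ c ⬝ᵥ y := by
  have := dotProduct_le_of_mem_face (y := -y) (v := -v) hc fun i hi => neg_le_neg (hy i hi)
  rw [dotProduct_neg] at this
  linarith

/-- Complementary slackness: the nonnegative terms `c i * (v - y i)` sum to zero. -/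
lemma eq_of_dotProduct_eq {I : Set (Fin n)} {c y : Fin n → ℝ} {v : ℝ} (hc : c ∈ face I)
    (hy : ∀ i ∈ I, y i ≤ v) (h : c ⬝ᵥ y = v) {i : Fin n} (hi : c i ≠ 0) : y i = v := by
  have h1 : ∑ i, c i * (v - y i) = 0 := by
    simp only [mul_sub, Finset.sum_sub_distrib, ← Finset.sum_mul, hc.1.2, one_mul]
    exact sub_eq_zero.2 h.symm
  have h2 := (Finset.sum_eq_zero_iff_of_nonneg fun i _ => by
    by_cases hi : i ∈ I
    · exact mul_nonneg (hc.1.1 i) (sub_nonneg.2 (hy i hi))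
    · simp [hc.2 i hi]).1 h1 i (Finset.mem_univ _)
  have := (mul_eq_zero.1 h2).resolve_left hi
  linarith

/-- `(c, d)` are optimal strategies, of value `v`, in the game `K` restricted to `I × J`. -/
structure IsNash (K : Mat n) (I J : Set (Fin n)) (c d : Fin n → ℝ) (v : ℝ) : Prop where
  left_mem : c ∈ face I
  right_mem : d ∈ face J
  le_value : ∀ i ∈ I, (K *ᵥ d) i ≤ v
  value_le : ∀ j ∈ J, v ≤ (c ᵥ* K) j

namespace IsNash

variable {K : Mat n} {I J : Set (Fin n)} {c d c' d' : Fin n → ℝ} {v v' : ℝ}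

/-- Exchanging the players; facts about one player's strategy carry over to the other's. -/
lemma symm (h : IsNash K I J c d v) : IsNash (-Kᵀ) J I d c (-v) where
  left_mem := h.right_mem
  right_mem := h.left_mem
  le_value := fun j hj => by
    rw [neg_mulVec, mulVec_transpose]; exact neg_le_neg (h.value_le j hj)
  value_le := fun i hi => by
    rw [vecMul_neg, vecMul_transpose]; exact neg_le_neg (h.le_value i hi)

lemma value_le_value (h : IsNash K I J c d v) (h' : IsNash K I J c' d' v') : v ≤ v' := by
  have h1 := le_dotProduct_of_mem_face h'.right_mem h.value_le
  have h2 := dotProduct_le_of_mem_face h.left_mem h'.le_value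
  rw [dotProduct_comm, ← dotProduct_mulVec] at h1
  exact h1.trans h2

lemma value_eq (h : IsNash K I J c d v) : c ⬝ᵥ (K *ᵥ d) = v := by
  refine le_antisymm (dotProduct_le_of_mem_face h.left_mem h.le_value) ?_
  have h1 := le_dotProduct_of_mem_face h.right_mem h.value_le
  rwa [dotProduct_comm, ← dotProduct_mulVec] at h1

lemma eq_value (h : IsNash K I J c d v) {i : Fin n} (hi : c i ≠ 0) : (K *ᵥ d) i = v :=
  eq_of_dotProduct_eq h.left_mem h.le_value h.value_eq hi

lemma eq_value' (h : IsNash K I J c d v) {j : Fin n} (hj : d j ≠ 0) : (c ᵥ* K) j = v := by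
  have := h.symm.eq_value hj
  rw [neg_mulVec, mulVec_transpose, Pi.neg_apply] at this
  linarith

lemma swap (h : IsNash K I J c d v) (h' : IsNash K I J c' d' v') : IsNash K I J c d' v where
  left_mem := h.left_mem
  right_mem := h'.right_mem
  le_value := fun i hi => (h'.le_value i hi).trans (h'.value_le_value h)
  value_le := h.value_le

/-- With more tight rows than columns in the support, `RowNondeg` would force `d = 0`, but `d` sums
to one. -/
lemma card_le (hK : RowNondeg K) (h : IsNash K I J c d v) (S : Finset (Fin n))
    (hS : ∀ i ∈ S, (K *ᵥ d) i = v) (T : Finset (Fin n)) (hT : ∀ j, j ∉ T → d j = 0) :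
    S.card ≤ T.card := by
  by_contra hlt
  obtain ⟨S', hS', hcard⟩ := Finset.exists_subset_card_eq (Nat.succ_le_of_lt (not_le.1 hlt))
  have h0 := hK S' T d v hcard hT fun i hi => hS i (hS' hi)
  have h1 := h.right_mem.1.2
  rw [h0] at h1
  simp at h1

/-- In a nondegenerate game the supports of optimal strategies are the sets of tight payoffs. -/
lemma support_eq (hK : Nondeg K) (h : IsNash K I J c d v) :
    (∀ i ∈ I, (K *ᵥ d) i = v → c i ≠ 0) ∧
      (Finset.univ.filter (c · ≠ 0)).card = (Finset.univ.filter (d · ≠ 0)).card := by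
  classical
  set S := Finset.univ.filter (c · ≠ 0)
  set T := Finset.univ.filter (d · ≠ 0)
  set S' := Finset.univ.filter fun i => i ∈ I ∧ (K *ᵥ d) i = v
  have hSI : ∀ i, c i ≠ 0 → i ∈ I := fun i hi => by
    by_contra h'; exact hi (h.left_mem.2 i h')
  have hSS' : S ⊆ S' := fun i hi => by
    have hi' : c i ≠ 0 := by simpa [S] using hi
    simp [S', h.eq_value hi', hSI i hi']
  -- The cycle `|S'| ≤ |T| ≤ |S| ≤ |S'|` collapses, so the tight rows are exactly the support.
  have h1 : S'.card ≤ T.card := h.card_le hK.1 S' (by simp +contextual [S']) T (by simp [T])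
  have h2 : T.card ≤ S.card := by
    refine h.symm.card_le (by simpa using hK.2.neg) T (fun j hj => ?_) S (by simp [S])
    have hj' : d j ≠ 0 := by simpa [T] using hj
    rw [neg_mulVec, mulVec_transpose, Pi.neg_apply, h.eq_value' hj']
  have h3 := Finset.card_le_card hSS'
  have h4 : S = S' := Finset.eq_of_subset_of_card_le hSS' (h1.trans h2)
  refine ⟨fun i hi hv => ?_, le_antisymm (h3.trans h1) h2⟩
  have : i ∈ S := by rw [h4]; simp [S', hi, hv]
  simpa [S] using this

/-- Both `d` and `d'` are optimal against `c`, and the support of `d'` lies in that of `d`. The line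
through them contains a point `e` with one more zero coordinate. It satisfies as many equations as
`d` with one unknown fewer, so nondegeneracy gives `e = 0`, although `e` sums to one. -/
lemma right_unique (hK : Nondeg K) (h : IsNash K I J c d v) (h' : IsNash K I J c' d' v') :
    d = d' := by
  classical
  have hs := h.swap h'
  have hKs : Nondeg (-Kᵀ) := hK.transpose.neg
  by_contra hne
  obtain ⟨j₀, hj₀⟩ : ∃ j, d' j - d j ≠ 0 := by
    by_contra hall
    push Not at hall
    exact hne (funext fun j => by linarith [hall j])
  set T := Finset.univ.filter (d · ≠ 0) with hT
  set S := Finset.univ.filter (c · ≠ 0) with hS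
  have hsupp : ∀ j, d j = 0 → d' j = 0 := fun j hj => by
    by_contra hj'
    have hjJ : j ∈ J := by by_contra hJ; exact hj' (h'.right_mem.2 j hJ)
    refine (h.symm.support_eq hKs).1 j hjJ ?_ hj
    rw [neg_mulVec, mulVec_transpose, Pi.neg_apply, hs.eq_value' hj']
  have hj₀T : j₀ ∈ T := by
    simp only [hT, Finset.mem_filter, Finset.mem_univ, true_and]
    intro h0
    exact hj₀ (by rw [hsupp j₀ h0, h0, sub_zero])
  -- The parameter at which the line through `d` and `d'` has `j₀`-th coordinate zero.
  set t := d j₀ / (d j₀ - d' j₀) with ht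
  set e : Fin n → ℝ := d + t • (d' - d) with he
  have hne0 : d j₀ - d' j₀ ≠ 0 := fun h0 => hj₀ (by linarith)
  have he0 : e j₀ = 0 := by
    simp only [he, ht, Pi.add_apply, Pi.smul_apply, Pi.sub_apply, smul_eq_mul]
    field_simp
    ring
  have hesum : ∑ j, e j = 1 := by
    simp [he, Finset.sum_add_distrib, ← Finset.mul_sum, h.right_mem.1.2, h'.right_mem.1.2]
  have hez : e = 0 := by
    refine hK.1 S (T.erase j₀) e v ?_ (fun j hj => ?_) fun i hi => ?_
    · rw [Finset.card_erase_add_one hj₀T]; exact (h.support_eq hK).2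
    · by_cases hjj : j = j₀
      · rw [hjj, he0]
      · have hj0 : d j = 0 := by
          by_contra h0
          exact hj (Finset.mem_erase.2 ⟨hjj, by simp [hT, h0]⟩)
        simp [he, hj0, hsupp j hj0]
    · have hi' : c i ≠ 0 := by simpa [hS] using hi
      rw [he, mulVec_add, mulVec_smul, mulVec_sub]
      simp [h.eq_value hi', hs.eq_value hi']
  rw [hez] at hesum
  simp at hesum

lemma left_unique (hK : Nondeg K) (h : IsNash K I J c d v) (h' : IsNash K I J c' d' v') :
    c = c' := h.symm.right_unique hK.transpose.neg h'.symm

end IsNash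

lemma exists_dotProduct_eq (f : StrongDual ℝ (Fin n → ℝ)) : ∃ w : Fin n → ℝ, ∀ y, f y = w ⬝ᵥ y := by
  refine ⟨fun i => f (Pi.single i 1), fun y => ?_⟩
  have := LinearMap.pi_apply_eq_sum_univ (f : (Fin n → ℝ) →ₗ[ℝ] ℝ) y
  simp only [ContinuousLinearMap.coe_coe, smul_eq_mul] at this
  rw [this, dotProduct]
  refine Finset.sum_congr rfl fun i _ => ?_
  rw [mul_comm]
  congr 2
  funext j
  simp [Pi.single_apply, eq_comm]

lemma nonneg_of_forall_sub_mul_lt {a w u : ℝ} (h : ∀ t : ℝ, 0 ≤ t → a - t * w < u) : 0 ≤ w := by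
  by_contra hw
  push Not at hw
  have h0 := h 0 le_rfl
  have h1 := h ((u - a) / (-w)) (div_nonneg (by linarith) (by linarith))
  have h2 : (u - a) / (-w) * w = -(u - a) := by
    rw [div_neg, neg_mul, div_mul_cancel₀ _ hw.ne]
  rw [h2] at h1
  linarith

/-- The minimax theorem. -/
lemma exists_isNash (K : Mat n) {I J : Set (Fin n)} (hI : I.Nonempty) (hJ : J.Nonempty) :
    ∃ c d v, IsNash K I J c d v := by
  classical
  have hI' : I.toFinset.Nonempty := by simpa using hI
  have hcont : Continuous fun d : Fin n → ℝ => I.toFinset.sup' hI' fun i => (K *ᵥ d) i :=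
    Continuous.finset_sup'_apply hI' fun i _ =>
      (continuous_apply i).comp (Continuous.matrix_mulVec continuous_const continuous_id)
  -- `d` minimises the largest payoff over `I`. By minimality no strategy on `J` keeps all payoffs
  -- on `I` below `v`, so the open convex set `s` misses the image of `face J`.
  obtain ⟨d, hd, hmin⟩ := (isCompact_face J).exists_isMinOn (face_nonempty hJ) hcont.continuousOn
  set v := I.toFinset.sup' hI' fun i => (K *ᵥ d) i with hv
  have hle : ∀ i ∈ I, (K *ᵥ d) i ≤ v := fun i hi =>
    Finset.le_sup' (fun i => (K *ᵥ d) i) (by simpa using hi)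
  set s : Set (Fin n → ℝ) := {y | ∀ i ∈ I, y i < v} with hs
  have hs_open : IsOpen s := by
    have : s = ⋂ i, {y | i ∈ I → y i < v} := by ext y; simp [hs]
    rw [this]
    refine isOpen_iInter_of_finite fun i => ?_
    by_cases hi : i ∈ I
    · simpa [hi] using isOpen_lt (continuous_apply i) continuous_const
    · simp [hi]
  have hs_conv : Convex ℝ s := by
    intro x hx y hy a b ha hb hab i hi
    exact (convex_Iio v) (hx i hi) (hy i hi) ha hb hab
  have ht_conv : Convex ℝ ((fun d => K *ᵥ d) '' face J) :=
    (convex_face J).is_linear_image (Matrix.mulVecLin K).isLinear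
  have hdisj : Disjoint s ((fun d => K *ᵥ d) '' face J) := by
    rw [Set.disjoint_left]
    rintro _ hy ⟨d', hd', rfl⟩
    have h1 : v ≤ I.toFinset.sup' hI' fun i => (K *ᵥ d') i := hmin hd'
    have h2 : (I.toFinset.sup' hI' fun i => (K *ᵥ d') i) < v :=
      (Finset.sup'_lt_iff hI').2 fun i hi => hy i (by simpa using hi)
    exact absurd h1 (not_le.2 h2)
  -- The normal `w` is nonnegative because `s` is unbounded downwards, and vanishes off `I` because
  -- `s` is unconstrained there. Normalised, it is the optimal row strategy.
  obtain ⟨f, u, hfs, hft⟩ := geometric_hahn_banach_open hs_conv hs_open ht_conv hdisj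
  obtain ⟨w, hw⟩ := exists_dotProduct_eq f
  have hbase : ∀ ε > 0, (fun _ => v - ε : Fin n → ℝ) ∈ s := fun ε hε i _ => by
    simp only; linarith
  have hdot : ∀ ε, f (fun _ => v - ε) = (∑ i, w i) * (v - ε) := fun ε => by
    rw [hw, dotProduct, Finset.sum_mul]
  have hwI : ∀ i, 0 ≤ w i := fun i => by
    refine nonneg_of_forall_sub_mul_lt (a := f fun _ => v - 1) (u := u) fun t ht => ?_
    have hmem : (fun _ => v - 1 : Fin n → ℝ) - t • Pi.single i 1 ∈ s := fun k _ => by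
      have : (0 : ℝ) ≤ t * (Pi.single i (1 : ℝ) : Fin n → ℝ) k := by
        refine mul_nonneg ht ?_
        by_cases h : k = i
        · subst h; simp
        · simp [h]
      simp only [Pi.sub_apply, Pi.smul_apply, smul_eq_mul]
      linarith
    have := hfs _ hmem
    rwa [map_sub, map_smul, hw (Pi.single i 1), dotProduct_single_one, smul_eq_mul] at this
  have hwI' : ∀ i, i ∉ I → w i = 0 := fun i hi => by
    refine le_antisymm (neg_nonneg.1 ?_) (hwI i)
    refine nonneg_of_forall_sub_mul_lt (a := f fun _ => v - 1) (u := u) fun t _ => ?_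
    have hmem : (fun _ => v - 1 : Fin n → ℝ) + t • Pi.single i 1 ∈ s := fun k hk => by
      have : k ≠ i := fun h => hi (h ▸ hk)
      simp [this]
    have := hfs _ hmem
    rw [map_add, map_smul, hw (Pi.single i 1), dotProduct_single_one, smul_eq_mul] at this
    linarith
  have huW : (∑ i, w i) * v ≤ u := by
    refine le_of_forall_pos_le_add fun ε hε => ?_
    have hW : 0 ≤ ∑ i, w i := Finset.sum_nonneg fun i _ => hwI i
    -- The `+ 1` keeps the divisor positive while the sum is only known to be nonnegative.
    have h1 := hfs _ (hbase (ε / (∑ i, w i + 1)) (by positivity))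
    rw [hdot] at h1
    have h2 : (∑ i, w i) * (ε / (∑ i, w i + 1)) ≤ ε := by
      rw [mul_div_assoc', div_le_iff₀ (by positivity)]
      nlinarith
    linarith
  have hWpos : 0 < ∑ i, w i := by
    refine lt_of_le_of_ne (Finset.sum_nonneg fun i _ => hwI i) fun h0 => ?_
    have hw0 : ∀ i, w i = 0 := fun i =>
      (Finset.sum_eq_zero_iff_of_nonneg fun i _ => hwI i).1 h0.symm i (Finset.mem_univ i)
    have h1 := hfs _ (hbase 1 one_pos)
    have h2 := hft _ (mem_image_of_mem _ hd)
    rw [hdot, ← h0] at h1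
    rw [hw] at h2
    have : w ⬝ᵥ (K *ᵥ d) = 0 := by simp [dotProduct, hw0]
    linarith
  refine ⟨(∑ i, w i)⁻¹ • w, d, v, ⟨⟨⟨fun i => ?_, ?_⟩, fun i hi => ?_⟩, hd, hle, fun j hj => ?_⟩⟩
  · exact mul_nonneg (inv_nonneg.2 hWpos.le) (hwI i)
  · simp only [Pi.smul_apply, smul_eq_mul, ← Finset.mul_sum]
    exact inv_mul_cancel₀ hWpos.ne'
  · simp [hwI' i hi]
  · have h1 := hft _ (mem_image_of_mem _ (single_mem_face hj))
    rw [hw, dotProduct_mulVec, dotProduct_single_one] at h1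
    rw [smul_vecMul, Pi.smul_apply, smul_eq_mul, inv_mul_eq_div, le_div_iff₀ hWpos]
    linarith

/-! ### The Hamiltonian as a maximum of linear functionals -/

/-- The linear functional `(M q)_i - (p' M)_j`. -/
noncomputable def payDiff (M : Mat n) (i j : Fin n) : Pt n →ₗ[ℝ] ℝ :=
  ((LinearMap.proj i).comp M.mulVecLin).comp (LinearMap.snd ℝ _ _) -
    ((LinearMap.proj j).comp Mᵀ.mulVecLin).comp (LinearMap.fst ℝ _ _)

@[simp] lemma payDiff_apply (M : Mat n) (i j : Fin n) (x : Pt n) :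
    payDiff M i j x = (M *ᵥ x.2) i - (x.1 ᵥ* M) j := by
  simp [payDiff]

lemma bottomCols_eq (M : Mat n) (p : Fin n → ℝ) : bottomCols M p = topRows (-Mᵀ) p := by
  ext j
  simp [bottomCols, topRows, neg_mulVec, mulVec_transpose]

lemma ham_eq_of_mem (M : Mat n) (x : Pt n) {i j : Fin n} (hi : i ∈ topRows M x.2)
    (hj : j ∈ bottomCols M x.1) : ham M x = (M *ᵥ x.2) i - (x.1 ᵥ* M) j := by
  have : Nonempty (Fin n) := ⟨i⟩
  have h1 : ⨆ k, (M *ᵥ x.2) k = (M *ᵥ x.2) i :=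
    le_antisymm (ciSup_le hi) (le_ciSup (Set.finite_range _).bddAbove i)
  have h2 : ⨅ k, (x.1 ᵥ* M) k = (x.1 ᵥ* M) j :=
    le_antisymm (ciInf_le (Set.finite_range _).bddBelow j) (le_ciInf hj)
  rw [ham, h1, h2]

section

variable [Nonempty (Fin n)]

lemma topRows_nonempty (M : Mat n) (q : Fin n → ℝ) : (topRows M q).Nonempty :=
  Finite.exists_max (M *ᵥ q)

lemma bottomCols_nonempty (M : Mat n) (p : Fin n → ℝ) : (bottomCols M p).Nonempty :=
  Finite.exists_min (p ᵥ* M)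

lemma exists_ham_eq (M : Mat n) (x : Pt n) : ∃ i j, i ∈ topRows M x.2 ∧ j ∈ bottomCols M x.1 ∧
    ham M x = payDiff M i j x := by
  obtain ⟨i, hi⟩ := topRows_nonempty M x.2
  obtain ⟨j, hj⟩ := bottomCols_nonempty M x.1
  exact ⟨i, j, hi, hj, by rw [payDiff_apply]; exact ham_eq_of_mem M x hi hj⟩

lemma payDiff_le_ham (M : Mat n) (x : Pt n) (i j : Fin n) : payDiff M i j x ≤ ham M x := by
  obtain ⟨i', j', hi, hj, h⟩ := exists_ham_eq M x
  rw [h, payDiff_apply, payDiff_apply]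
  exact sub_le_sub (hi i) (hj j)

lemma ham_smul (M : Mat n) {t : ℝ} (ht : 0 ≤ t) (x : Pt n) : ham M (t • x) = t * ham M x := by
  refine le_antisymm ?_ ?_
  · obtain ⟨i, j, -, -, h⟩ := exists_ham_eq M (t • x)
    rw [h, map_smul, smul_eq_mul]
    exact mul_le_mul_of_nonneg_left (payDiff_le_ham M x i j) ht
  · obtain ⟨i, j, -, -, h⟩ := exists_ham_eq M x
    rw [h, ← smul_eq_mul, ← map_smul]
    exact payDiff_le_ham M _ i j

lemma exists_ham_sub_le (M : Mat n) :
    ∃ C : NNReal, ∀ x y : Pt n, ham M x - ham M y ≤ C * ‖x - y‖ := by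
  have hb : ∀ k : Fin n × Fin n, ∃ C : ℝ, ∀ x : Pt n, payDiff M k.1 k.2 x ≤ C * ‖x‖ := fun k => by
    refine ⟨‖LinearMap.toContinuousLinearMap (payDiff M k.1 k.2)‖, fun x => ?_⟩
    exact (le_abs_self _).trans
      ((LinearMap.toContinuousLinearMap (payDiff M k.1 k.2)).le_opNorm x)
  choose C hC using hb
  obtain ⟨k₀, hk₀⟩ := Finite.exists_max C
  refine ⟨(C k₀).toNNReal, fun x y => ?_⟩
  obtain ⟨i, j, -, -, h⟩ := exists_ham_eq M x
  have h1 := payDiff_le_ham M y i j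
  have h2 := hC (i, j) (x - y)
  have h3 : C (i, j) * ‖x - y‖ ≤ (C k₀).toNNReal * ‖x - y‖ :=
    mul_le_mul_of_nonneg_right ((hk₀ (i, j)).trans (Real.le_coe_toNNReal _)) (norm_nonneg _)
  simp only [map_sub] at h2
  rw [h]
  linarith

lemma exists_lipschitzWith_ham (M : Mat n) : ∃ C, LipschitzWith C (ham M) := by
  obtain ⟨C, hC⟩ := exists_ham_sub_le M
  refine ⟨C, LipschitzWith.of_dist_le_mul fun x y => ?_⟩
  rw [Real.dist_eq, dist_eq_norm, abs_le]
  have h1 := hC x y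
  have h2 := hC y x
  rw [norm_sub_rev] at h2
  constructor <;> linarith

lemma continuous_ham (M : Mat n) : Continuous (ham M) :=
  (exists_lipschitzWith_ham M).choose_spec.continuous

end

/-- Close to `q` the largest components of `M q'` are among those of `M q`. -/
lemma eventually_topRows_subset (M : Mat n) (q : Fin n → ℝ) :
    ∀ᶠ q' in nhds q, topRows M q' ⊆ topRows M q := by
  have h : ∀ i k, i ∉ topRows M q → (M *ᵥ q) i < (M *ᵥ q) k →
      ∀ᶠ q' in nhds q, (M *ᵥ q') i < (M *ᵥ q') k := fun i k _ hlt => by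
    have hc : ∀ l, Continuous fun q' : Fin n → ℝ => (M *ᵥ q') l := fun l =>
      (continuous_apply l).comp (Continuous.matrix_mulVec continuous_const continuous_id)
    exact (isOpen_lt (hc i) (hc k)).mem_nhds hlt
  have h2 : ∀ᶠ q' in nhds q, ∀ i k, i ∉ topRows M q → (M *ᵥ q) i < (M *ᵥ q) k →
      (M *ᵥ q') i < (M *ᵥ q') k := by
    simp only [Filter.eventually_all]
    exact h
  filter_upwards [h2] with q' hq' i hi
  by_contra hn
  obtain ⟨k, hk⟩ : ∃ k, (M *ᵥ q) i < (M *ᵥ q) k := by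
    simpa [topRows] using hn
  exact absurd (hi k) (not_le.2 (hq' i k hn hk))

lemma eventually_bottomCols_subset (M : Mat n) (p : Fin n → ℝ) :
    ∀ᶠ p' in nhds p, bottomCols M p' ⊆ bottomCols M p := by
  simp only [bottomCols_eq]
  exact eventually_topRows_subset _ _

lemma bestP_eq [Nonempty (Fin n)] (M : Mat n) (q : Fin n → ℝ) :
    bestP M q = face (topRows M q) := by
  obtain ⟨k, hk⟩ := topRows_nonempty M q
  ext c
  constructor
  · rintro ⟨hc, hmax⟩
    refine ⟨hc, fun i hi => ?_⟩
    by_contra h0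
    have hc' : c ∈ face univ := ⟨hc, by simp⟩
    have h1 := dotProduct_le_of_mem_face hc' fun i _ => hk i
    have h2 := hmax _ (single_mem_stdSimplex ℝ k)
    rw [single_one_dotProduct] at h2
    have h3 := eq_of_dotProduct_eq hc' (fun i _ => hk i) (le_antisymm h1 h2) h0
    exact hi fun l => by rw [h3]; exact hk l
  · intro hc
    refine ⟨hc.1, fun c' hc' => ?_⟩
    have h1 := dotProduct_le_of_mem_face (I := univ) ⟨hc', by simp⟩ fun i _ => hk i
    have h2 := le_dotProduct_of_mem_face (v := (M *ᵥ q) k) hc fun i hi => hi k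
    exact h1.trans h2

lemma bestQ_eq [Nonempty (Fin n)] (M : Mat n) (p : Fin n → ℝ) :
    bestQ M p = face (bottomCols M p) := by
  rw [bottomCols_eq, ← bestP_eq]
  ext d
  simp only [bestQ, bestP, mem_ofPred_eq, neg_mulVec, dotProduct_neg, neg_le_neg_iff,
    mulVec_transpose, dotProduct_mulVec]
  simp only [dotProduct_comm]

/-! ### The Hamiltonian vector field -/

/-- The velocity belonging to the strategies `c` and `d`. -/
noncomputable def vel (M A : Mat n) (c d : Fin n → ℝ) : Pt n :=
  ((projInv A)ᵀ *ᵥ (Mᵀ *ᵥ c), projInv A *ᵥ (M *ᵥ d))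

lemma mulVec_vel (M A : Mat n) (c d : Fin n → ℝ) : M *ᵥ (vel M A c d).2 = velMat M A *ᵥ d := by
  simp [vel, velMat, mulVec_mulVec, Matrix.mul_assoc]

lemma vel_vecMul (M A : Mat n) (c d : Fin n → ℝ) : (vel M A c d).1 ᵥ* M = c ᵥ* velMat M A := by
  simp [vel, velMat, mulVec_transpose, vecMul_vecMul, Matrix.mul_assoc]

lemma vel_neg (M : Mat n) {A : Mat n} (hA : A.det ≠ 0) (c d : Fin n → ℝ) :
    vel M (-A) c d = - vel M A c d := by
  simp [vel, projInv_neg hA, transpose_neg, neg_mulVec]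

lemma projAlong_eq (A : Mat n) (z : Fin n → ℝ) :
    projAlong (A⁻¹ *ᵥ 1) (A⁻¹ *ᵥ z) = projInv A *ᵥ z := by
  have h : ∑ i, (A⁻¹ *ᵥ z) i = (1 ᵥ* A⁻¹) ⬝ᵥ z := by
    rw [← dotProduct_mulVec]; simp [dotProduct]
  rw [projAlong, projInv, sub_mulVec, smul_mulVec, vecMulVec_mulVec, h, invSum, op_smul_eq_smul,
    smul_smul, div_eq_inv_mul]

lemma brField_eq [Nonempty (Fin n)] (M A : Mat n) (x : Pt n) :
    brField M A x = {v | ∃ c ∈ face (topRows M x.2), ∃ d ∈ face (bottomCols M x.1),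
      v = vel M A c d} := by
  simp only [brField, projAlong_eq, bestP_eq, bestQ_eq, projInv_transpose]
  ext v
  constructor
  · rintro ⟨⟨c, hc, h1⟩, ⟨d, hd, h2⟩⟩
    exact ⟨c, hc, d, hd, Prod.ext h1.symm h2.symm⟩
  · rintro ⟨c, hc, d, hd, rfl⟩
    exact ⟨⟨c, hc, rfl⟩, ⟨d, hd, rfl⟩⟩

/-- The correction term of `projInv` vanishes because `1' A⁻¹ (A v)` is the coordinate sum of `v`.
With `sum_projInv_mulVec` this makes `projInv A` the inverse of the form `A` on `TΣ`. -/
lemma projInv_mul {A : Mat n} (hA : A.det ≠ 0) {v : Fin n → ℝ} (hv : ∑ j, v j = 0) :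
    projInv A *ᵥ (A *ᵥ v) = v := by
  have h1 : A⁻¹ *ᵥ (A *ᵥ v) = v := by
    rw [mulVec_mulVec, nonsing_inv_mul _ hA.isUnit, one_mulVec]
  have h2 : (1 ᵥ* A⁻¹) ⬝ᵥ (A *ᵥ v) = 0 := by
    rw [← dotProduct_mulVec, h1]; simpa [dotProduct] using hv
  rw [projInv, sub_mulVec, smul_mulVec, vecMulVec_mulVec, h1, h2]
  simp

lemma sum_projInv_mulVec {A : Mat n} (hs : invSum A ≠ 0) (z : Fin n → ℝ) :
    ∑ i, (projInv A *ᵥ z) i = 0 := by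
  have h : ∑ i, (A⁻¹ *ᵥ z) i = (1 ᵥ* A⁻¹) ⬝ᵥ z := by
    rw [← dotProduct_mulVec]; simp [dotProduct]
  rw [← projAlong_eq]
  simp only [projAlong, Pi.sub_apply, Pi.smul_apply, smul_eq_mul, Finset.sum_sub_distrib,
    ← Finset.mul_sum]
  exact sub_eq_zero.2 (div_mul_cancel₀ _ hs).symm

lemma symp_eq (A : Mat n) (v w : Pt n) : symp A v w = v.1 ⬝ᵥ (A *ᵥ w.2) - w.1 ⬝ᵥ (A *ᵥ v.2) := by
  simp only [symp, dotProduct, mulVec, Finset.mul_sum, ← Finset.sum_sub_distrib]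
  exact Finset.sum_congr rfl fun i _ => Finset.sum_congr rfl fun j _ => by ring

lemma symp_self (A : Mat n) (v : Pt n) : symp A v v = 0 := by
  rw [symp_eq, sub_self]

lemma symp_sub_left (A : Mat n) (v v' w : Pt n) :
    symp A (v - v') w = symp A v w - symp A v' w := by
  simp only [symp_eq, Prod.fst_sub, Prod.snd_sub, sub_dotProduct, mulVec_sub, dotProduct_sub]
  ring

lemma symp_vel {M A : Mat n} (hA : A.det ≠ 0) (c d : Fin n → ℝ) {Y : Pt n}
    (hY : Y ∈ tangentProd n) :
    symp A (vel M A c d) Y = c ⬝ᵥ (M *ᵥ Y.2) - Y.1 ⬝ᵥ (M *ᵥ d) := by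
  have hA' : Aᵀ.det ≠ 0 := by rwa [det_transpose]
  have h1 : (vel M A c d).1 ⬝ᵥ (A *ᵥ Y.2) = c ⬝ᵥ (M *ᵥ Y.2) := by
    simp only [vel, mulVec_transpose]
    rw [← dotProduct_mulVec, projInv_mul hA hY.2, ← dotProduct_mulVec]
  have h2 : Y.1 ⬝ᵥ (A *ᵥ (vel M A c d).2) = Y.1 ⬝ᵥ (M *ᵥ d) := by
    have h3 := projInv_mul hA' hY.1
    rw [projInv_transpose, mulVec_transpose, mulVec_transpose] at h3
    simp only [vel]
    rw [dotProduct_mulVec, dotProduct_mulVec, h3]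
  rw [symp_eq, h1, h2]

lemma vel_mem_tangentProd (M : Mat n) {A : Mat n} (hs : invSum A ≠ 0) (c d : Fin n → ℝ) :
    vel M A c d ∈ tangentProd n := by
  refine ⟨?_, sum_projInv_mulVec hs _⟩
  simp only [vel]
  rw [← projInv_transpose]
  exact sum_projInv_mulVec (by rwa [invSum_transpose]) _

/-- The tangent test vector `(projInv A)ᵀ v` pairs with `A v` to `v ⬝ᵥ v`. -/
lemma eq_zero_of_dotProduct_tangent {A : Mat n} (hA : A.det ≠ 0) (hs : invSum A ≠ 0)
    {v : Fin n → ℝ} (hv : ∑ j, v j = 0)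
    (h : ∀ u : Fin n → ℝ, ∑ i, u i = 0 → u ⬝ᵥ (A *ᵥ v) = 0) : v = 0 := by
  have h1 := h ((projInv A)ᵀ *ᵥ v) (by
    rw [← projInv_transpose]
    exact sum_projInv_mulVec (by rwa [invSum_transpose]) _)
  rw [mulVec_transpose, ← dotProduct_mulVec, projInv_mul hA hv] at h1
  exact dotProduct_self_eq_zero.1 h1

lemma isSymplectic {A : Mat n} (hA : A.det ≠ 0) (hs : invSum A ≠ 0) : IsSymplectic A := by
  intro v hv h
  refine Prod.ext ?_ ?_
  · refine eq_zero_of_dotProduct_tangent (A := Aᵀ) (by rwa [det_transpose])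
      (by rwa [invSum_transpose]) hv.1 fun u hu => ?_
    have := h (0, u) ⟨by simp, hu⟩
    rw [symp_eq] at this
    simp only [zero_dotProduct, sub_zero] at this
    rwa [mulVec_transpose, dotProduct_comm, ← dotProduct_mulVec]
  · refine eq_zero_of_dotProduct_tangent hA hs hv.2 fun u hu => ?_
    have := h (u, 0) ⟨hu, by simp⟩
    rw [symp_eq] at this
    simpa using this

/-- Subgradients, along `TΣ`, of the maximum of the components of `N q`. -/
lemma exists_face_of_subgradient [Nonempty (Fin n)] (N : Mat n) (q r : Fin n → ℝ)
    (h : ∀ Y : Fin n → ℝ, ∑ j, Y j = 0 → ∀ k ∈ topRows N q, ∀ l ∈ topRows N (q + Y),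
      (N *ᵥ q) k + r ⬝ᵥ Y ≤ (N *ᵥ (q + Y)) l) :
    ∃ c ∈ face (topRows N q), ∀ Y : Fin n → ℝ, ∑ j, Y j = 0 → r ⬝ᵥ Y = c ⬝ᵥ (N *ᵥ Y) := by
  set I := topRows N q with hI
  have hn0 : (n : ℝ) ≠ 0 := by
    have : n ≠ 0 := by
      rintro rfl
      exact (‹Nonempty (Fin 0)›.elim fun i => i.elim0)
    exact_mod_cast this
  -- The orthogonal projection onto `TΣ`; it turns a separating functional into a tangent direction.
  let Pr : (Fin n → ℝ) →ₗ[ℝ] (Fin n → ℝ) :=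
    LinearMap.id - (LinearMap.pi fun _ => (n : ℝ)⁻¹ • ∑ j, LinearMap.proj j)
  have hPr : ∀ z i, Pr z i = z i - (n : ℝ)⁻¹ * ∑ j, z j := fun z i => by simp [Pr]
  have hPrsum : ∀ z, ∑ i, Pr z i = 0 := fun z => by
    simp only [hPr, Finset.sum_sub_distrib, Finset.sum_const, Finset.card_univ, Fintype.card_fin,
      nsmul_eq_mul]
    field_simp
    ring
  have hPrdot : ∀ z Y : Fin n → ℝ, ∑ j, Y j = 0 → Pr z ⬝ᵥ Y = z ⬝ᵥ Y := fun z Y hY => by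
    simp only [dotProduct, hPr, sub_mul, Finset.sum_sub_distrib, mul_assoc, ← Finset.mul_sum, hY]
    simp
  have hPrsymm : ∀ w z : Fin n → ℝ, w ⬝ᵥ Pr z = Pr w ⬝ᵥ z := fun w z => by
    simp only [dotProduct, hPr, sub_mul, mul_sub, Finset.sum_sub_distrib, mul_assoc,
      ← Finset.mul_sum, ← Finset.sum_mul]
    ring
  let G : (Fin n → ℝ) →ₗ[ℝ] (Fin n → ℝ) := Pr.comp Nᵀ.mulVecLin
  have hG : ∀ c, G c = Pr (c ᵥ* N) := fun c => by simp [G]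
  by_cases hmem : Pr r ∈ G '' face I
  · obtain ⟨c, hc, hcr⟩ := hmem
    refine ⟨c, hc, fun Y hY => ?_⟩
    rw [← hPrdot r Y hY, ← hcr, hG, hPrdot _ Y hY, dotProduct_mulVec]
  · exfalso
    -- Separation gives a tangent `Y` along which `r` grows faster than every active row. Since no
    -- new row becomes active at once, a short step along `Y` violates the subgradient inequality.
    obtain ⟨f, u, hfs, hfr⟩ := geometric_hahn_banach_closed_point
      ((convex_face I).linear_image G)
      ((isCompact_face I).image (LinearMap.continuous_of_finiteDimensional G)).isClosed hmem
    obtain ⟨w, hw⟩ := exists_dotProduct_eq f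
    set Y := Pr w with hY
    have hYsum : ∑ j, Y j = 0 := hPrsum w
    have hrY : u < r ⬝ᵥ Y := by
      rw [hw, hPrsymm, dotProduct_comm] at hfr
      exact hfr
    have hNY : ∀ i ∈ I, (N *ᵥ Y) i < u := fun i hi => by
      have := hfs _ (mem_image_of_mem G (single_mem_face hi))
      rw [hG, hw, hPrsymm, single_one_vecMul, dotProduct_comm] at this
      exact this
    obtain ⟨k, hk⟩ := topRows_nonempty N q
    have hev : ∀ᶠ t : ℝ in nhdsWithin 0 (Ioi 0), 0 < t ∧
        topRows N (q + t • Y) ⊆ topRows N q := by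
      refine eventually_mem_nhdsWithin.and ?_
      have hc : Filter.Tendsto (fun t : ℝ => q + t • Y) (nhds 0) (nhds q) := by
        have : Continuous fun t : ℝ => q + t • Y := by fun_prop
        simpa using this.tendsto 0
      exact (hc.eventually (eventually_topRows_subset N q)).filter_mono nhdsWithin_le_nhds
    obtain ⟨t, ht, hsub⟩ := hev.exists
    obtain ⟨l, hl⟩ := topRows_nonempty N (q + t • Y)
    have h1 := h (t • Y) (by simp [← Finset.mul_sum, hYsum]) k hk l hl
    have hlI := hsub hl
    have h2 := hNY l hlI
    have h3 : (N *ᵥ q) l ≤ (N *ᵥ q) k := hk l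
    rw [mulVec_add, mulVec_smul, dotProduct_smul, Pi.add_apply, Pi.smul_apply, smul_eq_mul,
      smul_eq_mul] at h1
    have h4 : t * (N *ᵥ Y) l < t * (r ⬝ᵥ Y) := mul_lt_mul_of_pos_left (h2.trans hrY) ht
    linarith

/-- The functional that weights rows by `c` and columns by `d` lies below `H` everywhere and equals
it at `x`. -/
lemma vel_mem_hamField [Nonempty (Fin n)] {M A : Mat n} (hA : A.det ≠ 0) (hs : invSum A ≠ 0)
    {x : Pt n} {c d : Fin n → ℝ} (hc : c ∈ face (topRows M x.2))
    (hd : d ∈ face (bottomCols M x.1)) : vel M A c d ∈ hamField M A x := by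
  let ξ : Pt n →ₗ[ℝ] ℝ :=
    ((LinearMap.lsum ℝ (fun _ => ℝ) ℝ fun i => LinearMap.toSpanSingleton ℝ ℝ (c i)).comp
      M.mulVecLin).comp (LinearMap.snd ℝ _ _) -
    ((LinearMap.lsum ℝ (fun _ => ℝ) ℝ fun i => LinearMap.toSpanSingleton ℝ ℝ
      ((M *ᵥ d) i))).comp (LinearMap.fst ℝ _ _)
  have hξ : ∀ Y, ξ Y = c ⬝ᵥ (M *ᵥ Y.2) - Y.1 ⬝ᵥ (M *ᵥ d) := fun Y => by
    simp [ξ, dotProduct, mul_comm]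
  refine ⟨vel_mem_tangentProd M hs c d, ξ, fun Y _ => ?_, fun Y hY => ?_⟩
  · obtain ⟨i, j, hi, hj, h⟩ := exists_ham_eq M (x + Y)
    obtain ⟨i', j', hi', hj', h'⟩ := exists_ham_eq M x
    have e1 := dotProduct_le_of_mem_face (I := univ) (y := M *ᵥ (x + Y).2) ⟨hc.1, by simp⟩
      fun i _ => hi i
    have e2 := le_dotProduct_of_mem_face (I := univ) (y := (x + Y).1 ᵥ* M) ⟨hd.1, by simp⟩
      fun i _ => hj i
    have e3 := dotProduct_le_of_mem_face (v := (M *ᵥ x.2) i') hc fun i hi => hi' i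
    have e3' := le_dotProduct_of_mem_face (v := (M *ᵥ x.2) i') hc fun i hi => hi i'
    have e4 := le_dotProduct_of_mem_face (v := (x.1 ᵥ* M) j') hd fun i hi => hj' i
    have e4' := dotProduct_le_of_mem_face (v := (x.1 ᵥ* M) j') hd fun i hi => hi j'
    rw [hξ, h, h', payDiff_apply, payDiff_apply]
    rw [dotProduct_mulVec Y.1, dotProduct_comm (Y.1 ᵥ* M) d]
    simp only [Prod.fst_add, Prod.snd_add, mulVec_add, add_vecMul, dotProduct_add,
      Pi.add_apply] at e1 e2 ⊢
    linarith
  · rw [symp_vel hA c d hY, hξ]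

/-- Row payoffs depend on `q` only and column payoffs on `p` only. Testing a subgradient on `(0, Y)`
and on `(Y, 0)` therefore produces `c` and `d` separately, and nondegeneracy of `ω` identifies the
vector. -/
lemma hamField_eq [Nonempty (Fin n)] {M A : Mat n} (hA : A.det ≠ 0) (hs : invSum A ≠ 0)
    (x : Pt n) : hamField M A x = {v | ∃ c ∈ face (topRows M x.2),
      ∃ d ∈ face (bottomCols M x.1), v = vel M A c d} := by
  refine Subset.antisymm ?_ ?_
  · rintro v ⟨hv, ξ, hξ, hvξ⟩
    obtain ⟨r, hr⟩ := exists_dotProduct_eq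
      (LinearMap.toContinuousLinearMap (ξ.comp (LinearMap.inr ℝ (Fin n → ℝ) (Fin n → ℝ))))
    obtain ⟨r', hr'⟩ := exists_dotProduct_eq
      (LinearMap.toContinuousLinearMap (ξ.comp (LinearMap.inl ℝ (Fin n → ℝ) (Fin n → ℝ))))
    simp only [LinearMap.coe_toContinuousLinearMap', LinearMap.comp_apply, LinearMap.inr_apply,
      LinearMap.inl_apply] at hr hr'
    obtain ⟨j₀, hj₀⟩ := bottomCols_nonempty M x.1
    obtain ⟨i₀, hi₀⟩ := topRows_nonempty M x.2
    obtain ⟨c, hc, hcr⟩ := exists_face_of_subgradient M x.2 r fun Y hY k hk l hl => by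
      have h1 := hξ (0, Y) ⟨by simp, hY⟩
      rw [hr, ham_eq_of_mem M x hk hj₀,
        ham_eq_of_mem M (x + (0, Y)) (i := l) (j := j₀) (by simpa using hl)
          (by simpa using hj₀)] at h1
      simp only [Prod.snd_add, Prod.fst_add, add_zero] at h1
      linarith
    obtain ⟨d, hd, hdr⟩ := exists_face_of_subgradient (-Mᵀ) x.1 r' fun Y hY k hk l hl => by
      rw [← bottomCols_eq] at hk hl
      have h1 := hξ (Y, 0) ⟨hY, by simp⟩
      rw [hr', ham_eq_of_mem M x hi₀ hk,
        ham_eq_of_mem M (x + (Y, 0)) (i := i₀) (j := l) (by simpa using hi₀)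
          (by simpa using hl)] at h1
      simp only [Prod.snd_add, Prod.fst_add, add_zero] at h1
      simp only [neg_mulVec, mulVec_transpose, Pi.neg_apply]
      linarith
    rw [← bottomCols_eq] at hd
    refine ⟨c, hc, d, hd, ?_⟩
    refine sub_eq_zero.1 (isSymplectic hA hs _ ?_ fun Y hY => ?_)
    · have h1 := vel_mem_tangentProd M hs c d
      refine ⟨?_, ?_⟩
      · simp [Finset.sum_sub_distrib, hv.1, h1.1]
      · simp [Finset.sum_sub_distrib, hv.2, h1.2]
    · rw [symp_sub_left, hvξ Y hY, symp_vel hA c d hY]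
      have hsplit : ξ Y = ξ (0, Y.2) + ξ (Y.1, 0) := by
        rw [← map_add]; simp
      rw [hsplit, hr, hr', hcr _ hY.2, hdr _ hY.1, neg_mulVec, mulVec_transpose, dotProduct_neg,
        dotProduct_comm d, ← dotProduct_mulVec]
      ring
  · rintro _ ⟨c, hc, d, hd, rfl⟩
    exact vel_mem_hamField hA hs hc hd

/-! ### Dimensions -/

/-- The two coordinate sums. -/
noncomputable def sums (n : ℕ) : Pt n →ₗ[ℝ] ℝ × ℝ :=
  LinearMap.prodMap (∑ i, LinearMap.proj i) (∑ i, LinearMap.proj i)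

@[simp] lemma sums_apply (x : Pt n) : sums n x = (∑ i, x.1 i, ∑ i, x.2 i) := by
  simp [sums]

/-- The tangent space as a submodule. -/
noncomputable def tanSub (n : ℕ) : Submodule ℝ (Pt n) := LinearMap.ker (sums n)

@[simp] lemma mem_tanSub {x : Pt n} : x ∈ tanSub n ↔ x ∈ tangentProd n := by
  simp [tanSub, tangentProd]

lemma sums_surjective [Nonempty (Fin n)] : Function.Surjective (sums n) := by
  rintro ⟨a, b⟩
  obtain ⟨i⟩ := ‹Nonempty (Fin n)›
  exact ⟨(Pi.single i a, Pi.single i b), by simp⟩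

lemma finrank_ker_of_surjective {F : Type*} [AddCommGroup F] [Module ℝ F]
    (L : Pt n →ₗ[ℝ] F) (hL : Function.Surjective L) :
    Module.finrank ℝ (LinearMap.ker L) = 2 * n - Module.finrank ℝ F := by
  have h := LinearMap.finrank_range_add_finrank_ker L
  rw [LinearMap.range_eq_top.2 hL, finrank_top, Module.finrank_prod, Module.finrank_fin_fun] at h
  omega

lemma finrank_tanSub [Nonempty (Fin n)] : Module.finrank ℝ (tanSub n) = 2 * n - 2 := by
  rw [tanSub, finrank_ker_of_surjective _ sums_surjective]
  simp

lemma finrank_tanSub_inf_ker [Nonempty (Fin n)] (l : Pt n →ₗ[ℝ] ℝ) {u : Pt n}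
    (hu : u ∈ tangentProd n) (hlu : l u ≠ 0) :
    Module.finrank ℝ (tanSub n ⊓ LinearMap.ker l : Submodule ℝ (Pt n)) = 2 * n - 3 := by
  rw [tanSub, ← LinearMap.ker_prod, finrank_ker_of_surjective]
  · simp
  · rintro ⟨a, c⟩
    obtain ⟨x, hx⟩ := sums_surjective (n := n) a
    have hu' : sums n u = 0 := by rw [← LinearMap.mem_ker]; exact mem_tanSub.2 hu
    refine ⟨x + ((c - l x) / l u) • u, ?_⟩
    change (sums n _, l _) = (a, c)
    rw [map_add, map_add, map_smul, map_smul, hu', hx]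
    ext
    · simp
    · simp
    · simp only [smul_eq_mul]
      field_simp
      ring

lemma add_mem_simplexProd {x Y : Pt n} (hx : x ∈ simplexProd n) (hY : Y ∈ tangentProd n)
    (h1 : ∀ i, 0 ≤ x.1 i + Y.1 i) (h2 : ∀ i, 0 ≤ x.2 i + Y.2 i) : x + Y ∈ simplexProd n :=
  ⟨⟨h1, by simp [Finset.sum_add_distrib, hx.1.2, hY.1]⟩,
    ⟨h2, by simp [Finset.sum_add_distrib, hx.2.2, hY.2]⟩⟩

lemma sub_mem_tangentProd {x y : Pt n} (hx : x ∈ simplexProd n) (hy : y ∈ simplexProd n) :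
    x - y ∈ tangentProd n :=
  ⟨by simp [Finset.sum_sub_distrib, hx.1.2, hy.1.2],
    by simp [Finset.sum_sub_distrib, hx.2.2, hy.2.2]⟩

/-! ### Polytopes as bounded intersections of half-spaces -/

/-- `C` is a finite intersection of closed half-spaces. -/
def IsHalfspaceInter (C : Set (Pt n)) : Prop :=
  ∃ F : Finset (Pt n →ᵃ[ℝ] ℝ), C = {x | ∀ f ∈ F, 0 ≤ f x}

namespace IsHalfspaceInter

lemma inter {C D : Set (Pt n)} (hC : IsHalfspaceInter C) (hD : IsHalfspaceInter D) :
    IsHalfspaceInter (C ∩ D) := by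
  classical
  obtain ⟨F, rfl⟩ := hC
  obtain ⟨G, rfl⟩ := hD
  refine ⟨F ∪ G, ?_⟩
  ext x
  simp only [mem_inter_iff, mem_ofPred_eq, Finset.mem_union]
  exact ⟨fun h f hf => hf.elim (h.1 f) (h.2 f), fun h => ⟨fun f hf => h f (Or.inl hf),
    fun f hf => h f (Or.inr hf)⟩⟩

lemma halfspace (f : Pt n →ᵃ[ℝ] ℝ) : IsHalfspaceInter {x | 0 ≤ f x} := ⟨{f}, by simp⟩

lemma forall_fintype {ι : Type*} [Fintype ι] (f : ι → Pt n →ᵃ[ℝ] ℝ) :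
    IsHalfspaceInter {x | ∀ i, 0 ≤ f i x} := by
  classical
  exact ⟨Finset.univ.image f, by simp⟩

lemma hyperplane (f : Pt n →ᵃ[ℝ] ℝ) : IsHalfspaceInter {x | f x = 0} := by
  have h : {x | f x = 0} = {x | 0 ≤ f x} ∩ {x | 0 ≤ (-f) x} := by
    ext x
    simp only [mem_inter_iff, mem_ofPred_eq]
    change f x = 0 ↔ 0 ≤ f x ∧ 0 ≤ -(f x)
    exact ⟨fun h => by simp [h], fun h => by linarith [h.1, h.2]⟩
  rw [h]
  exact (halfspace f).inter (halfspace (-f))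

/-- A bounded intersection of finitely many half-spaces is the convex hull of a finite set. -/
lemma exists_eq_convexHull {C : Set (Pt n)} (h : IsHalfspaceInter C) (hC : IsCompact C) :
    ∃ V : Finset (Pt n), C = convexHull ℝ (V : Set (Pt n)) := by
  obtain ⟨F, hF⟩ := h
  have hconv : Convex ℝ C := by
    rw [hF]
    intro x hx y hy a b ha hb hab f hf
    rw [Convex.combo_affine_apply hab]
    exact add_nonneg (mul_nonneg ha (hx f hf)) (mul_nonneg hb (hy f hf))
  -- Distinct extreme points have distinct active constraints: otherwise the segment from `y` to `x`
  -- could be prolonged beyond `x` inside `C`. So there are finitely many.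
  have hinj : Set.InjOn (fun x => {f : F | f.1 x = 0}) (C.extremePoints ℝ) := by
    intro x hx y hy hxy
    by_contra hne
    have hxC : ∀ f ∈ F, 0 ≤ f x := by simpa [hF] using hx.1
    have hyC : ∀ f ∈ F, 0 ≤ f y := by simpa [hF] using hy.1
    have hev : ∀ᶠ ε : ℝ in nhdsWithin 0 (Ioi 0), 0 < ε ∧
        ∀ f : F, 0 ≤ f.1 (AffineMap.lineMap y x (1 + ε)) := by
      refine eventually_mem_nhdsWithin.and (Filter.eventually_all.2 fun f => ?_)
      have hcalc : ∀ ε : ℝ, f.1 (AffineMap.lineMap y x (1 + ε)) =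
          f.1 x + ε * (f.1 x - f.1 y) := fun ε => by
        rw [AffineMap.apply_lineMap, AffineMap.lineMap_apply_ring]; ring
      rcases (hxC f f.2).lt_or_eq with hpos | hzero
      · have hc : Continuous fun ε : ℝ => f.1 x + ε * (f.1 x - f.1 y) := by fun_prop
        have := hc.tendsto 0
        rw [zero_mul, add_zero] at this
        filter_upwards [(this.eventually_const_lt hpos).filter_mono nhdsWithin_le_nhds] with ε hε
        rw [hcalc]; exact hε.le
      · have hfy : f.1 y = 0 := by
          have : f ∈ {f : F | f.1 x = 0} := hzero.symm
          rw [show {f : F | f.1 x = 0} = {f : F | f.1 y = 0} from hxy] at this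
          exact this
        filter_upwards with ε
        rw [hcalc, ← hzero, hfy]; simp
    obtain ⟨ε, hε, hz⟩ := hev.exists
    have hzC : AffineMap.lineMap y x (1 + ε) ∈ C := by
      rw [hF]; exact fun f hf => hz ⟨f, hf⟩
    have hseg : x ∈ openSegment ℝ (AffineMap.lineMap y x (1 + ε)) y := by
      refine ⟨1 / (1 + ε), ε / (1 + ε), by positivity, by positivity, by field_simp, ?_⟩
      rw [AffineMap.lineMap_apply_module']
      have h1 : (1 + ε) ≠ 0 := by positivity
      have h2 : 1 / (1 + ε) * (1 + ε) = 1 := by field_simp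
      have h3 : 1 / (1 + ε) + ε / (1 + ε) = 1 := by field_simp
      calc _ = (1 / (1 + ε) * (1 + ε)) • (x - y) + (1 / (1 + ε) + ε / (1 + ε)) • y := by
            module
        _ = x := by rw [h2, h3]; module
    have h5 := hx.2 hzC hy.1 hseg
    have h6 : (1 + ε) • (x - y) + y = x := by rw [← AffineMap.lineMap_apply_module']; exact h5
    have h7 : ε • (x - y) = 0 := by
      have : (1 + ε) • (x - y) + y = x + ε • (x - y) := by module
      rw [this] at h6
      simpa using h6
    exact hne (sub_eq_zero.1 ((smul_eq_zero.1 h7).resolve_left hε.ne'))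
  have hfin : (C.extremePoints ℝ).Finite :=
    Set.Finite.of_finite_image (Set.toFinite _) hinj
  refine ⟨hfin.toFinset, ?_⟩
  rw [hfin.coe_toFinset]
  -- Krein–Milman; the hull of a finite set is already closed.
  have h1 := closure_convexHull_extremePoints hC hconv
  exact h1.symm.trans (hfin.isClosed_convexHull ℝ).closure_eq

end IsHalfspaceInter

lemma isCompact_simplexProd : IsCompact (simplexProd n) :=
  (isCompact_stdSimplex ℝ (Fin n)).prod (isCompact_stdSimplex ℝ (Fin n))

/-- A linear functional minus a constant, as an affine map. -/
noncomputable def affSub (l : Pt n →ₗ[ℝ] ℝ) (c : ℝ) : Pt n →ᵃ[ℝ] ℝ :=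
  l.toAffineMap - AffineMap.const ℝ (Pt n) c

@[simp] lemma affSub_apply (l : Pt n →ₗ[ℝ] ℝ) (c : ℝ) (x : Pt n) : affSub l c x = l x - c := rfl

lemma isHalfspaceInter_simplexProd : IsHalfspaceInter (simplexProd n) := by
  have h : simplexProd n = (({x | ∀ i : Fin n ⊕ Fin n, 0 ≤ Sum.elim
      (fun i => affSub ((LinearMap.proj i).comp (LinearMap.fst ℝ _ _)) 0)
      (fun i => affSub ((LinearMap.proj i).comp (LinearMap.snd ℝ _ _)) 0) i x} ∩
      {x | affSub ((LinearMap.fst ℝ ℝ ℝ).comp (sums n)) 1 x = 0}) ∩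
      {x | affSub ((LinearMap.snd ℝ ℝ ℝ).comp (sums n)) 1 x = 0}) := by
    ext x
    simp only [simplexProd, stdSimplex, mem_prod, mem_ofPred_eq, mem_inter_iff, Sum.forall,
      Sum.elim_inl, Sum.elim_inr, affSub_apply, LinearMap.comp_apply, LinearMap.proj_apply,
      LinearMap.fst_apply, LinearMap.snd_apply, sums_apply, sub_zero, sub_eq_zero]
    tauto
  rw [h]
  exact ((IsHalfspaceInter.forall_fintype _).inter (.hyperplane _)).inter (.hyperplane _)

/-- The linear functional `(M q)_i`. -/
noncomputable def rowPay (M : Mat n) (i : Fin n) : Pt n →ₗ[ℝ] ℝ :=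
  ((LinearMap.proj i).comp M.mulVecLin).comp (LinearMap.snd ℝ _ _)

/-- The linear functional `(p' M)_j`. -/
noncomputable def colPay (M : Mat n) (j : Fin n) : Pt n →ₗ[ℝ] ℝ :=
  ((LinearMap.proj j).comp Mᵀ.mulVecLin).comp (LinearMap.fst ℝ _ _)

@[simp] lemma rowPay_apply (M : Mat n) (i : Fin n) (x : Pt n) : rowPay M i x = (M *ᵥ x.2) i := by
  simp [rowPay]

@[simp] lemma colPay_apply (M : Mat n) (j : Fin n) (x : Pt n) : colPay M j x = (x.1 ᵥ* M) j := by
  simp [colPay]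

lemma isHalfspaceInter_topRows (M : Mat n) (i : Fin n) :
    IsHalfspaceInter {x : Pt n | i ∈ topRows M x.2} := by
  have h : {x : Pt n | i ∈ topRows M x.2} =
      {x | ∀ k, 0 ≤ affSub (rowPay M i - rowPay M k) 0 x} := by
    ext x; simp [topRows]
  rw [h]
  exact .forall_fintype _

lemma isHalfspaceInter_bottomCols (M : Mat n) (j : Fin n) :
    IsHalfspaceInter {x : Pt n | j ∈ bottomCols M x.1} := by
  have h : {x : Pt n | j ∈ bottomCols M x.1} =
      {x | ∀ k, 0 ≤ affSub (colPay M k - colPay M j) 0 x} := by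
    ext x; simp [bottomCols]
  rw [h]
  exact .forall_fintype _

lemma IsHalfspaceInter.isClosed {C : Set (Pt n)} (h : IsHalfspaceInter C) : IsClosed C := by
  obtain ⟨F, rfl⟩ := h
  simp only [ofPred_forall]
  exact isClosed_biInter fun f _ =>
    isClosed_le continuous_const (AffineMap.continuous_of_finiteDimensional f)

/-- `hnear` makes `x₀` a relative interior point of `C` in the hyperplane where `l` is constant, so
the direction space of `C` is all of `tanSub n ⊓ ker l`. -/
lemma isPolytopeOfDim_of_near [Nonempty (Fin n)] {C : Set (Pt n)} (hC : IsHalfspaceInter C)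
    (l : Pt n →ₗ[ℝ] ℝ) {u x₀ : Pt n} (hu : u ∈ tangentProd n) (hlu : l u ≠ 0) (hx₀ : x₀ ∈ C)
    (hsub : ∀ x ∈ C, x ∈ simplexProd n ∧ l x = l x₀)
    (hnear : ∀ w ∈ tangentProd n, l w = 0 → ∀ᶠ ε : ℝ in nhdsWithin 0 (Ioi 0), x₀ + ε • w ∈ C) :
    IsPolytopeOfDim (2 * n - 3) C := by
  refine ⟨⟨x₀, hx₀⟩, hC.exists_eq_convexHull
    (isCompact_simplexProd.of_isClosed_subset hC.isClosed fun x hx => (hsub x hx).1), ?_⟩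
  have hspan : vectorSpan ℝ C = tanSub n ⊓ LinearMap.ker l := ?_
  · rw [hspan, finrank_tanSub_inf_ker l hu hlu]
  refine le_antisymm ?_ fun w hw => ?_
  · rw [vectorSpan_def, Submodule.span_le]
    rintro _ ⟨x, hx, y, hy, rfl⟩
    refine ⟨mem_tanSub.2 (sub_mem_tangentProd (hsub x hx).1 (hsub y hy).1), ?_⟩
    change l (x - y) = 0
    rw [map_sub, (hsub x hx).2, (hsub y hy).2,
      sub_self]
  · obtain ⟨hw1, hw2⟩ := hw
    obtain ⟨ε, hε, hmem⟩ := (eventually_mem_nhdsWithin.and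
      (hnear w (mem_tanSub.1 hw1) (LinearMap.mem_ker.1 hw2))).exists
    have h1 := vsub_mem_vectorSpan ℝ hmem hx₀
    rw [vsub_eq_sub, add_sub_cancel_left] at h1
    have h2 := Submodule.smul_mem _ ε⁻¹ h1
    rwa [smul_smul, inv_mul_cancel₀ (ne_of_gt hε), one_smul] at h2

lemma eventually_add_smul_mem_simplexProd {x w : Pt n} (hx : x ∈ simplexProd n)
    (hp : ∀ i, 0 < x.1 i) (hq : ∀ i, 0 < x.2 i) (hw : w ∈ tangentProd n) :
    ∀ᶠ ε : ℝ in nhds 0, x + ε • w ∈ simplexProd n := by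
  have h : ∀ a b : ℝ, 0 < a → ∀ᶠ ε : ℝ in nhds 0, 0 ≤ a + ε * b := fun a b ha => by
    have hc : Continuous fun ε : ℝ => a + ε * b := by fun_prop
    have := hc.tendsto 0
    rw [zero_mul, add_zero] at this
    filter_upwards [this.eventually_const_lt ha] with ε hε using hε.le
  have h1 : ∀ᶠ ε : ℝ in nhds 0, ∀ i, 0 ≤ x.1 i + ε * w.1 i :=
    Filter.eventually_all.2 fun i => h _ _ (hp i)
  have h2 : ∀ᶠ ε : ℝ in nhds 0, ∀ i, 0 ≤ x.2 i + ε * w.2 i :=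
    Filter.eventually_all.2 fun i => h _ _ (hq i)
  filter_upwards [h1, h2] with ε h1 h2
  refine add_mem_simplexProd hx ⟨?_, ?_⟩ h1 h2
  · simp [← Finset.mul_sum, hw.1]
  · simp [← Finset.mul_sum, hw.2]

lemma eventually_topRows_add_smul (M : Mat n) (x w : Pt n) :
    ∀ᶠ ε : ℝ in nhds 0, topRows M (x + ε • w).2 ⊆ topRows M x.2 := by
  have hc : Continuous fun ε : ℝ => (x + ε • w).2 := by fun_prop
  have := hc.tendsto 0
  rw [zero_smul, add_zero] at this
  exact this.eventually (eventually_topRows_subset M x.2)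

lemma eventually_bottomCols_add_smul (M : Mat n) (x w : Pt n) :
    ∀ᶠ ε : ℝ in nhds 0, bottomCols M (x + ε • w).1 ⊆ bottomCols M x.1 := by
  have hc : Continuous fun ε : ℝ => (x + ε • w).1 := by fun_prop
  have := hc.tendsto 0
  rw [zero_smul, add_zero] at this
  exact this.eventually (eventually_bottomCols_subset M x.1)

/-! ### The Hamiltonian near the equilibrium -/

lemma exists_topRows_single (M : Mat n) {p v : Fin n → ℝ} {i : Fin n}
    (hv : ∀ k, (M *ᵥ v) k = (Pi.single i 1 : Fin n → ℝ) k - p i) : topRows M v = {i} := by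
  ext k
  simp only [topRows, mem_ofPred_eq, hv, mem_singleton_iff]
  constructor
  · intro h
    by_contra hne
    have := h i
    simp [hne] at this
    linarith
  · rintro rfl l
    by_cases hl : l = k
    · rw [hl]
    · simp [hl]

namespace IsEquil

variable {M : Mat n} {p q : Fin n → ℝ} {μ : ℝ}

lemma mem_simplexProd (h : IsEquil M p q μ) : (p, q) ∈ simplexProd n :=
  ⟨⟨fun i => (h.p_pos i).le, h.p_sum⟩, ⟨fun i => (h.q_pos i).le, h.q_sum⟩⟩

/-- The bordered system with right-hand side `(0, w)` is solvable, and pairing its solution with `p`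
shows that the border unknown is zero. -/
lemma exists_mulVec_eq (h : IsEquil M p q μ) {w : Fin n → ℝ} (hw : p ⬝ᵥ w = 0) :
    ∃ v, ∑ j, v j = 0 ∧ M *ᵥ v = w := by
  set z : Option (Fin n) → ℝ := (bordered M)⁻¹ *ᵥ fun i => Option.elim i 0 w with hz
  have h1 : bordered M *ᵥ z = fun i => Option.elim i 0 w := by
    rw [hz, mulVec_mulVec, mul_nonsing_inv _ h.det_bordered_ne_zero.isUnit, one_mulVec]
  have hsum : ∑ j, z (some j) = 0 := by
    have := congrFun h1 none
    rwa [bordered_mulVec_none] at this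
  have h2 : ∀ i, z none + (M *ᵥ fun j => z (some j)) i = w i := fun i => by
    have := congrFun h1 (some i)
    rwa [bordered_mulVec_some] at this
  have h3 : p ⬝ᵥ (M *ᵥ fun j => z (some j)) = 0 := by
    rw [dotProduct_mulVec, h.vecMul_eq]
    simp [dotProduct, ← Finset.mul_sum, hsum]
  have h4 : z none = 0 := by
    have : p ⬝ᵥ w = z none * ∑ i, p i + p ⬝ᵥ (M *ᵥ fun j => z (some j)) := by
      simp only [dotProduct, Finset.mul_sum, ← Finset.sum_add_distrib, ← h2]
      exact Finset.sum_congr rfl fun i _ => by ring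
    rw [hw, h3, h.p_sum] at this
    linarith
  refine ⟨fun j => z (some j), hsum, funext fun i => ?_⟩
  have := h2 i
  rw [h4] at this
  linarith

lemma exists_vecMul_eq (h : IsEquil M p q μ) {w : Fin n → ℝ} (hw : q ⬝ᵥ w = 0) :
    ∃ u, ∑ j, u j = 0 ∧ u ᵥ* M = w := by
  obtain ⟨u, hu, huw⟩ := h.transpose.exists_mulVec_eq hw
  exact ⟨u, hu, by rwa [mulVec_transpose] at huw⟩

lemma topRows_add (h : IsEquil M p q μ) (v : Fin n → ℝ) : topRows M (q + v) = topRows M v := by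
  ext i; simp [topRows, mulVec_add, h.mulVec_eq]

lemma bottomCols_add (h : IsEquil M p q μ) (u : Fin n → ℝ) :
    bottomCols M (p + u) = bottomCols M u := by
  ext i; simp [bottomCols, add_vecMul, h.vecMul_eq]

variable [Nonempty (Fin n)]

lemma ham_add (h : IsEquil M p q μ) (Y : Pt n) : ham M ((p, q) + Y) = ham M Y := by
  obtain ⟨i, j, hi, hj, hY⟩ := exists_ham_eq M Y
  rw [hY, ham_eq_of_mem M _ (i := i) (j := j), Prod.fst_add, Prod.snd_add, mulVec_add,
    add_vecMul, h.mulVec_eq, h.vecMul_eq, payDiff_apply]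
  · simp
  · exact (h.topRows_add Y.2).symm ▸ hi
  · exact (h.bottomCols_add Y.1).symm ▸ hj

/-- If `H Y ≤ 0`, every row payoff is at most every column payoff. Their means with weights `p` and
`q` are both zero, so rows are `≤ 0` and columns `≥ 0`. Positivity of the weights makes all of them
zero, and injectivity gives `Y = 0`. -/
lemma ham_pos (h : IsEquil M p q μ) {Y : Pt n} (hY : Y ∈ tangentProd n) (hne : Y ≠ 0) :
    0 < ham M Y := by
  by_contra hle
  push Not at hle
  have h1 : ∀ i j, (M *ᵥ Y.2) i ≤ (Y.1 ᵥ* M) j := fun i j => by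
    have := (payDiff_le_ham M Y i j).trans hle
    rw [payDiff_apply] at this
    linarith
  have hpf : p ∈ face univ := ⟨h.mem_simplexProd.1, by simp⟩
  have hqf : q ∈ face univ := ⟨h.mem_simplexProd.2, by simp⟩
  have e1 : p ⬝ᵥ (M *ᵥ Y.2) = 0 := by
    rw [dotProduct_mulVec, h.vecMul_eq]; simp [dotProduct, ← Finset.mul_sum, hY.2]
  have e2 : q ⬝ᵥ (Y.1 ᵥ* M) = 0 := by
    rw [dotProduct_comm, ← dotProduct_mulVec, h.mulVec_eq]
    simp [dotProduct, ← Finset.sum_mul, hY.1]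
  have h2 : ∀ i, (M *ᵥ Y.2) i ≤ 0 := fun i => by
    rw [← e2]; exact le_dotProduct_of_mem_face hqf fun j _ => h1 i j
  have h3 : ∀ j, 0 ≤ (Y.1 ᵥ* M) j := fun j => by
    rw [← e1]; exact dotProduct_le_of_mem_face hpf fun i _ => h1 i j
  have h4 : M *ᵥ Y.2 = fun _ => 0 := funext fun i =>
    eq_of_dotProduct_eq hpf (fun i _ => h2 i) e1 (h.p_pos i).ne'
  have h5 : Y.1 ᵥ* M = fun _ => 0 := funext fun j => by
    have := eq_of_dotProduct_eq (y := -(Y.1 ᵥ* M)) (v := 0) hqf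
      (fun i _ => by simpa using h3 i) (by rw [dotProduct_neg, e2, neg_zero]) (h.q_pos j).ne'
    simpa using this
  exact hne (Prod.ext (h.inj_left _ hY.1 _ h5) (h.inj_right _ hY.2 _ h4))

/-- Compactness of the unit sphere of the tangent space and homogeneity of `H`. -/
lemma exists_mul_norm_le_ham (h : IsEquil M p q μ) :
    ∃ m > 0, ∀ Y ∈ tangentProd n, m * ‖Y‖ ≤ ham M Y := by
  have hcomp : IsCompact ((tanSub n : Set (Pt n)) ∩ Metric.sphere 0 1) :=
    (isCompact_sphere (0 : Pt n) 1).inter_left (Submodule.closed_of_finiteDimensional _)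
  have key : ∃ m > 0, ∀ Y ∈ (tanSub n : Set (Pt n)) ∩ Metric.sphere 0 1, m ≤ ham M Y := by
    rcases ((tanSub n : Set (Pt n)) ∩ Metric.sphere 0 1).eq_empty_or_nonempty with he | hne
    · exact ⟨1, one_pos, by simp [he]⟩
    · obtain ⟨Y, hY, hmin⟩ := hcomp.exists_isMinOn hne (continuous_ham M).continuousOn
      refine ⟨ham M Y, h.ham_pos (mem_tanSub.1 hY.1) ?_, fun Z hZ => hmin hZ⟩
      rintro rfl
      simpa using hY.2
  obtain ⟨m, hm, hle⟩ := key
  refine ⟨m, hm, fun Y hY => ?_⟩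
  by_cases h0 : Y = 0
  · have : ham M (0 : Pt n) = 0 := by
      obtain ⟨i, j, -, -, h⟩ := exists_ham_eq M 0
      rw [h, map_zero]
    simp [h0, this]
  · have hn : ‖Y‖ ≠ 0 := norm_ne_zero_iff.2 h0
    have h1 := hle (‖Y‖⁻¹ • Y) ⟨Submodule.smul_mem _ _ (mem_tanSub.2 hY), by
      simp [norm_smul, hn]⟩
    rw [ham_smul M (by positivity), inv_mul_eq_div, le_div_iff₀ (by positivity)] at h1
    exact h1

/-- Below this level the norm of `Y` is smaller than every coordinate of `p` and `q`, so `H` cannot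
reach the boundary of the simplices. -/
lemma exists_threshold (h : IsEquil M p q μ) : ∃ ρ₀ > 0, ∀ Y ∈ tangentProd n, ham M Y < ρ₀ →
    (∀ i, 0 < p i + Y.1 i) ∧ ∀ i, 0 < q i + Y.2 i := by
  obtain ⟨m, hm, hle⟩ := h.exists_mul_norm_le_ham
  obtain ⟨i₀, hi₀⟩ := Finite.exists_min p
  obtain ⟨j₀, hj₀⟩ := Finite.exists_min q
  have hδ : 0 < min (p i₀) (q j₀) := lt_min (h.p_pos _) (h.q_pos _)
  refine ⟨m * min (p i₀) (q j₀), mul_pos hm hδ, fun Y hY hlt => ?_⟩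
  have h1 : ‖Y‖ < min (p i₀) (q j₀) := lt_of_mul_lt_mul_left ((hle Y hY).trans_lt hlt) hm.le
  constructor
  · intro i
    have h2 : |Y.1 i| ≤ ‖Y‖ := (norm_le_pi_norm Y.1 i).trans (norm_fst_le Y)
    have h3 := (abs_le.1 h2).1
    have h4 := hi₀ i
    have h5 := min_le_left (p i₀) (q j₀)
    linarith
  · intro i
    have h2 : |Y.2 i| ≤ ‖Y‖ := (norm_le_pi_norm Y.2 i).trans (norm_snd_le Y)
    have h3 := (abs_le.1 h2).1
    have h4 := hj₀ i
    have h5 := min_le_right (p i₀) (q j₀)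
    linarith

end IsEquil

/-- `ρ` is a value for which the level set of `H` in the affine span of `Σ × Σ` lies in the
relative interior of `Σ × Σ`. -/
structure IsSmall (M : Mat n) (p q : Fin n → ℝ) (ρ : ℝ) : Prop where
  pos : 0 < ρ
  interior : ∀ Y ∈ tangentProd n, ham M Y = ρ → (∀ i, 0 < p i + Y.1 i) ∧ ∀ i, 0 < q i + Y.2 i

lemma isPolytopeOfDim_swap {d : ℕ} {C : Set (Pt n)} (hC : IsPolytopeOfDim d C) :
    IsPolytopeOfDim d (Prod.swap ⁻¹' C) := by
  classical
  obtain ⟨hne, ⟨F, hF⟩, hd⟩ := hC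
  let e : Pt n ≃ₗ[ℝ] Pt n := LinearEquiv.prodComm ℝ _ _
  have himg : Prod.swap ⁻¹' C = e '' C := by
    ext x
    constructor
    · intro hx
      exact ⟨x.swap, hx, Prod.swap_swap x⟩
    · rintro ⟨y, hy, rfl⟩
      change Prod.swap (Prod.swap y) ∈ C
      rwa [Prod.swap_swap]
  rw [himg]
  refine ⟨hne.image _, ⟨F.image e, ?_⟩, ?_⟩
  · rw [hF, Finset.coe_image]
    exact (e : Pt n →ₗ[ℝ] Pt n).image_convexHull _
  · rw [← hd]
    have : vectorSpan ℝ (e '' C) = (vectorSpan ℝ C).map (e : Pt n →ₗ[ℝ] Pt n) :=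
      ((e : Pt n →ₗ[ℝ] Pt n).toAffineMap.map_vectorSpan (s := C)).symm
    rw [this]
    exact LinearEquiv.finrank_map_eq e _

lemma projInv_mulVec_eq_zero {A : Mat n} (hA : A.det ≠ 0) {z : Fin n → ℝ}
    (hz : projInv A *ᵥ z = 0) : ∃ ν : ℝ, z = fun _ => ν := by
  rw [← projAlong_eq, projAlong, sub_eq_zero] at hz
  have h1 := congrArg (A *ᵥ ·) hz
  simp only [mulVec_smul, mulVec_mulVec, mul_nonsing_inv _ hA.isUnit, one_mulVec] at h1
  exact ⟨_, h1.trans (funext fun i => by simp; rfl)⟩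

/-- `projInv A` kills only constant vectors, and `M` maps no nonzero tangent vector to a constant.
-/
lemma IsEquil.injOn_vel_right {M A : Mat n} {p q : Fin n → ℝ} {μ : ℝ} (h : IsEquil M p q μ) (hA : A.det ≠ 0)
    {d d' : Fin n → ℝ} (hd : d ∈ stdSimplex ℝ (Fin n)) (hd' : d' ∈ stdSimplex ℝ (Fin n))
    (heq : projInv A *ᵥ (M *ᵥ d) = projInv A *ᵥ (M *ᵥ d')) : d = d' := by
  rw [← sub_eq_zero, ← mulVec_sub, ← mulVec_sub] at heq
  obtain ⟨ν, hν⟩ := projInv_mulVec_eq_zero hA heq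
  exact sub_eq_zero.1 (h.inj_right _ (by simp [Finset.sum_sub_distrib, hd.2, hd'.2]) ν hν)

lemma IsEquil.injOn_vel_left {M A : Mat n} {p q : Fin n → ℝ} {μ : ℝ} (h : IsEquil M p q μ) (hA : A.det ≠ 0)
    {c c' : Fin n → ℝ} (hc : c ∈ stdSimplex ℝ (Fin n)) (hc' : c' ∈ stdSimplex ℝ (Fin n))
    (heq : (projInv A)ᵀ *ᵥ (Mᵀ *ᵥ c) = (projInv A)ᵀ *ᵥ (Mᵀ *ᵥ c')) : c = c' := by
  rw [← projInv_transpose] at heq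
  exact h.transpose.injOn_vel_right (by rwa [det_transpose]) hc hc' heq

section Level

variable {M : Mat n} {p q : Fin n → ℝ} {μ ρ : ℝ} [Nonempty (Fin n)]

lemma IsSmall.mem_levelSet_add (hρ : IsSmall M p q ρ) (h : IsEquil M p q μ) {Y : Pt n}
    (hY : Y ∈ tangentProd n) (hham : ham M Y = ρ) : (p, q) + Y ∈ levelSet M ρ := by
  obtain ⟨h1, h2⟩ := hρ.interior Y hY hham
  exact ⟨add_mem_simplexProd h.mem_simplexProd hY (fun i => (h1 i).le) fun i => (h2 i).le,
    by rw [h.ham_add, hham]⟩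

lemma IsEquil.ham_sub (h : IsEquil M p q μ) (x : Pt n) : ham M (x - (p, q)) = ham M x := by
  rw [← h.ham_add, add_sub_cancel]

lemma IsSmall.mem_levelSet (hρ : IsSmall M p q ρ) (h : IsEquil M p q μ) {x y : Pt n}
    (hx : x ∈ simplexProd n) (hxy : y - x ∈ tangentProd n) (hham : ham M y = ρ) :
    y ∈ levelSet M ρ := by
  have h1 : y - (p, q) ∈ tangentProd n := by
    have h2 := (tanSub n).add_mem (mem_tanSub.2 hxy)
      (mem_tanSub.2 (sub_mem_tangentProd hx h.mem_simplexProd))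
    rw [sub_add_sub_cancel] at h2
    exact mem_tanSub.1 h2
  have := hρ.mem_levelSet_add h h1 (by rw [h.ham_sub, hham])
  rwa [add_sub_cancel] at this

lemma isCompact_levelSet (M : Mat n) (ρ : ℝ) : IsCompact (levelSet M ρ) :=
  isCompact_simplexProd.inter_right (isClosed_eq (continuous_ham M) continuous_const)

/-- Small level sets are spheres. -/
lemma IsSmall.nonempty_homeomorph (hρ : IsSmall M p q ρ) (h : IsEquil M p q μ) :
    Nonempty (levelSet M ρ ≃ₜ Metric.sphere (0 : EuclideanSpace ℝ (Fin (2 * n - 2))) 1) := by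
  let L : tanSub n ≃L[ℝ] EuclideanSpace ℝ (Fin (2 * n - 2)) :=
    ContinuousLinearEquiv.ofFinrankEq (by simp [finrank_tanSub])
  have hmem : ∀ x : levelSet M ρ, (x : Pt n) - (p, q) ∈ tanSub n := fun x =>
    mem_tanSub.2 (sub_mem_tangentProd x.2.1 h.mem_simplexProd)
  let Y : levelSet M ρ → tanSub n := fun x => ⟨x - (p, q), hmem x⟩
  have hYham : ∀ x, ham M (Y x) = ρ := fun x => by
    change ham M (x - (p, q)) = ρ
    rw [h.ham_sub]; exact x.2.2
  have hham0 : ham M (0 : Pt n) = 0 := by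
    obtain ⟨i, j, -, -, h⟩ := exists_ham_eq M 0
    rw [h, map_zero]
  have hLY : ∀ x, ‖L (Y x)‖ ≠ 0 := fun x h0 => by
    have h1 : Y x = 0 := by simpa using h0
    have h2 := hYham x
    rw [h1, Submodule.coe_zero, hham0] at h2
    exact hρ.pos.ne h2
  have hYcont : Continuous Y := Continuous.subtype_mk (continuous_subtype_val.sub continuous_const) _
  let S := Metric.sphere (0 : EuclideanSpace ℝ (Fin (2 * n - 2))) 1
  have hSpos : ∀ u : S, 0 < ham M (L.symm u : tanSub n) := fun u => by
    refine h.ham_pos (mem_tanSub.1 (L.symm u).2) fun h0 => ?_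
    have h1 : (u : EuclideanSpace ℝ (Fin (2 * n - 2))) = 0 := by
      have : L.symm u = 0 := Subtype.ext h0
      simpa using this
    have h2 := u.2
    rw [mem_sphere_zero_iff_norm, h1, norm_zero] at h2
    exact zero_ne_one h2
  -- On each open ray of the tangent space `H` is linear and positive, so it takes the value `ρ`
  -- exactly once.
  let Z : S → Pt n := fun u => (ρ / ham M (L.symm u : tanSub n)) • ((L.symm u : tanSub n) : Pt n)
  have hZ : ∀ u, Z u ∈ tanSub n ∧ ham M (Z u) = ρ := fun u => by
    refine ⟨Submodule.smul_mem _ _ (L.symm u).2, ?_⟩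
    rw [ham_smul M (div_pos hρ.pos (hSpos u)).le, div_mul_cancel₀ _ (hSpos u).ne']
  have hZcont : Continuous Z := by
    have h1 : Continuous fun u : S => ((L.symm u : tanSub n) : Pt n) :=
      continuous_subtype_val.comp (L.symm.continuous.comp continuous_subtype_val)
    exact (continuous_const.div ((continuous_ham M).comp h1) fun u => (hSpos u).ne').smul h1
  refine ⟨{
    toFun := fun x => ⟨‖L (Y x)‖⁻¹ • L (Y x), by simp [norm_smul, hLY x]⟩
    invFun := fun u => ⟨(p, q) + Z u, hρ.mem_levelSet_add h (mem_tanSub.1 (hZ u).1) (hZ u).2⟩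
    left_inv := fun x => ?_
    right_inv := fun u => ?_
    continuous_toFun := ?_
    continuous_invFun := ?_ }⟩
  · refine Subtype.ext ?_
    simp only [Z, map_smul, ContinuousLinearEquiv.symm_apply_apply, Submodule.coe_smul]
    rw [ham_smul M (by positivity), hYham, smul_smul]
    have : ρ / (‖L (Y x)‖⁻¹ * ρ) * ‖L (Y x)‖⁻¹ = 1 := by
      have h1 := hLY x
      have h2 := hρ.pos.ne'
      field_simp
    rw [this, one_smul]
    change (p, q) + ((x : Pt n) - (p, q)) = x
    rw [add_sub_cancel]
  · refine Subtype.ext ?_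
    have h1 : Y ⟨(p, q) + Z u, hρ.mem_levelSet_add h (mem_tanSub.1 (hZ u).1) (hZ u).2⟩ =
        (ρ / ham M (L.symm u : tanSub n)) • L.symm u := Subtype.ext (by simp [Y, Z])
    simp only [h1, map_smul, ContinuousLinearEquiv.apply_symm_apply]
    have h2 : ‖(u : EuclideanSpace ℝ (Fin (2 * n - 2)))‖ = 1 := mem_sphere_zero_iff_norm.1 u.2
    have h3 : 0 < ρ / ham M (L.symm u : tanSub n) := div_pos hρ.pos (hSpos u)
    rw [norm_smul, h2, Real.norm_of_nonneg h3.le, mul_one, smul_smul, inv_mul_cancel₀ h3.ne',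
      one_smul]
  · refine Continuous.subtype_mk ?_ _
    exact ((L.continuous.comp hYcont).norm.inv₀ hLY).smul (L.continuous.comp hYcont)
  · exact Continuous.subtype_mk (continuous_const.add hZcont) _

/-- Solve `M v = e_i - p_i 1` and `u' M = -(e_j - q_j 1)'`; the right-hand sides are orthogonal to
`p` and `q`, as `exists_mulVec_eq` and `exists_vecMul_eq` require. -/
lemma IsEquil.exists_direction (hn : 2 ≤ n) (h : IsEquil M p q μ) (i j : Fin n) : ∃ Y ∈ tangentProd n,
    topRows M Y.2 = {i} ∧ bottomCols M Y.1 = {j} ∧ 0 < payDiff M i j Y ∧ ham M Y = payDiff M i j Y := by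
  have hp : p ⬝ᵥ (Pi.single i 1 - fun _ => p i) = 0 := by
    rw [dotProduct_sub, dotProduct_single_one]
    simp [dotProduct, ← Finset.sum_mul, h.p_sum]
  have hq : q ⬝ᵥ -(Pi.single j 1 - fun _ => q j) = 0 := by
    rw [dotProduct_neg, dotProduct_sub, dotProduct_single_one]
    simp [dotProduct, ← Finset.sum_mul, h.q_sum]
  obtain ⟨v, hv, hMv⟩ := h.exists_mulVec_eq hp
  obtain ⟨u, hu, hMu⟩ := h.exists_vecMul_eq hq
  have h1 : topRows M v = {i} := exists_topRows_single M (p := p) fun k => by rw [hMv]; rfl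
  have h2 : bottomCols M u = {j} := by
    rw [bottomCols_eq]
    refine exists_topRows_single _ (p := q) fun k => ?_
    rw [neg_mulVec, mulVec_transpose, hMu, neg_neg]; rfl
  have h3 : ham M (u, v) = payDiff M i j (u, v) := by
    rw [payDiff_apply]
    exact ham_eq_of_mem M _ (h1.symm ▸ mem_singleton i) (h2.symm ▸ mem_singleton j)
  refine ⟨(u, v), ⟨hu, hv⟩, h1, h2, ?_, h3⟩
  rw [← h3]
  refine h.ham_pos ⟨hu, hv⟩ fun h0 => ?_
  have hv0 : v = 0 := congrArg Prod.snd h0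
  have hu0 : u = 0 := congrArg Prod.fst h0
  subst hv0 hu0
  -- For `Y = 0` every row would be a top row, which contradicts `2 ≤ n`.
  have e1 : ∀ k : Fin n, k = i := fun k => by
    have : k ∈ topRows M (0 : Fin n → ℝ) := fun l => by simp
    rwa [h1] at this
  have e2 := (e1 ⟨0, by omega⟩).trans (e1 ⟨1, by omega⟩).symm
  simp at e2

/-- Small level sets are finite unions of polytopes of codimension one. -/
lemma IsSmall.isPolyhedralOfDim (hn : 2 ≤ n) (hρ : IsSmall M p q ρ) (h : IsEquil M p q μ) :
    IsPolyhedralOfDim (2 * n - 3) (levelSet M ρ) := by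
  let C : Fin n × Fin n → Set (Pt n) := fun k => ((simplexProd n ∩ {x | k.1 ∈ topRows M x.2}) ∩
    {x | k.2 ∈ bottomCols M x.1}) ∩ {x | affSub (payDiff M k.1 k.2) ρ x = 0}
  refine ⟨range C, finite_range C, ?_, ?_⟩
  · rintro _ ⟨⟨i, j⟩, rfl⟩
    obtain ⟨Y, hY, htop, hbot, hpos, hham⟩ := IsEquil.exists_direction hn h i j
    set t := ρ / payDiff M i j Y with ht
    have htpos : 0 < t := div_pos hρ.pos hpos
    have htY : t • Y ∈ tangentProd n :=
      mem_tanSub.1 ((tanSub n).smul_mem t (mem_tanSub.2 hY))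
    have hhamt : ham M (t • Y) = ρ := by
      rw [ham_smul M htpos.le, hham, ht, div_mul_cancel₀ _ hpos.ne']
    obtain ⟨hposp, hposq⟩ := hρ.interior _ htY hhamt
    have hlev := hρ.mem_levelSet_add h htY hhamt
    -- A relative interior point of the piece: its coordinates are positive, and `i` and `j` are its
    -- only active indices.
    set x₀ := (p, q) + t • Y with hx₀
    have hsm : ∀ (N : Mat n) (v : Fin n → ℝ), topRows N (t • v) = topRows N v := fun N v => by
      ext k; simp [topRows, mulVec_smul, htpos]
    have htop₀ : topRows M x₀.2 = {i} := by
      rw [← htop, ← hsm M Y.2]; exact h.topRows_add _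
    have hbot₀ : bottomCols M x₀.1 = {j} := by
      rw [← hbot, bottomCols_eq M Y.1, ← hsm _ Y.1, ← bottomCols_eq]; exact h.bottomCols_add _
    have hpay₀ : payDiff M i j x₀ = ρ := by
      rw [← hlev.2, payDiff_apply, ham_eq_of_mem M x₀ (htop₀ ▸ mem_singleton i)
        (hbot₀ ▸ mem_singleton j)]
    refine isPolytopeOfDim_of_near (((isHalfspaceInter_simplexProd.inter
      (isHalfspaceInter_topRows M i)).inter (isHalfspaceInter_bottomCols M j)).inter
      (.hyperplane _)) (payDiff M i j) (x₀ := x₀) hY hpos.ne' ?_ ?_ ?_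
    · refine ⟨⟨⟨hlev.1, by simp [htop₀]⟩, by simp [hbot₀]⟩, ?_⟩
      rw [mem_ofPred_eq, affSub_apply, hpay₀, sub_self]
    · rintro x ⟨⟨⟨hx, -⟩, -⟩, hx4⟩
      rw [mem_ofPred_eq, affSub_apply, sub_eq_zero] at hx4
      exact ⟨hx, by rw [hpay₀]; exact hx4⟩
    · intro w hw hlw
      refine Filter.Eventually.filter_mono nhdsWithin_le_nhds ?_
      filter_upwards [eventually_add_smul_mem_simplexProd hlev.1 hposp hposq hw,
        eventually_topRows_add_smul M x₀ w, eventually_bottomCols_add_smul M x₀ w]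
        with ε h1 h2 h3
      rw [htop₀] at h2
      rw [hbot₀] at h3
      refine ⟨⟨⟨h1, ?_⟩, ?_⟩, ?_⟩
      · obtain ⟨k, hk⟩ := topRows_nonempty M (x₀ + ε • w).2
        have := h2 hk
        rw [mem_singleton_iff] at this
        exact this ▸ hk
      · obtain ⟨k, hk⟩ := bottomCols_nonempty M (x₀ + ε • w).1
        have := h3 hk
        rw [mem_singleton_iff] at this
        exact this ▸ hk
      · rw [mem_ofPred_eq, affSub_apply, map_add, map_smul, hlw, hpay₀]; simp
  · ext x
    simp only [sUnion_range, mem_iUnion]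
    constructor
    · rintro ⟨hx, hham⟩
      obtain ⟨i, j, hi, hj, hij⟩ := exists_ham_eq M x
      exact ⟨(i, j), ⟨⟨⟨hx, hi⟩, hj⟩, by rw [mem_ofPred_eq, affSub_apply, ← hij, hham, sub_self]⟩⟩
    · rintro ⟨⟨i, j⟩, ⟨⟨⟨hx, hi⟩, hj⟩, hham⟩⟩
      rw [mem_ofPred_eq, affSub_apply, sub_eq_zero, payDiff_apply] at hham
      exact ⟨hx, by rw [ham_eq_of_mem M x hi hj, hham]⟩

/-- The points where two rows are both best replies form a polytope of codimension one. -/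
lemma IsEquil.isPolytopeOfDim_topRows (h : IsEquil M p q μ) {i k : Fin n} (hik : i ≠ k) :
    IsPolytopeOfDim (2 * n - 3)
      ((simplexProd n ∩ {x | i ∈ topRows M x.2}) ∩ {x | k ∈ topRows M x.2}) := by
  -- This right-hand side gives a direction with exactly `i` and `k` tied on top; the one in `hp'`
  -- gives a tangent direction that breaks the tie.
  have hp : p ⬝ᵥ (Pi.single i 1 + Pi.single k 1 - fun _ => p i + p k) = 0 := by
    rw [dotProduct_sub, dotProduct_add, dotProduct_single_one, dotProduct_single_one]
    simp [dotProduct, ← Finset.sum_mul, h.p_sum]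
  have hp' : p ⬝ᵥ (Pi.single i 1 - fun _ => p i) = 0 := by
    rw [dotProduct_sub, dotProduct_single_one]
    simp [dotProduct, ← Finset.sum_mul, h.p_sum]
  obtain ⟨v, hv, hMv⟩ := h.exists_mulVec_eq hp
  obtain ⟨v', hv', hMv'⟩ := h.exists_mulVec_eq hp'
  obtain ⟨ε, hε, hposq⟩ := exists_pos_add_smul q v h.q_pos
  have htop : topRows M v = {i, k} := by
    ext l
    simp only [topRows, mem_ofPred_eq, hMv, mem_insert_iff, mem_singleton_iff, Pi.sub_apply,
      Pi.add_apply]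
    constructor
    · intro hl
      by_contra hne
      push Not at hne
      have := hl i
      simp [hne.1, hne.2, hik] at this
      linarith
    · rintro (rfl | rfl) m
      · by_cases hm : m = l
        · rw [hm]
        · by_cases hm' : m = k <;> simp [hm, hm', hik, hik.symm]
          linarith
      · by_cases hm : m = l
        · rw [hm]
        · by_cases hm' : m = i <;> simp [hm, hm', hik, hik.symm]
          linarith
  set x₀ : Pt n := (p, q + ε • v) with hx₀
  have hx₀mem : x₀ ∈ simplexProd n := ⟨h.mem_simplexProd.1, fun j => (hposq j).le, by
    change ∑ j, (q j + ε * v j) = 1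
    simp [Finset.sum_add_distrib, ← Finset.mul_sum, hv, h.q_sum]⟩
  have htop₀ : topRows M x₀.2 = {i, k} := by
    rw [← htop, hx₀, h.topRows_add]
    ext l; simp [topRows, mulVec_smul, hε]
  refine isPolytopeOfDim_of_near ((isHalfspaceInter_simplexProd.inter
    (isHalfspaceInter_topRows M i)).inter (isHalfspaceInter_topRows M k))
    (rowPay M i - rowPay M k) (u := (0, v')) (x₀ := x₀) ⟨by simp, hv'⟩ ?_ ?_ ?_ ?_
  · simp [hMv', hik.symm]
  · exact ⟨⟨hx₀mem, by simp [htop₀]⟩, by simp [htop₀]⟩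
  · have hzero : ∀ x ∈ ((simplexProd n ∩ {x | i ∈ topRows M x.2}) ∩ {x | k ∈ topRows M x.2}),
        (rowPay M i - rowPay M k) x = 0 := by
      rintro x ⟨⟨hx, hi⟩, hk⟩
      simp only [LinearMap.sub_apply, rowPay_apply]
      exact sub_eq_zero.2 (le_antisymm (hk i) (hi k))
    intro x hx
    rw [hzero x hx, hzero x₀ ⟨⟨hx₀mem, by simp [htop₀]⟩, by simp [htop₀]⟩]
    exact ⟨hx.1.1, rfl⟩
  · intro w hw hlw
    refine Filter.Eventually.filter_mono nhdsWithin_le_nhds ?_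
    filter_upwards [eventually_add_smul_mem_simplexProd hx₀mem h.p_pos hposq hw,
      eventually_topRows_add_smul M x₀ w] with δ h1 h2
    rw [htop₀] at h2
    have heq : (M *ᵥ (x₀ + δ • w).2) i = (M *ᵥ (x₀ + δ • w).2) k := by
      have e1 : (M *ᵥ x₀.2) i = (M *ᵥ x₀.2) k := by
        have hi : i ∈ topRows M x₀.2 := by simp [htop₀]
        have hk : k ∈ topRows M x₀.2 := by simp [htop₀]
        exact le_antisymm (hk i) (hi k)
      have e2 : (M *ᵥ w.2) i = (M *ᵥ w.2) k := by
        simpa [sub_eq_zero] using hlw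
      simp [mulVec_add, mulVec_smul, e1, e2]
    obtain ⟨l, hl⟩ := topRows_nonempty M (x₀ + δ • w).2
    rcases h2 hl with rfl | hlk
    · exact ⟨⟨h1, hl⟩, fun m => by rw [← heq]; exact hl m⟩
    · rw [mem_singleton_iff] at hlk
      subst hlk
      exact ⟨⟨h1, fun m => by rw [heq]; exact hl m⟩, hl⟩

/-- The row statement for `-Mᵀ`, with the two factors swapped. -/
lemma IsEquil.isPolytopeOfDim_bottomCols (h : IsEquil M p q μ) {i k : Fin n} (hik : i ≠ k) :
    IsPolytopeOfDim (2 * n - 3)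
      ((simplexProd n ∩ {x | i ∈ bottomCols M x.1}) ∩ {x | k ∈ bottomCols M x.1}) := by
  have h1 := isPolytopeOfDim_swap (h.transpose.neg.isPolytopeOfDim_topRows hik)
  convert h1 using 1
  ext x
  simp only [bottomCols_eq, mem_inter_iff, mem_ofPred_eq, mem_preimage, simplexProd, mem_prod,
    Prod.fst_swap, Prod.snd_swap]
  tauto

/-- The set where `X_H` is multivalued is a finite union of polytopes of codimension one. -/
lemma IsEquil.isPolyhedralOfDim_nontrivial (h : IsEquil M p q μ) {A : Mat n} (hA : A.det ≠ 0)
    (hs : invSum A ≠ 0) : IsPolyhedralOfDim (2 * n - 3)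
      {x | x ∈ simplexProd n ∧ (hamField M A x).Nontrivial} := by
  let C : Fin n × Fin n → Set (Pt n) := fun k =>
    (simplexProd n ∩ {x | k.1 ∈ topRows M x.2}) ∩ {x | k.2 ∈ topRows M x.2}
  let D : Fin n × Fin n → Set (Pt n) := fun k =>
    (simplexProd n ∩ {x | k.1 ∈ bottomCols M x.1}) ∩ {x | k.2 ∈ bottomCols M x.1}
  refine ⟨C '' {k | k.1 ≠ k.2} ∪ D '' {k | k.1 ≠ k.2},
    ((Set.toFinite _).image C).union ((Set.toFinite _).image D), ?_, ?_⟩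
  · rintro _ (⟨⟨i, k⟩, hik, rfl⟩ | ⟨⟨i, k⟩, hik, rfl⟩)
    · exact h.isPolytopeOfDim_topRows hik
    · exact h.isPolytopeOfDim_bottomCols hik
  · ext x
    rw [mem_ofPred_eq, hamField_eq hA hs]
    constructor
    · rintro ⟨hx, hnt⟩
      by_cases h1 : (topRows M x.2).Nontrivial
      · obtain ⟨i, hi, k, hk, hik⟩ := h1
        exact ⟨C (i, k), Or.inl ⟨(i, k), hik, rfl⟩, ⟨hx, hi⟩, hk⟩
      by_cases h2 : (bottomCols M x.1).Nontrivial
      · obtain ⟨i, hi, k, hk, hik⟩ := h2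
        exact ⟨D (i, k), Or.inr ⟨(i, k), hik, rfl⟩, ⟨hx, hi⟩, hk⟩
      exfalso
      obtain ⟨i, hi⟩ := topRows_nonempty M x.2
      obtain ⟨j, hj⟩ := bottomCols_nonempty M x.1
      have h1' : topRows M x.2 = {i} := (not_nontrivial_iff.1 h1).eq_singleton_of_mem hi
      have h2' : bottomCols M x.1 = {j} := (not_nontrivial_iff.1 h2).eq_singleton_of_mem hj
      obtain ⟨v, ⟨c, hc, d, hd, rfl⟩, w, ⟨c', hc', d', hd', rfl⟩, hne⟩ := hnt
      rw [h1', face_singleton, mem_singleton_iff] at hc hc'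
      rw [h2', face_singleton, mem_singleton_iff] at hd hd'
      exact hne (by rw [hc, hc', hd, hd'])
    · rintro ⟨_, ⟨⟨i, k⟩, hik, rfl⟩ | ⟨⟨i, k⟩, hik, rfl⟩, ⟨hx, hi⟩, hk⟩
      -- A tie yields the velocities of two vertices, which differ because the velocity determines
      -- the strategy.
      · obtain ⟨j, hj⟩ := bottomCols_nonempty M x.1
        refine ⟨hx, _, ⟨_, single_mem_face hi, _, single_mem_face hj, rfl⟩, _,
          ⟨_, single_mem_face hk, _, single_mem_face hj, rfl⟩, fun heq => hik ?_⟩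
        have := h.injOn_vel_left hA (single_mem_stdSimplex ℝ i) (single_mem_stdSimplex ℝ k)
          (congrArg Prod.fst heq)
        by_contra hne
        have := congrFun this i
        simp [show i ≠ k from hne] at this
      · obtain ⟨j, hj⟩ := topRows_nonempty M x.2
        refine ⟨hx, _, ⟨_, single_mem_face hj, _, single_mem_face hi, rfl⟩, _,
          ⟨_, single_mem_face hj, _, single_mem_face hk, rfl⟩, fun heq => hik ?_⟩
        have := h.injOn_vel_right hA (single_mem_stdSimplex ℝ i) (single_mem_stdSimplex ℝ k)
          (congrArg Prod.snd heq)
        by_contra hne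
        have := congrFun this i
        simp [show i ≠ k from hne] at this

/-- On the open pieces the Hamiltonian is differentiable and the field is its gradient field. -/
lemma exists_hasFDerivAt {A : Mat n} (hA : A.det ≠ 0) (hs : invSum A ≠ 0) (i j : Fin n)
    {x : Pt n} (hx : x ∈ cell M {i} {j}) : ∃ v ∈ tangentProd n, hamField M A x = {v} ∧
      ∃ L : Pt n →L[ℝ] ℝ, HasFDerivAt (ham M) L x ∧ ∀ Y ∈ tangentProd n, symp A v Y = L Y := by
  obtain ⟨-, h1, h2⟩ := hx
  refine ⟨vel M A (Pi.single i 1) (Pi.single j 1), vel_mem_tangentProd M hs _ _, ?_,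
    LinearMap.toContinuousLinearMap (payDiff M i j), ?_, fun Y hY => ?_⟩
  · rw [hamField_eq hA hs, h1, h2, face_singleton, face_singleton]
    ext v; simp
  -- No index other than `i` and `j` can become active close to `x`.
  · have hev : ham M =ᶠ[nhds x] fun y => LinearMap.toContinuousLinearMap (payDiff M i j) y := by
      have e1 : ∀ᶠ y : Pt n in nhds x, topRows M y.2 ⊆ {i} := by
        rw [← h1]
        exact (continuous_snd.tendsto x).eventually (eventually_topRows_subset M x.2)
      have e2 : ∀ᶠ y : Pt n in nhds x, bottomCols M y.1 ⊆ {j} := by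
        rw [← h2]
        exact (continuous_fst.tendsto x).eventually (eventually_bottomCols_subset M x.1)
      filter_upwards [e1, e2] with y hy1 hy2
      obtain ⟨i', j', hi', hj', hy⟩ := exists_ham_eq M y
      rw [hy, mem_singleton_iff.1 (hy1 hi'), mem_singleton_iff.1 (hy2 hj')]
      rfl
    exact (ContinuousLinearMap.hasFDerivAt _).congr_of_eventuallyEq hev
  · rw [symp_vel hA _ _ hY, LinearMap.coe_toContinuousLinearMap', payDiff_apply,
      single_one_dotProduct, dotProduct_mulVec, dotProduct_single_one]

end Level

/-! ### Orbits of right-translation fields -/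

/-- `γ` is, on `[0, b]`, a continuous curve in `S` which to the right of every point is locally the
translation along the vector `w` at that point. -/
structure IsOrbit {E : Type*} [NormedAddCommGroup E] [NormedSpace ℝ E] (S : Set E) (w : E → E)
    (γ : ℝ → E) (b : ℝ) : Prop where
  cont : ContinuousOn γ (Icc 0 b)
  mem : ∀ t ∈ Icc 0 b, γ t ∈ S
  germ : ∀ t ∈ Ico 0 b, ∃ ε > 0, t + ε ≤ b ∧ ∀ s ∈ Icc 0 ε, γ (t + s) = γ t + s • w (γ t)

/-- Translations along `w` stay in `S` and keep `w` constant for a short time. -/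
def IsTranslationField {E : Type*} [NormedAddCommGroup E] [NormedSpace ℝ E] (S : Set E)
    (w : E → E) : Prop :=
  ∀ x ∈ S, ∃ ε > 0, ∀ s ∈ Icc (0 : ℝ) ε, x + s • w x ∈ S ∧ w (x + s • w x) = w x

section Orbits

variable {E : Type*} [NormedAddCommGroup E] [NormedSpace ℝ E] {S : Set E} {w : E → E}
  {γ γ' : ℝ → E} {b : ℝ}

namespace IsOrbit

lemma of_germ (hc : ContinuousOn γ (Icc 0 b)) (hm : ∀ t ∈ Icc 0 b, γ t ∈ S)
    (hg : ∀ t ∈ Ico 0 b, ∃ ε > 0, ∀ s ∈ Icc 0 ε, t + s ≤ b → γ (t + s) = γ t + s • w (γ t)) :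
    IsOrbit S w γ b := by
  refine ⟨hc, hm, fun t ht => ?_⟩
  obtain ⟨ε, hε, h⟩ := hg t ht
  have hpos : 0 < b - t := by linarith [ht.2]
  refine ⟨min ε (b - t), lt_min hε hpos, by linarith [min_le_right ε (b - t)], fun s hs => ?_⟩
  exact h s ⟨hs.1, hs.2.trans (min_le_left _ _)⟩ (by linarith [hs.2.trans (min_le_right ε (b - t))])

lemma mono (h : IsOrbit S w γ b) {b' : ℝ} (hb : b' ≤ b) : IsOrbit S w γ b' :=
  of_germ (h.cont.mono (Icc_subset_Icc le_rfl hb)) (fun t ht => h.mem t ⟨ht.1, ht.2.trans hb⟩)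
    fun t ht => by
      obtain ⟨ε, hε, -, hs⟩ := h.germ t ⟨ht.1, ht.2.trans_le hb⟩
      exact ⟨ε, hε, fun s hs' _ => hs s hs'⟩

lemma congr (h : IsOrbit S w γ b) (heq : ∀ t ∈ Icc 0 b, γ' t = γ t) : IsOrbit S w γ' b :=
  of_germ (h.cont.congr heq) (fun t ht => by rw [heq t ht]; exact h.mem t ht) fun t ht => by
    obtain ⟨ε, hε, hle, hs⟩ := h.germ t ht
    refine ⟨ε, hε, fun s hs' hsb => ?_⟩
    rw [heq _ ⟨by linarith [ht.1, hs'.1], hsb⟩, heq t ⟨ht.1, ht.2.le⟩, hs s hs']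

/-- The set of times of agreement is closed and, by the right germs, contains a right neighbourhood
of each of its points before `b`. -/
lemma eqOn (h : IsOrbit S w γ b) (h' : IsOrbit S w γ' b) (h0 : γ 0 = γ' 0) :
    ∀ t ∈ Icc 0 b, γ t = γ' t := by
  rcases lt_or_ge b 0 with hb | hb
  · intro t ht
    exact absurd (ht.1.trans ht.2) (not_le.2 hb)
  refine IsClosed.Icc_subset_of_forall_mem_nhdsWithin (s := {t | γ t = γ' t}) ?_ h0 ?_
  · have : {t | γ t = γ' t} ∩ Icc 0 b = Icc 0 b ∩ (fun t => γ t - γ' t) ⁻¹' {0} := by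
      ext t; simp [sub_eq_zero, and_comm]
    rw [this]
    exact (h.cont.sub h'.cont).preimage_isClosed_of_isClosed isClosed_Icc isClosed_singleton
  · rintro t ⟨ht, htb⟩
    obtain ⟨ε, hε, -, hs⟩ := h.germ t htb
    obtain ⟨ε', hε', -, hs'⟩ := h'.germ t htb
    have hpos : 0 < min ε ε' := lt_min hε hε'
    refine Filter.mem_of_superset (Ioo_mem_nhdsGT (lt_add_of_pos_right t hpos)) fun u hu => ?_
    have h1 := hs (u - t) ⟨by linarith [hu.1], by linarith [hu.2, min_le_left ε ε']⟩
    have h2 := hs' (u - t) ⟨by linarith [hu.1], by linarith [hu.2, min_le_right ε ε']⟩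
    rw [add_sub_cancel] at h1 h2
    have ht' : γ t = γ' t := ht
    rw [mem_ofPred_eq, h1, h2, ht']

lemma hasDerivWithinAt (h : IsOrbit S w γ b) {t : ℝ} (ht : t ∈ Ico 0 b) :
    HasDerivWithinAt γ (w (γ t)) (Ici t) t := by
  obtain ⟨ε, hε, -, hs⟩ := h.germ t ht
  have h1 : HasDerivWithinAt (fun u => γ t + (u - t) • w (γ t)) (w (γ t)) (Ici t) t := by
    have h2 : HasDerivAt (fun u : ℝ => γ t + (u - t) • w (γ t)) ((1 : ℝ) • w (γ t)) t :=
      (((hasDerivAt_id t).sub_const t).smul_const _).const_add _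
    rw [one_smul] at h2
    exact h2.hasDerivWithinAt
  refine h1.congr_of_eventuallyEq ?_ (by simp)
  filter_upwards [Icc_mem_nhdsGE (lt_add_of_pos_right t hε)] with u hu
  have := hs (u - t) ⟨by linarith [hu.1], by linarith [hu.2]⟩
  rwa [add_sub_cancel] at this

lemma norm_sub_le (h : IsOrbit S w γ b) {C : ℝ} (hC : ∀ x ∈ S, ‖w x‖ ≤ C) {t u : ℝ} (ht : 0 ≤ t)
    (htu : t ≤ u) (hu : u ≤ b) : ‖γ u - γ t‖ ≤ C * (u - t) := by
  refine norm_image_sub_le_of_norm_deriv_right_le_segment (f := γ) (f' := fun r => w (γ r))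
    (a := t) (b := u) (h.cont.mono (Icc_subset_Icc ht hu)) (fun r hr => ?_) (fun r hr => ?_) u
    ⟨htu, le_rfl⟩
  · exact h.hasDerivWithinAt ⟨ht.trans hr.1, hr.2.trans_le hu⟩
  · exact hC _ (h.mem r ⟨ht.trans hr.1, hr.2.le.trans hu⟩)

lemma lipschitzOnWith (h : IsOrbit S w γ b) {C : NNReal} (hC : ∀ x ∈ S, ‖w x‖ ≤ C) :
    LipschitzOnWith C γ (Icc 0 b) := by
  refine LipschitzOnWith.of_dist_le_mul fun t ht u hu => ?_
  rcases le_total t u with htu | htu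
  · rw [dist_comm, dist_eq_norm, dist_comm t u, Real.dist_eq, abs_of_nonneg (by linarith)]
    exact h.norm_sub_le hC ht.1 htu hu.2
  · rw [dist_eq_norm, Real.dist_eq, abs_of_nonneg (by linarith)]
    exact h.norm_sub_le hC hu.1 htu ht.2

lemma exists_extension (hw : IsTranslationField S w) (h : IsOrbit S w γ b) (hb : 0 ≤ b) :
    ∃ ε > 0, ∃ γ', IsOrbit S w γ' (b + ε) ∧ γ' 0 = γ 0 := by
  obtain ⟨ε, hε, hs⟩ := hw (γ b) (h.mem b ⟨hb, le_rfl⟩)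
  refine ⟨ε, hε, fun t => if t ≤ b then γ t else γ b + (t - b) • w (γ b), ?_, by simp [hb]⟩
  set γ' : ℝ → E := fun t => if t ≤ b then γ t else γ b + (t - b) • w (γ b) with hγ'
  have h1 : ∀ t, t ≤ b → γ' t = γ t := fun t ht => by simp [hγ', ht]
  have h2 : ∀ t, b ≤ t → γ' t = γ b + (t - b) • w (γ b) := fun t ht => by
    rcases ht.lt_or_eq with hlt | rfl
    · simp [hγ', not_le.2 hlt]
    · simp [hγ']
  refine of_germ ?_ (fun t ht => ?_) fun t ht => ?_
  · rw [← Icc_union_Icc_eq_Icc hb (by linarith : b ≤ b + ε)]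
    refine ContinuousOn.union_of_isClosed ?_ ?_ isClosed_Icc isClosed_Icc
    · exact h.cont.congr fun t ht => h1 t ht.2
    · have : ContinuousOn (fun t : ℝ => γ b + (t - b) • w (γ b)) (Icc b (b + ε)) := by fun_prop
      exact this.congr fun t ht => h2 t ht.1
  · rcases le_total t b with htb | htb
    · rw [h1 t htb]; exact h.mem t ⟨ht.1, htb⟩
    · rw [h2 t htb]; exact (hs (t - b) ⟨by linarith, by linarith [ht.2]⟩).1
  · rcases lt_or_ge t b with htb | htb
    · obtain ⟨δ, hδ, hle, hδs⟩ := h.germ t ⟨ht.1, htb⟩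
      refine ⟨δ, hδ, fun s hs' _ => ?_⟩
      rw [h1 _ (by linarith [hs'.2]), h1 t htb.le, hδs s hs']
    · refine ⟨1, one_pos, fun s hs' hle => ?_⟩
      rw [h2 _ (by linarith [hs'.1]), h2 t htb, (hs (t - b) ⟨by linarith, by linarith [ht.2]⟩).2]
      module

/-- Orbits on shorter intervals agree where both are defined, so their diagonal is one curve on `[0,
b)`. The speed bound gives it a limit at `b`, even if corners accumulate there, and closedness keeps
the limit in `S`. -/
lemma exists_of_forall_lt [FiniteDimensional ℝ E] (hS : IsClosed S) {C : NNReal}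
    (hC : ∀ x ∈ S, ‖w x‖ ≤ C) {x : E} (hb : 0 < b)
    (h : ∀ t, 0 ≤ t → t < b → ∃ γ, IsOrbit S w γ t ∧ γ 0 = x) : ∃ γ, IsOrbit S w γ b ∧ γ 0 = x := by
  choose! c hc hc0 using h
  let f : ℝ → E := fun u => c u u
  have hf : ∀ t, t < b → ∀ u, 0 ≤ u → u ≤ t → f u = c t u := fun t ht u hu hut =>
    (hc u hu (hut.trans_lt ht)).eqOn ((hc t (hu.trans hut) ht).mono hut)
      (by rw [hc0 u hu (hut.trans_lt ht), hc0 t (hu.trans hut) ht]) u ⟨hu, le_rfl⟩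
  have hlip : LipschitzOnWith C f (Ico 0 b) := by
    refine LipschitzOnWith.of_dist_le_mul fun t ht u hu => ?_
    have hm : max t u < b := max_lt ht.2 hu.2
    rw [hf _ hm t ht.1 (le_max_left _ _), hf _ hm u hu.1 (le_max_right _ _)]
    exact ((hc _ (ht.1.trans (le_max_left t u)) hm).lipschitzOnWith hC).dist_le_mul t
      ⟨ht.1, le_max_left _ _⟩ u ⟨hu.1, le_max_right _ _⟩
  obtain ⟨g, hg, hfg⟩ := hlip.extend_finite_dimension
  have hgc : Continuous g := hg.continuous
  have hgt : ∀ t, t < b → ∀ u, 0 ≤ u → u ≤ t → g u = c t u := fun t ht u hu hut => by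
    rw [← hfg ⟨hu, hut.trans_lt ht⟩, hf t ht u hu hut]
  have hmem : ∀ t ∈ Ico 0 b, g t ∈ S := fun t ht => by
    rw [hgt t ht.2 t ht.1 le_rfl]
    exact (hc t ht.1 ht.2).mem t ⟨ht.1, le_rfl⟩
  refine ⟨g, of_germ hgc.continuousOn (fun t ht => ?_) fun t ht => ?_, ?_⟩
  · have h1 : Icc 0 b ⊆ closure (Ico 0 b) := by rw [closure_Ico hb.ne]
    have h2 : MapsTo g (closure (Ico 0 b)) (closure S) :=
      MapsTo.closure (fun u hu => hmem u hu) hgc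
    have h3 := h2 (h1 ht)
    rwa [hS.closure_eq] at h3
  · have htb : (t + b) / 2 < b := by linarith [ht.2]
    have htt : t < (t + b) / 2 := by linarith [ht.2]
    obtain ⟨ε, hε, hle, hs⟩ := (hc _ (ht.1.trans htt.le) htb).germ t ⟨ht.1, htt⟩
    refine ⟨ε, hε, fun s hs' _ => ?_⟩
    rw [hgt _ htb t ht.1 htt.le, hgt _ htb (t + s) (by linarith [ht.1, hs'.1])
      (by linarith [hs'.2]), hs s hs']
  · rw [hgt 0 hb 0 le_rfl le_rfl, hc0 0 le_rfl hb]

/-- The attainable lengths form a closed set by `exists_of_forall_lt` and can always be increased by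
`exists_extension`. -/
lemma exists_orbit [FiniteDimensional ℝ E] (hS : IsClosed S) (hw : IsTranslationField S w)
    {C : NNReal} (hC : ∀ x ∈ S, ‖w x‖ ≤ C) {x : E} (hx : x ∈ S) (b : ℝ) (hb : 0 ≤ b) :
    ∃ γ, IsOrbit S w γ b ∧ γ 0 = x := by
  set G : Set ℝ := {t | ∃ γ, IsOrbit S w γ t ∧ γ 0 = x} with hG
  have hmono : ∀ t ∈ G, ∀ u ≤ t, u ∈ G := fun t ⟨γ, h, h0⟩ u hu => ⟨γ, h.mono hu, h0⟩
  have h0 : (0 : ℝ) ∈ G := by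
    refine ⟨fun _ => x, ⟨continuousOn_const, fun _ _ => hx, fun t ht => ?_⟩, rfl⟩
    exact absurd ht.2 (not_lt.2 ht.1)
  have hclosed : IsClosed (G ∩ Icc 0 b) := by
    refine isClosed_of_closure_subset fun t ht => ?_
    have htI : t ∈ Icc 0 b := by
      have := closure_mono inter_subset_right ht
      rwa [isClosed_Icc.closure_eq] at this
    refine ⟨?_, htI⟩
    rcases htI.1.lt_or_eq with hpos | rfl
    · refine exists_of_forall_lt hS hC hpos fun u _ hut => ?_
      obtain ⟨r, hr, hrG⟩ := mem_closure_iff.1 ht (Ioi u) isOpen_Ioi hut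
      exact hmono r hrG.1 u (le_of_lt hr)
    · exact h0
  refine hclosed.Icc_subset_of_forall_mem_nhdsWithin h0 ?_ ⟨hb, le_rfl⟩
  rintro t ⟨⟨γ, h, hγ0⟩, ht⟩
  obtain ⟨ε, hε, γ', h', hγ'⟩ := h.exists_extension hw ht.1
  refine Filter.mem_of_superset (Ioo_mem_nhdsGT (lt_add_of_pos_right t hε)) fun u hu => ?_
  exact ⟨γ', h'.mono hu.2.le, by rw [hγ', hγ0]⟩

end IsOrbit

/-- The forward flow property of `φ` on `S`. -/
def IsForwardFlow (S : Set E) (w : E → E) (φ : ℝ → E → E) : Prop :=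
  ∀ x ∈ S, φ 0 x = x ∧ ∀ b, IsOrbit S w (fun t => φ t x) b

/-- A bounded translation field in a closed set has a forward flow. -/
lemma exists_forward_flow [FiniteDimensional ℝ E] (hS : IsClosed S) (hw : IsTranslationField S w)
    {C : NNReal} (hC : ∀ x ∈ S, ‖w x‖ ≤ C) :
    ∃ φ : ℝ → E → E, IsForwardFlow S w φ := by
  have h : ∀ (x : E) (b : ℝ), x ∈ S → 0 ≤ b → ∃ γ, IsOrbit S w γ b ∧ γ 0 = x := fun x b hx hb =>
    IsOrbit.exists_orbit hS hw hC hx b hb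
  choose! c hc hc0 using h
  refine ⟨fun t x => c x t t, fun x hx => ⟨hc0 x 0 hx le_rfl, fun b => ?_⟩⟩
  rcases lt_or_ge b 0 with hb | hb
  · refine ⟨?_, fun t ht => absurd (ht.1.trans ht.2) (not_le.2 hb),
      fun t ht => absurd (ht.1.trans_lt ht.2) (not_lt.2 hb.le)⟩
    rw [Icc_eq_empty (not_le.2 hb)]
    exact continuousOn_empty _
  · refine (hc x b hx hb).congr fun t ht => ?_
    exact (hc x t hx ht.1).eqOn ((hc x b hx hb).mono ht.2) (by rw [hc0 x t hx ht.1, hc0 x b hx hb])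
      t ⟨ht.1, le_rfl⟩

namespace IsForwardFlow

variable {φ : ℝ → E → E}

lemma mem (hφ : IsForwardFlow S w φ) {x : E} (hx : x ∈ S) {t : ℝ} (ht : 0 ≤ t) : φ t x ∈ S :=
  ((hφ x hx).2 t).mem t ⟨ht, le_rfl⟩

lemma eq_of_isOrbit (hφ : IsForwardFlow S w φ) {x : E} (hx : x ∈ S) (h : IsOrbit S w γ b)
    (h0 : γ 0 = x) {t : ℝ} (ht : t ∈ Icc 0 b) : γ t = φ t x :=
  h.eqOn ((hφ x hx).2 b) (by rw [h0, (hφ x hx).1]) t ht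

lemma add (hφ : IsForwardFlow S w φ) {x : E} (hx : x ∈ S) {t s : ℝ} (ht : 0 ≤ t) (hs : 0 ≤ s) :
    φ (t + s) x = φ s (φ t x) := by
  have h := (hφ x hx).2 (t + s)
  have h1 : IsOrbit S w (fun u => φ (t + u) x) s := by
    refine IsOrbit.of_germ ?_ (fun u hu => h.mem _ ⟨by linarith [hu.1], by linarith [hu.2]⟩)
      fun u hu => ?_
    · exact h.cont.comp (by fun_prop : Continuous fun u : ℝ => t + u).continuousOn
        fun u hu => ⟨by linarith [hu.1], by linarith [hu.2]⟩
    · obtain ⟨ε, hε, -, hg⟩ := h.germ (t + u) ⟨by linarith [hu.1], by linarith [hu.2]⟩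
      refine ⟨ε, hε, fun r hr _ => ?_⟩
      have := hg r hr
      rwa [add_assoc] at this
  exact hφ.eq_of_isOrbit (hφ.mem hx ht) h1 (by simp) ⟨hs, le_rfl⟩

lemma norm_sub_le (hφ : IsForwardFlow S w φ) {C : ℝ} (hC : ∀ x ∈ S, ‖w x‖ ≤ C) {x : E}
    (hx : x ∈ S) {t u : ℝ} (ht : 0 ≤ t) (htu : t ≤ u) : ‖φ u x - φ t x‖ ≤ C * (u - t) :=
  ((hφ x hx).2 u).norm_sub_le hC ht htu le_rfl

/-- Continuity of the time-`t` maps follows from continuity for short times. -/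
lemma continuousOn (hφ : IsForwardFlow S w φ) {C : ℝ} (hC : ∀ x ∈ S, ‖w x‖ ≤ C)
    (hloc : ∀ y ∈ S, ∃ τ > 0, ∀ s ∈ Icc 0 τ, ContinuousWithinAt (φ s) S y) {t : ℝ} (ht : 0 ≤ t) :
    ContinuousOn (φ t) S := by
  intro x hx
  have hnorm : ∀ y ∈ S, ∀ r u, 0 ≤ r → 0 ≤ u → ‖φ u y - φ r y‖ ≤ C * |u - r| := by
    intro y hy r u hr hu
    rcases le_total r u with h | h
    · rw [abs_of_nonneg (by linarith)]; exact hφ.norm_sub_le hC hy hr h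
    · rw [norm_sub_rev, abs_sub_comm, abs_of_nonneg (by linarith)]; exact hφ.norm_sub_le hC hy hu h
  -- These times form a closed set by the uniform speed bound, and the local hypothesis at `φ r x`
  -- with the semigroup law continues it to the right.
  set G : Set ℝ := {r | ContinuousWithinAt (φ r) S x} with hG
  have hclosed : IsClosed (G ∩ Icc 0 t) := by
    refine isClosed_of_closure_subset fun r hr => ?_
    have hrI : r ∈ Icc 0 t := by
      have := closure_mono inter_subset_right hr
      rwa [isClosed_Icc.closure_eq] at this
    refine ⟨?_, hrI⟩
    rw [hG, mem_ofPred_eq, Metric.continuousWithinAt_iff]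
    intro ε hε
    have hC' : 0 < |C| + 1 := by positivity
    obtain ⟨u, hu, huG⟩ := Metric.mem_closure_iff.1 hr (ε / (3 * (|C| + 1))) (by positivity)
    rw [Real.dist_eq] at huG
    have hsmall : ∀ y ∈ S, ‖φ r y - φ u y‖ ≤ ε / 3 := fun y hy => by
      refine (hnorm y hy u r hu.2.1 hrI.1).trans ?_
      have h1 : C * |r - u| ≤ (|C| + 1) * |r - u| :=
        mul_le_mul_of_nonneg_right (by linarith [le_abs_self C]) (abs_nonneg _)
      have h2 : (|C| + 1) * |r - u| ≤ (|C| + 1) * (ε / (3 * (|C| + 1))) :=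
        mul_le_mul_of_nonneg_left huG.le hC'.le
      have h3 : (|C| + 1) * (ε / (3 * (|C| + 1))) = ε / 3 := by field_simp
      linarith
    obtain ⟨δ, hδ, hδ'⟩ := Metric.continuousWithinAt_iff.1 hu.1 (ε / 3) (by positivity)
    refine ⟨δ, hδ, fun y hy hyx => ?_⟩
    have h1 := hδ' hy hyx
    have h2 := hsmall y hy
    have h3 := hsmall x hx
    rw [dist_eq_norm] at h1 ⊢
    have h4 : φ r y - φ r x = (φ r y - φ u y) + (φ u y - φ u x) - (φ r x - φ u x) := by abel
    rw [h4]
    have h5 := _root_.norm_sub_le ((φ r y - φ u y) + (φ u y - φ u x)) (φ r x - φ u x)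
    have h6 := norm_add_le (φ r y - φ u y) (φ u y - φ u x)
    linarith
  have h0 : (0 : ℝ) ∈ G := by
    have : ContinuousWithinAt (fun y : E => y) S x := continuousWithinAt_id
    exact this.congr (fun y hy => (hφ y hy).1) (hφ x hx).1
  refine hclosed.Icc_subset_of_forall_mem_nhdsWithin h0 ?_ ⟨ht, le_rfl⟩
  rintro r ⟨hr, hrI⟩
  obtain ⟨τ, hτ, hs⟩ := hloc _ (hφ.mem hx hrI.1)
  refine Filter.mem_of_superset (Ioo_mem_nhdsGT (lt_add_of_pos_right r hτ)) fun u hu => ?_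
  have h1 := hs (u - r) ⟨by linarith [hu.1], by linarith [hu.2]⟩
  have h2 : ContinuousWithinAt (fun y => φ (u - r) (φ r y)) S x :=
    ContinuousWithinAt.comp h1 hr fun y hy => hφ.mem hy hrI.1
  refine h2.congr (fun y hy => ?_) ?_
  · rw [← hφ.add hy hrI.1 (by linarith [hu.1]), add_sub_cancel]
  · rw [← hφ.add hx hrI.1 (by linarith [hu.1]), add_sub_cancel]

end IsForwardFlow

end Orbits

/-! ### The direction of motion -/

/-- An equilibrium of the subgame with rows `I` and columns `J`. -/
noncomputable def nashPair (K : Mat n) (I J : Set (Fin n)) : Pt n :=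
  Classical.epsilon fun e => ∃ v, IsNash K I J e.1 e.2 v

/-- The forward velocity on the piece `C_{I,J}`. -/
noncomputable def forwardVel (M A : Mat n) (I J : Set (Fin n)) : Pt n :=
  vel M A (nashPair (velMat M A) I J).1 (nashPair (velMat M A) I J).2

/-- The forward velocity at `x`. -/
noncomputable def dir (M A : Mat n) (x : Pt n) : Pt n :=
  forwardVel M A (topRows M x.2) (bottomCols M x.1)

lemma isNash_nashPair (K : Mat n) {I J : Set (Fin n)} (hI : I.Nonempty) (hJ : J.Nonempty) :
    ∃ v, IsNash K I J (nashPair K I J).1 (nashPair K I J).2 v := by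
  obtain ⟨c, d, v, h⟩ := exists_isNash K hI hJ
  exact Classical.epsilon_spec (p := fun e : Pt n => ∃ v, IsNash K I J e.1 e.2 v) ⟨(c, d), v, h⟩

/-- By uniqueness of optimal strategies the choice made in `nashPair` does not matter. -/
lemma forwardVel_eq {M A : Mat n} (hK : Nondeg (velMat M A)) {I J : Set (Fin n)}
    {c d : Fin n → ℝ} {v : ℝ} (h : IsNash (velMat M A) I J c d v) :
    forwardVel M A I J = vel M A c d := by
  obtain ⟨v', h'⟩ := Classical.epsilon_spec
    (p := fun e : Pt n => ∃ v, IsNash (velMat M A) I J e.1 e.2 v) ⟨(c, d), v, h⟩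
  exact congrArg₂ (vel M A) (h'.left_unique hK h) (h'.right_unique hK h)

/-- Only finitely many pairs of active sets occur. -/
lemma exists_norm_dir_le (M A : Mat n) : ∃ C : NNReal, ∀ x, ‖dir M A x‖ ≤ C := by
  obtain ⟨C, hC⟩ := (Set.finite_range fun k : Set (Fin n) × Set (Fin n) =>
    ‖forwardVel M A k.1 k.2‖₊).bddAbove
  exact ⟨C, fun x => hC ⟨(topRows M x.2, bottomCols M x.1), rfl⟩⟩

lemma exists_ne_zero_of_mem_face {I : Set (Fin n)} {c : Fin n → ℝ} (hc : c ∈ face I) :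
    ∃ i ∈ I, c i ≠ 0 := by
  by_contra h
  push Not at h
  have h0 : ∀ i, c i = 0 := fun i => by
    by_cases hi : i ∈ I
    · exact h i hi
    · exact hc.2 i hi
  have h1 := hc.1.2
  simp [h0] at h1

/-- Under a translation that favours the support of `c` most, `c` remains a best response. -/
lemma mem_face_topRows_of_translate {N : Mat n} [Nonempty (Fin n)] {q q' u c : Fin n → ℝ}
    {s v : ℝ} (hs : 0 ≤ s) (hq : N *ᵥ q' = N *ᵥ q + s • u) (hsub : topRows N q' ⊆ topRows N q)
    (hc : c ∈ face (topRows N q)) (hu : ∀ i ∈ topRows N q, u i ≤ v)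
    (huc : ∀ i, c i ≠ 0 → u i = v) : c ∈ face (topRows N q') := by
  refine ⟨hc.1, fun i hi => ?_⟩
  by_contra hne
  have hi' : i ∈ topRows N q := by
    by_contra h
    exact hne (hc.2 i h)
  obtain ⟨k, hk⟩ := topRows_nonempty N q'
  have h0 := congrFun hq
  simp only [Pi.add_apply, Pi.smul_apply, smul_eq_mul] at h0
  refine hi fun l => (hk l).trans ?_
  rw [h0, h0, huc i hne]
  exact add_le_add (hi' k) (mul_le_mul_of_nonneg_left (hu k (hsub hk)) hs)

lemma mulVec_translate (M A : Mat n) (x : Pt n) (s : ℝ) (c d : Fin n → ℝ) :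
    M *ᵥ (x + s • vel M A c d).2 = M *ᵥ x.2 + s • (velMat M A *ᵥ d) := by
  rw [Prod.snd_add, Prod.smul_snd, mulVec_add, mulVec_smul, mulVec_vel]

lemma translate_vecMul (M A : Mat n) (x : Pt n) (s : ℝ) (c d : Fin n → ℝ) :
    (x + s • vel M A c d).1 ᵥ* M = x.1 ᵥ* M + s • (c ᵥ* velMat M A) := by
  rw [Prod.fst_add, Prod.smul_fst, add_vecMul, smul_vecMul, vel_vecMul]

lemma ham_translate (M A : Mat n) (x : Pt n) (s : ℝ) (c d : Fin n → ℝ) {i j : Fin n}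
    (hi : i ∈ topRows M x.2) (hj : j ∈ bottomCols M x.1)
    (hi' : i ∈ topRows M (x + s • vel M A c d).2)
    (hj' : j ∈ bottomCols M (x + s • vel M A c d).1) :
    ham M (x + s • vel M A c d) =
      ham M x + s * ((velMat M A *ᵥ d) i - (c ᵥ* velMat M A) j) := by
  rw [ham_eq_of_mem M _ hi' hj', ham_eq_of_mem M _ hi hj, mulVec_translate, translate_vecMul]
  simp only [Pi.add_apply, Pi.smul_apply, smul_eq_mul]
  ring

lemma dir_mem_tangentProd (M : Mat n) {A : Mat n} (hs : invSum A ≠ 0) (x : Pt n) :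
    dir M A x ∈ tangentProd n := vel_mem_tangentProd M hs _ _

section

variable [Nonempty (Fin n)]

lemma dir_mem_hamField {M A : Mat n} (hA : A.det ≠ 0) (hs : invSum A ≠ 0) (x : Pt n) :
    dir M A x ∈ hamField M A x := by
  obtain ⟨v, h⟩ := isNash_nashPair (velMat M A) (topRows_nonempty M x.2) (bottomCols_nonempty M x.1)
  exact vel_mem_hamField hA hs h.left_mem h.right_mem

/-- An energy preserving displacement by an admissible velocity is one along `dir`. -/
lemma vel_eq_dir {M A : Mat n} (hK : Nondeg (velMat M A)) {x : Pt n} {s : ℝ} (hs : 0 < s)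
    {c d : Fin n → ℝ} (hc : c ∈ face (topRows M x.2)) (hd : d ∈ face (bottomCols M x.1))
    (htop : topRows M (x + s • vel M A c d).2 ⊆ topRows M x.2)
    (hbot : bottomCols M (x + s • vel M A c d).1 ⊆ bottomCols M x.1)
    (hham : ham M (x + s • vel M A c d) = ham M x) : vel M A c d = dir M A x := by
  obtain ⟨i, hi⟩ := topRows_nonempty M (x + s • vel M A c d).2
  obtain ⟨j, hj⟩ := bottomCols_nonempty M (x + s • vel M A c d).1
  have h1 := ham_translate M A x s c d (htop hi) (hbot hj) hi hj
  -- Conservation of `H` equates the rates of row `i` and column `j`; this is the value of the game.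
  -- Rows tied at `x` move no faster than `i`, which ends on top, and columns no slower than `j`.
  rw [hham, left_eq_add, mul_eq_zero, or_iff_right hs.ne', sub_eq_zero] at h1
  refine (forwardVel_eq hK (v := (velMat M A *ᵥ d) i) ⟨hc, hd, fun k hk => ?_, fun k hk => ?_⟩).symm
  · have h2 := hi k
    rw [mulVec_translate] at h2
    simp only [Pi.add_apply, Pi.smul_apply, smul_eq_mul] at h2
    have h3 := hk i
    nlinarith
  · have h2 := hj k
    rw [translate_vecMul] at h2
    simp only [Pi.add_apply, Pi.smul_apply, smul_eq_mul] at h2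
    have h3 := hk j
    rw [h1]
    nlinarith

/-- Rows in the support of `c` rise at rate `v`, the greatest among the top rows, and so stay on
top; dually for columns. Hence `(c, d)` stays optimal for the possibly smaller active sets, and `H`
is constant since both rates equal `v`. -/
lemma exists_translate_dir {M A : Mat n} (hK : Nondeg (velMat M A)) (x : Pt n) :
    ∃ ε > 0, ∀ s ∈ Icc (0 : ℝ) ε, ham M (x + s • dir M A x) = ham M x ∧
      dir M A (x + s • dir M A x) = dir M A x := by
  obtain ⟨v, h⟩ := isNash_nashPair (velMat M A) (topRows_nonempty M x.2) (bottomCols_nonempty M x.1)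
  set c := (nashPair (velMat M A) (topRows M x.2) (bottomCols M x.1)).1
  set d := (nashPair (velMat M A) (topRows M x.2) (bottomCols M x.1)).2
  have hdir : dir M A x = vel M A c d := rfl
  obtain ⟨ε, hε, hev⟩ := Metric.eventually_nhds_iff.1
    ((eventually_topRows_add_smul M x (dir M A x)).and
      (eventually_bottomCols_add_smul M x (dir M A x)))
  refine ⟨ε / 2, half_pos hε, fun s hs => ?_⟩
  obtain ⟨htop, hbot⟩ := hev (y := s) (by
    rw [Real.dist_eq, sub_zero, abs_of_nonneg hs.1]; linarith [hs.2])
  rw [hdir] at htop hbot ⊢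
  have hc : c ∈ face (topRows M (x + s • vel M A c d).2) :=
    mem_face_topRows_of_translate hs.1 (mulVec_translate M A x s c d) htop h.left_mem h.le_value
      fun i hi => h.eq_value hi
  have hd : d ∈ face (bottomCols M (x + s • vel M A c d).1) := by
    have h1 := h.right_mem
    have h2 := h.value_le
    rw [bottomCols_eq] at h1 h2 hbot ⊢
    rw [bottomCols_eq] at hbot
    refine mem_face_topRows_of_translate (u := -(c ᵥ* velMat M A)) (v := -v) hs.1 ?_ hbot h1
      (fun i hi => neg_le_neg (h2 i hi)) fun i hi => by rw [Pi.neg_apply, h.eq_value' hi]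
    rw [neg_mulVec, mulVec_transpose, translate_vecMul, neg_mulVec, mulVec_transpose]
    module
  constructor
  · obtain ⟨i, hi, hci⟩ := exists_ne_zero_of_mem_face hc
    obtain ⟨j, hj, hdj⟩ := exists_ne_zero_of_mem_face hd
    rw [ham_translate M A x s c d (htop hi) (hbot hj) hi hj, h.eq_value hci, h.eq_value' hdj]
    simp
  · exact forwardVel_eq hK (v := v)
      ⟨hc, hd, fun k hk => h.le_value k (htop hk), fun k hk => h.value_le k (hbot hk)⟩

lemma IsSmall.isTranslationField {M A : Mat n} {p q : Fin n → ℝ} {μ ρ : ℝ}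
    (hρ : IsSmall M p q ρ) (h : IsEquil M p q μ) (hK : Nondeg (velMat M A))
    (hs : invSum A ≠ 0) : IsTranslationField (levelSet M ρ) (dir M A) := by
  intro x hx
  obtain ⟨ε, hε, hx'⟩ := exists_translate_dir hK x
  refine ⟨ε, hε, fun s hs' => ⟨hρ.mem_levelSet h hx.1 ?_ ?_, (hx' s hs').2⟩⟩
  · rw [add_sub_cancel_left, ← mem_tanSub]
    exact (tanSub n).smul_mem _ (mem_tanSub.2 (dir_mem_tangentProd M hs x))
  · rw [(hx' s hs').1, hx.2]

end

/-! ### Absolutely continuous solutions -/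

lemma LipschitzWith.absolutelyContinuousOnInterval_comp {X Y : Type*} [PseudoMetricSpace X]
    [PseudoMetricSpace Y] {f : X → Y} {C : NNReal} (hf : LipschitzWith C f) {γ : ℝ → X} {a b : ℝ}
    (hγ : AbsolutelyContinuousOnInterval γ a b) :
    AbsolutelyContinuousOnInterval (fun t => f (γ t)) a b := by
  have h := Filter.Tendsto.const_mul (C : ℝ) hγ
  rw [mul_zero] at h
  refine squeeze_zero (fun E => Finset.sum_nonneg fun _ _ => dist_nonneg) (fun E => ?_) h
  rw [Finset.mul_sum]
  exact Finset.sum_le_sum fun i _ => hf.dist_le_mul _ _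

/-- The mean velocity of an absolutely continuous curve lies in every closed convex set that
contains almost all velocities. -/
lemma average_mem {E : Type*} [NormedAddCommGroup E] [NormedSpace ℝ E] {K : Set E}
    (hK : Convex ℝ K) (hK' : IsClosed K) {γ : ℝ → E} {a b : ℝ} (hab : a < b)
    (hγ : AbsolutelyContinuousOnInterval γ a b)
    (hv : ∀ᵐ t ∂(volume.restrict (Icc a b)), ∃ v ∈ K, HasDerivAt γ v t) :
    (b - a)⁻¹ • (γ b - γ a) ∈ K := by
  by_contra hnot
  -- The derivative of `f ∘ γ` is below `u` almost everywhere, while its mean would exceed `u`.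
  obtain ⟨f, u, hfu, hu⟩ := geometric_hahn_banach_closed_point hK hK' hnot
  have hac : AbsolutelyContinuousOnInterval (fun t => f (γ t)) a b :=
    LipschitzWith.absolutelyContinuousOnInterval_comp f.lipschitz hγ
  have h1 : ∫ t in a..b, deriv (fun t => f (γ t)) t ≤ ∫ _ in a..b, u := by
    refine intervalIntegral.integral_mono_ae_restrict hab.le hac.intervalIntegrable_deriv
      intervalIntegrable_const ?_
    filter_upwards [hv] with t ⟨v, hvK, hd⟩
    exact (f.hasFDerivAt.comp_hasDerivAt t hd).deriv.trans_le (hfu v hvK).le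
  rw [hac.integral_deriv_eq_sub, intervalIntegral.integral_const, ← map_sub, smul_eq_mul] at h1
  rw [map_smul, smul_eq_mul, ← div_eq_inv_mul, lt_div_iff₀ (sub_pos.2 hab)] at hu
  linarith

lemma isCompact_image_vel (M A : Mat n) (I J : Set (Fin n)) :
    IsCompact ((fun e : Pt n => vel M A e.1 e.2) '' face I ×ˢ face J) := by
  refine ((isCompact_face I).prod (isCompact_face J)).image ?_
  have h : ∀ N : Mat n, Continuous fun x : Fin n → ℝ => N *ᵥ x := fun N =>
    Continuous.matrix_mulVec continuous_const continuous_id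
  exact ((h _).comp ((h _).comp continuous_fst)).prodMk ((h _).comp ((h _).comp continuous_snd))

lemma convex_image_vel (M A : Mat n) (I J : Set (Fin n)) :
    Convex ℝ ((fun e : Pt n => vel M A e.1 e.2) '' face I ×ˢ face J) := by
  let L : Pt n →ₗ[ℝ] Pt n := LinearMap.prodMap
    ((projInv A)ᵀ.mulVecLin.comp Mᵀ.mulVecLin) ((projInv A).mulVecLin.comp M.mulVecLin)
  exact ((convex_face I).prod (convex_face J)).linear_image L

namespace IsSolutionOn

variable {M A : Mat n} {γ : ℝ → Pt n} {a b : ℝ}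

lemma mono (h : IsSolutionOn M A γ a b) {a' b' : ℝ} (ha : a ≤ a') (hab : a' ≤ b') (hb : b' ≤ b) :
    IsSolutionOn M A γ a' b' := by
  have hsub : Icc a' b' ⊆ Icc a b := Icc_subset_Icc ha hb
  refine ⟨fun t ht => h.1 t (hsub ht), h.2.1.mono ?_, ae_restrict_of_ae_restrict_of_subset hsub h.2.2⟩
  rwa [uIcc_of_le hab, uIcc_of_le (ha.trans (hab.trans hb))]

lemma continuousOn (h : IsSolutionOn M A γ a b) : ContinuousOn γ (Icc a b) :=
  h.2.1.continuousOn.mono Icc_subset_uIcc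

lemma exists_subset (h : IsSolutionOn M A γ a b) {t : ℝ} (ht : t ∈ Icc a b) :
    ∃ ε > 0, ∀ s ∈ Icc a b, |s - t| ≤ ε →
      topRows M (γ s).2 ⊆ topRows M (γ t).2 ∧ bottomCols M (γ s).1 ⊆ bottomCols M (γ t).1 := by
  have h1 := (h.continuousOn t ht).snd.eventually (eventually_topRows_subset M (γ t).2)
  have h2 := (h.continuousOn t ht).fst.eventually (eventually_bottomCols_subset M (γ t).1)
  obtain ⟨ε, hε, hs⟩ := Metric.mem_nhdsWithin_iff.1 (h1.and h2)
  exact ⟨ε / 2, half_pos hε, fun s hs' hst => hs ⟨by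
    rw [Metric.mem_ball, Real.dist_eq]; linarith, hs'⟩⟩

variable [Nonempty (Fin n)]

/-- The Hamiltonian is constant along solutions. -/
lemma ham_eq (h : IsSolutionOn M A γ a b) {t u : ℝ} (ht : t ∈ Icc a b) (hu : u ∈ Icc a b) :
    ham M (γ t) = ham M (γ u) := by
  obtain ⟨C, hC⟩ := exists_lipschitzWith_ham M
  have hab : a ≤ b := ht.1.trans ht.2
  have hac : AbsolutelyContinuousOnInterval (fun t => ham M (γ t)) a b :=
    LipschitzWith.absolutelyContinuousOnInterval_comp hC h.2.1
  have hne : ∀ c : ℝ, ∀ᵐ t : ℝ, t ≠ c := fun c => by simp [ae_iff, measure_singleton]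
  obtain ⟨k, hk⟩ := hac.const_of_ae_hasDerivAt_zero (by
    have hsol := (ae_restrict_iff' measurableSet_Icc).1 h.2.2
    filter_upwards [hsol, hac.ae_differentiableAt, hne a, hne b] with r hr hdiff hra hrb hmem
    obtain ⟨v, ⟨hv, ξ, hξ, hvξ⟩, hd⟩ := hr (by rwa [uIcc_of_le hab] at hmem)
    rw [uIcc_of_le hab] at hmem
    have hmem' : r ∈ Ioo a b := ⟨lt_of_le_of_ne hmem.1 hra.symm, lt_of_le_of_ne hmem.2 hrb⟩
    have hf := (hdiff (by rwa [uIcc_of_le hab])).hasDerivAt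
    have hg := hf.sub ((LinearMap.toContinuousLinearMap ξ).hasFDerivAt.comp_hasDerivAt r hd)
    -- `H ∘ γ` touches `ξ ∘ γ` plus a constant from above at `r`, so its derivative is `ξ v = ω(v,
    -- v) = 0`.
    have hmin : IsLocalMin ((fun t => ham M (γ t)) - (LinearMap.toContinuousLinearMap ξ) ∘ γ) r := by
      filter_upwards [Ioo_mem_nhds hmem'.1 hmem'.2] with s hs
      have h1 := hξ (γ s - γ r) (sub_mem_tangentProd (h.1 s (Ioo_subset_Icc_self hs)) (h.1 r hmem))
      rw [add_sub_cancel, map_sub] at h1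
      simp only [Pi.sub_apply, Function.comp_apply, LinearMap.coe_toContinuousLinearMap']
      linarith
    have h0 := hmin.hasDerivAt_eq_zero hg
    rw [LinearMap.coe_toContinuousLinearMap', ← hvξ v hv, symp_self, sub_zero] at h0
    rw [h0] at hf
    exact hf)
  rw [uIcc_of_le hab] at hk
  rw [hk t ht, hk u hu]

/-- The velocities admissible for active sets inside `I` and `J` form a compact convex set, which
contains the mean velocity. -/
lemma exists_eq_add_smul_vel (h : IsSolutionOn M A γ a b) (hA : A.det ≠ 0) (hs : invSum A ≠ 0)
    {a' b' : ℝ} (ha : a ≤ a') (hab : a' < b') (hb : b' ≤ b) {I J : Set (Fin n)}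
    (hI : ∀ t ∈ Icc a' b', topRows M (γ t).2 ⊆ I) (hJ : ∀ t ∈ Icc a' b', bottomCols M (γ t).1 ⊆ J) :
    ∃ c ∈ face I, ∃ d ∈ face J, γ b' = γ a' + (b' - a') • vel M A c d := by
  have h' := h.mono ha hab.le hb
  obtain ⟨⟨c, d⟩, ⟨hc, hd⟩, hcd⟩ := average_mem (convex_image_vel M A I J)
    (isCompact_image_vel M A I J).isClosed hab h'.2.1 (by
      rw [ae_restrict_iff' measurableSet_Icc]
      filter_upwards [(ae_restrict_iff' measurableSet_Icc).1 h'.2.2] with t ht htm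
      obtain ⟨v, hv, hd⟩ := ht htm
      rw [hamField_eq hA hs] at hv
      obtain ⟨c, hc, d, hd', rfl⟩ := hv
      exact ⟨_, ⟨(c, d), ⟨face_mono (hI t htm) hc, face_mono (hJ t htm) hd'⟩, rfl⟩, hd⟩)
  refine ⟨c, hc, d, hd, ?_⟩
  rw [show vel M A c d = _ from hcd, smul_inv_smul₀ (sub_pos.2 hab).ne', add_sub_cancel]

/-- Shortly after `t` the active sets lie in those at `t`, so the mean velocity is admissible at
`t`. It preserves `H`, and `vel_eq_dir` leaves only `dir`. -/
lemma eq_add_smul_dir (h : IsSolutionOn M A γ a b) (hG : Good M A) {t : ℝ} (ht : t ∈ Icc a b) :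
    ∃ ε > 0, ∀ s ∈ Icc 0 ε, t + s ≤ b → γ (t + s) = γ t + s • dir M A (γ t) := by
  obtain ⟨ε, hε, hsub⟩ := h.exists_subset ht
  refine ⟨ε, hε, fun s hs hsb => ?_⟩
  rcases hs.1.eq_or_lt with rfl | hs0
  · simp
  have hmem : ∀ u ∈ Icc t (t + s), u ∈ Icc a b ∧ |u - t| ≤ ε := fun u hu =>
    ⟨⟨ht.1.trans hu.1, hu.2.trans hsb⟩, by
      rw [abs_of_nonneg (sub_nonneg.2 hu.1)]; linarith [hu.2, hs.2]⟩
  obtain ⟨c, hc, d, hd, heq⟩ := h.exists_eq_add_smul_vel hG.det_ne_zero hG.invSum_ne_zero ht.1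
    (lt_add_of_pos_right t hs0) hsb (fun u hu => (hsub u (hmem u hu).1 (hmem u hu).2).1)
    (fun u hu => (hsub u (hmem u hu).1 (hmem u hu).2).2)
  have hend : t + s ∈ Icc t (t + s) := ⟨by linarith, le_rfl⟩
  rw [add_sub_cancel_left] at heq
  have h1 := hsub _ (hmem _ hend).1 (hmem _ hend).2
  rw [heq] at h1
  rw [heq, vel_eq_dir hG.nondeg hs0 hc hd h1.1 h1.2 (by rw [← heq, h.ham_eq (hmem _ hend).1 ht])]

/-- The same argument on `[t - s, t]`, where the reversed displacement is a velocity for `-A`. -/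
lemma eq_add_smul_dir_neg (h : IsSolutionOn M A γ a b) (hG : Good M A) {t : ℝ} (ht : t ∈ Icc a b) :
    ∃ ε > 0, ∀ s ∈ Icc 0 ε, a ≤ t - s → γ (t - s) = γ t + s • dir M (-A) (γ t) := by
  obtain ⟨ε, hε, hsub⟩ := h.exists_subset ht
  refine ⟨ε, hε, fun s hs hsa => ?_⟩
  rcases hs.1.eq_or_lt with rfl | hs0
  · simp
  have hmem : ∀ u ∈ Icc (t - s) t, u ∈ Icc a b ∧ |u - t| ≤ ε := fun u hu =>
    ⟨⟨hsa.trans hu.1, hu.2.trans ht.2⟩, by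
      rw [abs_sub_comm, abs_of_nonneg (sub_nonneg.2 hu.2)]; linarith [hu.1, hs.2]⟩
  obtain ⟨c, hc, d, hd, heq⟩ := h.exists_eq_add_smul_vel hG.det_ne_zero hG.invSum_ne_zero hsa
    (sub_lt_self t hs0) ht.2 (fun u hu => (hsub u (hmem u hu).1 (hmem u hu).2).1)
    (fun u hu => (hsub u (hmem u hu).1 (hmem u hu).2).2)
  have hend : t - s ∈ Icc (t - s) t := ⟨le_rfl, by linarith⟩
  have heq' : γ (t - s) = γ t + s • vel M (-A) c d := by
    rw [heq, vel_neg M hG.det_ne_zero, sub_sub_cancel, smul_neg, add_neg_cancel_right]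
  have h1 := hsub _ (hmem _ hend).1 (hmem _ hend).2
  rw [heq'] at h1
  rw [heq', vel_eq_dir hG.neg.nondeg hs0 hc hd h1.1 h1.2
    (by rw [← heq', h.ham_eq (hmem _ hend).1 ht])]

lemma isOrbit (h : IsSolutionOn M A γ a b) (hG : Good M A) {ρ t : ℝ} (ht : t ∈ Icc a b)
    (hρ : ham M (γ t) = ρ) : IsOrbit (levelSet M ρ) (dir M A) (fun s => γ (t + s)) (b - t) := by
  have hmem : ∀ s ∈ Icc 0 (b - t), t + s ∈ Icc a b := fun s hs =>
    ⟨by linarith [hs.1, ht.1], by linarith [hs.2]⟩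
  refine IsOrbit.of_germ ?_ (fun s hs => ⟨h.1 _ (hmem s hs), ?_⟩) fun s hs => ?_
  · exact h.continuousOn.comp (by fun_prop : Continuous fun s : ℝ => t + s).continuousOn hmem
  · rw [h.ham_eq (hmem s hs) ht, hρ]
  · obtain ⟨ε, hε, h'⟩ := h.eq_add_smul_dir hG (hmem s ⟨hs.1, hs.2.le⟩)
    refine ⟨ε, hε, fun u hu hub => ?_⟩
    rw [← add_assoc]
    exact h' u hu (by linarith)

lemma isOrbit_neg (h : IsSolutionOn M A γ a b) (hG : Good M A) {ρ t : ℝ} (ht : t ∈ Icc a b)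
    (hρ : ham M (γ t) = ρ) :
    IsOrbit (levelSet M ρ) (dir M (-A)) (fun s => γ (t - s)) (t - a) := by
  have hmem : ∀ s ∈ Icc 0 (t - a), t - s ∈ Icc a b := fun s hs =>
    ⟨by linarith [hs.2], by linarith [hs.1, ht.2]⟩
  refine IsOrbit.of_germ ?_ (fun s hs => ⟨h.1 _ (hmem s hs), ?_⟩) fun s hs => ?_
  · exact h.continuousOn.comp (by fun_prop : Continuous fun s : ℝ => t - s).continuousOn hmem
  · rw [h.ham_eq (hmem s hs) ht, hρ]
  · obtain ⟨ε, hε, h'⟩ := h.eq_add_smul_dir_neg hG (hmem s ⟨hs.1, hs.2.le⟩)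
    refine ⟨ε, hε, fun u hu hub => ?_⟩
    rw [← sub_sub]
    exact h' u hu (by linarith)

end IsSolutionOn

/-! ### The flow on a level set -/

lemma IsForwardFlow.exists_eq_add_smul {S : Set (Pt n)} {w : Pt n → Pt n}
    {fwd : ℝ → Pt n → Pt n} (hf : IsForwardFlow S w fwd) {x : Pt n} (hx : x ∈ S) :
    ∃ ε > 0, ∀ s ∈ Icc 0 ε, fwd s x = x + s • w x := by
  obtain ⟨ε, hε, -, h⟩ := ((hf x hx).2 1).germ 0 ⟨le_rfl, one_pos⟩
  refine ⟨ε, hε, fun s hs => ?_⟩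
  have := h s hs
  rwa [zero_add, (hf x hx).1] at this

section FlowPair

variable {M A : Mat n} {ρ b : ℝ} {γ : ℝ → Pt n} {fwd bwd : ℝ → Pt n → Pt n}

/-- The two-sided flow made of a forward and a backward flow. -/
noncomputable def twoSided (fwd bwd : ℝ → Pt n → Pt n) (t : ℝ) (x : Pt n) : Pt n :=
  if 0 ≤ t then fwd t x else bwd (-t) x

lemma twoSided_mem (hf : IsForwardFlow (levelSet M ρ) (dir M A) fwd)
    (hb : IsForwardFlow (levelSet M ρ) (dir M (-A)) bwd) {x : Pt n} (hx : x ∈ levelSet M ρ)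
    (t : ℝ) : twoSided fwd bwd t x ∈ levelSet M ρ := by
  unfold twoSided
  split_ifs with ht
  · exact hf.mem hx ht
  · exact hb.mem hx (by linarith)

lemma twoSided_of_nonneg (x : Pt n) {t : ℝ} (ht : 0 ≤ t) : twoSided fwd bwd t x = fwd t x :=
  if_pos ht

lemma twoSided_neg (hf : IsForwardFlow (levelSet M ρ) (dir M A) fwd)
    (hb : IsForwardFlow (levelSet M ρ) (dir M (-A)) bwd) {x : Pt n} (hx : x ∈ levelSet M ρ) {t : ℝ}
    (ht : 0 ≤ t) : twoSided fwd bwd (-t) x = bwd t x := by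
  unfold twoSided
  split_ifs with h
  · obtain rfl : t = 0 := le_antisymm (by linarith) ht
    rw [neg_zero, (hf x hx).1, (hb x hx).1]
  · rw [neg_neg]

variable [Nonempty (Fin n)]

/-- A Lipschitz curve is differentiable almost everywhere, and there its derivative equals the right
derivative `dir`. The shift `r` allows solutions that start before time zero. -/
lemma IsOrbit.isSolutionOn (ho : IsOrbit (levelSet M ρ) (dir M A) γ b) (hG : Good M A)
    (hb : 0 ≤ b) (r : ℝ) : IsSolutionOn M A (fun t => γ (t + r)) (-r) (b - r) := by
  obtain ⟨C, hC⟩ := exists_norm_dir_le M A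
  have hmem : ∀ t ∈ Icc (-r) (b - r), t + r ∈ Icc 0 b := fun t ht =>
    ⟨by linarith [ht.1], by linarith [ht.2]⟩
  have hlip : LipschitzOnWith C (fun t => γ (t + r)) (Icc (-r) (b - r)) := by
    refine LipschitzOnWith.of_dist_le_mul fun t ht u hu => ?_
    have := (ho.lipschitzOnWith fun x _ => hC x).dist_le_mul _ (hmem t ht) _ (hmem u hu)
    rwa [dist_add_right] at this
  refine ⟨fun t ht => (ho.mem _ (hmem t ht)).1, ?_, ?_⟩
  · refine LipschitzOnWith.absolutelyContinuousOnInterval (K := C) ?_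
    rwa [uIcc_of_le (by linarith)]
  · have hne : ∀ c : ℝ, ∀ᵐ t : ℝ, t ≠ c := fun c => by simp [ae_iff, measure_singleton]
    rw [ae_restrict_iff' measurableSet_Icc]
    filter_upwards [hlip.ae_differentiableWithinAt_of_mem_real, hne (-r), hne (b - r)]
      with t hdiff h1 h2 ht
    have ht' : t ∈ Ioo (-r) (b - r) := ⟨lt_of_le_of_ne ht.1 h1.symm, lt_of_le_of_ne ht.2 h2⟩
    have hd := ((hdiff ht).differentiableAt (Icc_mem_nhds ht'.1 ht'.2)).hasDerivAt
    have hright : HasDerivWithinAt (fun t => γ (t + r)) (dir M A (γ (t + r))) (Ici t) t := by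
      have h3 := ho.hasDerivWithinAt (t := t + r)
        ⟨by linarith [ht'.1], by linarith [ht'.2]⟩
      have h4 := h3.scomp (h := fun u => u + r) t ((hasDerivAt_id t).add_const r).hasDerivWithinAt
        (fun u (hu : t ≤ u) => show t + r ≤ u + r by linarith)
      rwa [one_smul] at h4
    have heq := (uniqueDiffOn_Ici t t self_mem_Ici).eq_deriv _ hd.hasDerivWithinAt hright
    rw [heq] at hd
    exact ⟨_, dir_mem_hamField hG.det_ne_zero hG.invSum_ne_zero _, hd⟩

lemma IsForwardFlow.isSolutionOn (hf : IsForwardFlow (levelSet M ρ) (dir M A) fwd) (hG : Good M A)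
    {x : Pt n} (hx : x ∈ levelSet M ρ) (hb : 0 ≤ b) : IsSolutionOn M A (fun t => fwd t x) 0 b := by
  simpa using ((hf x hx).2 b).isSolutionOn hG hb 0

/-- A forward orbit read backwards is an orbit for `-A`, and such orbits are unique. -/
lemma IsForwardFlow.reverse (hf : IsForwardFlow (levelSet M ρ) (dir M A) fwd)
    (hb : IsForwardFlow (levelSet M ρ) (dir M (-A)) bwd) (hG : Good M A) {x : Pt n}
    (hx : x ∈ levelSet M ρ) {b u : ℝ} (hu : 0 ≤ u) (hub : u ≤ b) :
    bwd u (fwd b x) = fwd (b - u) x := by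
  have hb0 := hu.trans hub
  have h1 := (hf.isSolutionOn hG hx hb0).isOrbit_neg hG (ρ := ρ) (t := b) ⟨hb0, le_rfl⟩
    (hf.mem hx hb0).2
  rw [sub_zero] at h1
  exact (hb.eq_of_isOrbit (hf.mem hx hb0) h1 (by simp) ⟨hu, hub⟩).symm

/-- Close to `y`, the forward flow is continuous at `y` for short times. -/
lemma IsForwardFlow.exists_continuousWithinAt
    (hf : IsForwardFlow (levelSet M ρ) (dir M A) fwd) (hG : Good M A) {y : Pt n}
    (hy : y ∈ levelSet M ρ) :
    ∃ τ > 0, ∀ s ∈ Icc 0 τ, ContinuousWithinAt (fwd s) (levelSet M ρ) y := by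
  obtain ⟨C, hC⟩ := exists_norm_dir_le M A
  obtain ⟨δ, hδ, hsub⟩ := Metric.eventually_nhds_iff.1
    ((continuous_snd.tendsto y).eventually (eventually_topRows_subset M y.2) |>.and
      ((continuous_fst.tendsto y).eventually (eventually_bottomCols_subset M y.1)))
  have hC0 : 0 < (C : ℝ) + 1 := by positivity
  -- In this time an orbit moves at most `δ / 3`. Starting within `δ / 3` of `y`, it meets only
  -- active indices of `y`.
  refine ⟨δ / 3 / (C + 1), by positivity, fun s hs => ?_⟩
  rcases hs.1.eq_or_lt with rfl | hs0
  · exact continuousWithinAt_id.congr (fun x hx => (hf x hx).1) (hf y hy).1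
  have hdist : ∀ x ∈ levelSet M ρ, ∀ r ∈ Icc 0 s, dist (fwd r x) x ≤ δ / 3 := fun x hx r hr => by
    have h1 := hf.norm_sub_le (fun x _ => hC x) hx le_rfl hr.1
    rw [(hf x hx).1, ← dist_eq_norm, sub_zero] at h1
    have h2 : C * r ≤ (C + 1) * (δ / 3 / (C + 1)) :=
      mul_le_mul (by linarith) (hr.2.trans hs.2) hr.1 hC0.le
    rw [mul_div_cancel₀ _ hC0.ne'] at h2
    exact h1.trans h2
  have hkey : Filter.Tendsto (fwd s) (nhdsWithin y (levelSet M ρ)) (nhds (y + s • dir M A y)) := by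
    -- By compactness it suffices to identify every cluster point `z`. It is `y` displaced by an
    -- admissible velocity with `H` unchanged, so that velocity is `dir M A y`.
    refine (isCompact_levelSet M ρ).tendsto_nhds_of_unique_mapClusterPt
      (eventually_nhdsWithin_of_forall fun x hx => hf.mem hx hs.1) fun z hz hcl => ?_
    obtain ⟨U, hU, hUz⟩ := mapClusterPt_iff_ultrafilter.1 hcl
    have hUy : Filter.Tendsto id (U : Filter (Pt n)) (nhds y) := hU.trans nhdsWithin_le_nhds
    have hmem : ∀ᶠ x in (U : Filter (Pt n)), s⁻¹ • (fwd s x - x) ∈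
        (fun e : Pt n => vel M A e.1 e.2) '' face (topRows M y.2) ×ˢ face (bottomCols M y.1) := by
      have hev : ∀ᶠ x in nhdsWithin y (levelSet M ρ), x ∈ levelSet M ρ ∧ dist x y < δ / 3 :=
        (eventually_mem_nhdsWithin).and
          (nhdsWithin_le_nhds (Metric.ball_mem_nhds y (by positivity)))
      filter_upwards [hU hev] with x ⟨hx, hxy⟩
      have hball : ∀ r ∈ Icc 0 s, dist (fwd r x) y < δ := fun r hr => by
        have := dist_triangle (fwd r x) x y
        linarith [hdist x hx r hr]
      obtain ⟨c, hc, d, hd, heq⟩ := (hf.isSolutionOn hG hx hs.1).exists_eq_add_smul_vel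
        hG.det_ne_zero hG.invSum_ne_zero le_rfl hs0 le_rfl
        (fun t ht => (hsub (hball t ht)).1) (fun t ht => (hsub (hball t ht)).2)
      refine ⟨(c, d), ⟨hc, hd⟩, ?_⟩
      rw [heq, (hf x hx).1, add_sub_cancel_left, sub_zero, inv_smul_smul₀ hs0.ne']
    obtain ⟨⟨c, d⟩, ⟨hc, hd⟩, hcd⟩ := (isCompact_image_vel M A _ _).isClosed.mem_of_tendsto
      ((hUz.sub hUy).const_smul s⁻¹) hmem
    have hz' : z = y + s • vel M A c d := by
      rw [show vel M A c d = _ from hcd, smul_inv_smul₀ hs0.ne', add_sub_cancel]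
    have hzy : dist z y < δ := by
      have h1 : dist z y ≤ δ / 3 := le_of_tendsto (hUz.dist hUy) (by
        filter_upwards [hU self_mem_nhdsWithin] with x hx
        exact hdist x hx s ⟨hs.1, le_rfl⟩)
      linarith
    have h3 := hsub hzy
    have h4 : ham M z = ham M y := hz.2.trans hy.2.symm
    rw [hz'] at h3 h4
    rw [hz', vel_eq_dir hG.nondeg hs0 hc hd h3.1 h3.2 h4]
  -- Restricting the limit to the point `y` itself identifies it with `fwd s y`.
  have := tendsto_nhds_unique (tendsto_pure_nhds (fwd s) y)
    (hkey.mono_left (pure_le_nhdsWithin hy))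
  rwa [← this] at hkey

lemma IsForwardFlow.continuousOn_levelSet
    (hf : IsForwardFlow (levelSet M ρ) (dir M A) fwd) (hG : Good M A) {t : ℝ} (ht : 0 ≤ t) :
    ContinuousOn (fwd t) (levelSet M ρ) := by
  obtain ⟨C, hC⟩ := exists_norm_dir_le M A
  exact hf.continuousOn (fun x _ => hC x) (fun y hy => hf.exists_continuousWithinAt hG hy) ht

/-- Started from a point far enough back, a two-sided orbit is a single forward orbit. This reduces
the group law and the Lipschitz bound to forward time. -/
lemma twoSided_eq (hf : IsForwardFlow (levelSet M ρ) (dir M A) fwd)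
    (hb : IsForwardFlow (levelSet M ρ) (dir M (-A)) bwd) (hG : Good M A) {x : Pt n}
    (hx : x ∈ levelSet M ρ) {t r : ℝ} (hr : 0 ≤ r) (htr : -r ≤ t) :
    twoSided fwd bwd t x = fwd (t + r) (bwd r x) := by
  have hf' : IsForwardFlow (levelSet M ρ) (dir M (- -A)) fwd := by rwa [neg_neg]
  have hrev : ∀ u, 0 ≤ u → u ≤ r → fwd u (bwd r x) = bwd (r - u) x := fun u hu hur =>
    hb.reverse hf' hG.neg hx hu hur
  rcases le_total 0 t with ht | ht
  · rw [twoSided_of_nonneg x ht, add_comm, hf.add (hb.mem hx hr) hr ht, hrev r hr le_rfl, sub_self,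
      (hb x hx).1]
  · obtain ⟨u, rfl⟩ : ∃ u, t = -u := ⟨-t, by simp⟩
    rw [twoSided_neg hf hb hx (by linarith), hrev _ (by linarith) (by linarith)]
    congr 1
    ring

lemma twoSided_add (hf : IsForwardFlow (levelSet M ρ) (dir M A) fwd)
    (hb : IsForwardFlow (levelSet M ρ) (dir M (-A)) bwd) (hG : Good M A) {x : Pt n}
    (hx : x ∈ levelSet M ρ) (t s : ℝ) :
    twoSided fwd bwd (t + s) x = twoSided fwd bwd t (twoSided fwd bwd s x) := by
  have hr : 0 ≤ |t| + |s| := by positivity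
  rw [twoSided_eq hf hb hG hx hr (by linarith [neg_abs_le t, neg_abs_le s]),
    twoSided_eq hf hb hG hx (t := s) hr (by linarith [abs_nonneg t, neg_abs_le s])]
  have hy := hb.mem hx hr
  set y := bwd (|t| + |s|) x
  have hs : |t| ≤ s + (|t| + |s|) := by linarith [neg_abs_le s]
  rcases le_total 0 t with ht | ht
  · rw [twoSided_of_nonneg _ ht, ← hf.add hy ((abs_nonneg t).trans hs) ht]
    congr 1
    ring
  · obtain ⟨u, rfl⟩ : ∃ u, t = -u := ⟨-t, by simp⟩
    have hu : 0 ≤ u := by linarith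
    rw [twoSided_neg hf hb (hf.mem hy ((abs_nonneg _).trans hs)) hu,
      hf.reverse hb hG hy hu (by rw [abs_neg, abs_of_nonneg hu] at hs ⊢; exact hs)]
    congr 1
    ring

lemma exists_lipschitzWith_twoSided (hf : IsForwardFlow (levelSet M ρ) (dir M A) fwd)
    (hb : IsForwardFlow (levelSet M ρ) (dir M (-A)) bwd) (hG : Good M A) :
    ∃ C, ∀ x ∈ levelSet M ρ, LipschitzWith C fun t => twoSided fwd bwd t x := by
  obtain ⟨C, hC⟩ := exists_norm_dir_le M A
  have h : ∀ x ∈ levelSet M ρ, ∀ t u, t ≤ u →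
      dist (twoSided fwd bwd u x) (twoSided fwd bwd t x) ≤ C * dist u t := fun x hx t u htu => by
    rw [twoSided_eq hf hb hG hx (abs_nonneg t) (neg_abs_le t),
      twoSided_eq hf hb hG hx (t := u) (abs_nonneg t) ((neg_abs_le t).trans htu), dist_eq_norm,
      Real.dist_eq, abs_of_nonneg (sub_nonneg.2 htu)]
    have := hf.norm_sub_le (fun x _ => hC x) (hb.mem hx (abs_nonneg t))
      (t := t + |t|) (u := u + |t|) (by linarith [neg_abs_le t]) (by linarith)
    rwa [add_sub_add_right_eq_sub] at this
  refine ⟨C, fun x hx => LipschitzWith.of_dist_le_mul fun t u => ?_⟩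
  rcases le_total t u with htu | htu
  · rw [dist_comm, dist_comm t]
    exact h x hx t u htu
  · exact h x hx u t htu

/-- The flow on the level set. -/
noncomputable def levelFlow (hf : IsForwardFlow (levelSet M ρ) (dir M A) fwd)
    (hb : IsForwardFlow (levelSet M ρ) (dir M (-A)) bwd) (hG : Good M A) :
    Flow ℝ (levelSet M ρ) where
  toFun t x := ⟨twoSided fwd bwd t x, twoSided_mem hf hb x.2 t⟩
  cont' := by
    obtain ⟨C, hC⟩ := exists_lipschitzWith_twoSided hf hb hG
    -- Joint continuity follows from continuity in `x` and a Lipschitz bound in `t` uniform in `x`.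
    refine continuous_prod_of_continuous_lipschitzWith _ C (fun t => ?_) fun x => ?_
    · refine Continuous.subtype_mk ?_ _
      rcases le_total 0 t with ht | ht
      · simp only [twoSided_of_nonneg _ ht]
        exact continuousOn_iff_continuous_domRestrict.1 (hf.continuousOn_levelSet hG ht)
      · obtain ⟨u, rfl⟩ : ∃ u, t = -u := ⟨-t, by simp⟩
        have hu : 0 ≤ u := by linarith
        have : (fun x : levelSet M ρ => twoSided fwd bwd (-u) x) = fun x : levelSet M ρ => bwd u x :=
          funext fun x => twoSided_neg hf hb x.2 hu
        rw [this]
        exact continuousOn_iff_continuous_domRestrict.1 (hb.continuousOn_levelSet hG.neg hu)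
    · exact fun t u => hC x x.2 t u
  map_add' t s x := Subtype.ext (twoSided_add hf hb hG x.2 t s)
  map_zero' x := Subtype.ext ((twoSided_of_nonneg _ le_rfl).trans (hf x x.2).1)

lemma levelFlow_apply (hf : IsForwardFlow (levelSet M ρ) (dir M A) fwd)
    (hb : IsForwardFlow (levelSet M ρ) (dir M (-A)) bwd) (hG : Good M A) (t : ℝ)
    (x : levelSet M ρ) : (levelFlow hf hb hG t x : Pt n) = twoSided fwd bwd t x := rfl

lemma isUniqueFlow_levelFlow (hf : IsForwardFlow (levelSet M ρ) (dir M A) fwd)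
    (hb : IsForwardFlow (levelSet M ρ) (dir M (-A)) bwd) (hG : Good M A) :
    IsUniqueFlow M A ρ (levelFlow hf hb hG) := by
  intro x
  simp only [levelFlow_apply]
  refine ⟨fun a b hab => ?_, fun a b ha hb' γ hγ h0 t ht => ?_⟩
  · have hr : 0 ≤ |a| + |b| := by positivity
    have h1 := ((hf _ (hb.mem x.2 hr)).2 (b + (|a| + |b|))).isSolutionOn hG
      (by linarith [neg_abs_le b, abs_nonneg a]) (|a| + |b|)
    rw [add_sub_cancel_right] at h1
    have h2 := h1.mono (a' := a) (by linarith [neg_abs_le a, abs_nonneg b]) hab le_rfl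
    have heq : ∀ t, a ≤ t → fwd (t + (|a| + |b|)) (bwd (|a| + |b|) x) = twoSided fwd bwd t x :=
      fun t ht => (twoSided_eq hf hb hG x.2 hr (by linarith [neg_abs_le a, abs_nonneg b])).symm
    refine ⟨fun t ht => (twoSided_mem hf hb x.2 t).1, ?_, ?_⟩
    · obtain ⟨C, hC⟩ := exists_lipschitzWith_twoSided hf hb hG
      exact (hC x x.2).lipschitzOnWith.absolutelyContinuousOnInterval
    · have hne : ∀ᵐ t : ℝ, t ≠ a := by simp [ae_iff, measure_singleton]
      rw [ae_restrict_iff' measurableSet_Icc]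
      filter_upwards [(ae_restrict_iff' measurableSet_Icc).1 h2.2.2, hne] with t ht hta htm
      obtain ⟨v, hv, hd⟩ := ht htm
      refine ⟨v, ?_, hd.congr_of_eventuallyEq ?_⟩
      · rwa [heq t htm.1] at hv
      · filter_upwards [Ioi_mem_nhds (lt_of_le_of_ne htm.1 hta.symm)] with u hu
        exact (heq u (le_of_lt hu)).symm
  · have hρ : ham M (γ 0) = ρ := h0 ▸ x.2.2
    rcases le_total 0 t with h | h
    · have h1 := hγ.isOrbit hG (ρ := ρ) (t := 0) ⟨ha, hb'⟩ hρ
      have h2 := hf.eq_of_isOrbit x.2 h1 (by simpa using h0) (t := t) ⟨h, by linarith [ht.2]⟩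
      rw [twoSided_of_nonneg _ h, ← h2, zero_add]
    · have h1 := hγ.isOrbit_neg hG (ρ := ρ) (t := 0) ⟨ha, hb'⟩ hρ
      obtain ⟨u, rfl⟩ : ∃ u, t = -u := ⟨-t, by simp⟩
      have h2 := hb.eq_of_isOrbit x.2 h1 (by simpa using h0) (t := u)
        ⟨by linarith, by linarith [ht.1]⟩
      rw [twoSided_neg hf hb x.2 (by linarith), ← h2, zero_sub]

lemma exists_levelFlow_eq (hf : IsForwardFlow (levelSet M ρ) (dir M A) fwd)
    (hb : IsForwardFlow (levelSet M ρ) (dir M (-A)) bwd) (hG : Good M A) (x : levelSet M ρ) :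
    ∃ ε > 0, ∀ t ∈ Icc (0 : ℝ) ε, (levelFlow hf hb hG t x : Pt n) = x + t • dir M A x ∧
      (levelFlow hf hb hG (-t) x : Pt n) = x + t • dir M (-A) x := by
  obtain ⟨ε, hε, h1⟩ := hf.exists_eq_add_smul x.2
  obtain ⟨ε', hε', h2⟩ := hb.exists_eq_add_smul x.2
  refine ⟨min ε ε', lt_min hε hε', fun t ht => ?_⟩
  rw [levelFlow_apply, levelFlow_apply, twoSided_of_nonneg _ ht.1, twoSided_neg hf hb x.2 ht.1]
  exact ⟨h1 t ⟨ht.1, ht.2.trans (min_le_left _ _)⟩, h2 t ⟨ht.1, ht.2.trans (min_le_right _ _)⟩⟩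

lemma isPiecewiseTranslation_levelFlow (hf : IsForwardFlow (levelSet M ρ) (dir M A) fwd)
    (hb : IsForwardFlow (levelSet M ρ) (dir M (-A)) bwd) (hG : Good M A) :
    IsPiecewiseTranslation M ρ (levelFlow hf hb hG) := by
  refine ⟨forwardVel M A, fun I J => - forwardVel M (-A) I J, fun I J x hx => ?_⟩
  obtain ⟨ε, hε, h⟩ := exists_levelFlow_eq hf hb hG x
  obtain ⟨-, rfl, rfl⟩ := hx
  refine ⟨ε, hε, fun t ht => ⟨(h t ht).1, ?_⟩⟩
  rw [(h t ht).2, smul_neg, sub_neg_eq_add]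
  rfl

/-- A zero velocity would make `x` a minimum of `H` on `Σ × Σ`, but `H` vanishes at the equilibrium.
-/
lemma zero_notMem_hamField {p q : Fin n → ℝ} {μ : ℝ} (h : IsEquil M p q μ) (hρ : 0 < ρ)
    {x : Pt n} (hx : x ∈ levelSet M ρ) : (0 : Pt n) ∉ hamField M A x := by
  rintro ⟨-, ξ, hξ, h0⟩
  have hY := sub_mem_tangentProd h.mem_simplexProd hx.1
  have h1 := hξ _ hY
  rw [← h0 _ hY, add_sub_cancel] at h1
  have h2 : ham M (p, q) = 0 := by
    have := h.ham_add 0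
    rwa [add_zero, show ham M (0 : Pt n) = 0 by simpa using ham_smul M (le_refl (0 : ℝ)) 0] at this
  have h3 : symp A 0 ((p, q) - x) = 0 := by simp [symp_eq]
  rw [h2, h3, hx.2] at h1
  linarith

lemma exists_levelFlow_ne (hf : IsForwardFlow (levelSet M ρ) (dir M A) fwd)
    (hb : IsForwardFlow (levelSet M ρ) (dir M (-A)) bwd) (hG : Good M A) {p q : Fin n → ℝ} {μ : ℝ}
    (h : IsEquil M p q μ) (hρ : 0 < ρ) (x : levelSet M ρ) : ∃ t, levelFlow hf hb hG t x ≠ x := by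
  obtain ⟨ε, hε, h'⟩ := exists_levelFlow_eq hf hb hG x
  refine ⟨ε, fun heq => zero_notMem_hamField (A := A) h hρ x.2 ?_⟩
  have h1 := (h' ε ⟨hε.le, le_rfl⟩).1
  rw [heq, left_eq_add, smul_eq_zero, or_iff_right hε.ne'] at h1
  rw [← h1]
  exact dir_mem_hamField hG.det_ne_zero hG.invSum_ne_zero _

end FlowPair

/-! ### Convex polyhedral sets and piecewise affine relations -/

namespace IsConvexPolyhedral

variable {C D : Set (Pt n)}

lemma inter (hC : IsConvexPolyhedral C) (hD : IsConvexPolyhedral D) :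
    IsConvexPolyhedral (C ∩ D) := by
  classical
  obtain ⟨F, G, rfl⟩ := hC
  obtain ⟨F', G', rfl⟩ := hD
  refine ⟨F ∪ F', G ∪ G', ?_⟩
  ext x
  simp only [mem_inter_iff, mem_ofPred_eq, Finset.mem_union, or_imp, forall_and]
  tauto

lemma preimage (hC : IsConvexPolyhedral C) (L : Pt n →ᵃ[ℝ] Pt n) :
    IsConvexPolyhedral (L ⁻¹' C) := by
  classical
  obtain ⟨F, G, rfl⟩ := hC
  refine ⟨F.image (·.comp L), G.image (·.comp L), ?_⟩
  ext x
  simp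

lemma iInter {ι : Type*} [Finite ι] {C : ι → Set (Pt n)} (hC : ∀ k, IsConvexPolyhedral (C k)) :
    IsConvexPolyhedral (⋂ k, C k) := by
  classical
  choose F G h using hC
  have := Fintype.ofFinite ι
  refine ⟨Finset.univ.biUnion F, Finset.univ.biUnion G, ?_⟩
  ext x
  simp only [h, mem_iInter, mem_ofPred_eq, Finset.mem_biUnion, Finset.mem_univ, true_and,
    forall_exists_index, forall_and]
  exact and_congr forall_comm forall_comm

lemma sign_eq (f : Pt n →ᵃ[ℝ] ℝ) (s : SignType) :
    IsConvexPolyhedral {x | SignType.sign (f x) = s} := by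
  classical
  cases s
  · refine ⟨{f, -f}, ∅, ?_⟩
    ext x
    simp [le_antisymm_iff, and_comm]
  · refine ⟨∅, {-f}, ?_⟩
    ext x
    simpa using sign_eq_neg_one_iff
  · refine ⟨∅, {f}, ?_⟩
    ext x
    simpa using sign_eq_one_iff

end IsConvexPolyhedral

/-- On `D`, which is a countable union of convex polyhedral pieces, the relation `R` is contained
in the graphs of affine maps, one for each piece. -/
def IsPiecewiseAffineRel (R : Pt n → Pt n → Prop) (D : Set (Pt n)) : Prop :=
  ∃ Fam : Set (Set (Pt n)), Fam.Countable ∧ D = ⋃₀ Fam ∧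
    ∀ C ∈ Fam, IsConvexPolyhedral C ∧ ∃ L : Pt n →ᵃ[ℝ] Pt n, ∀ x ∈ C, ∀ y, R x y → y = L x

namespace IsPiecewiseAffineRel

variable {R : Pt n → Pt n → Prop} {D : Set (Pt n)}

lemma empty : IsPiecewiseAffineRel R (∅ : Set (Pt n)) := ⟨∅, countable_empty, by simp, by simp⟩

lemma of_isConvexPolyhedral (hD : IsConvexPolyhedral D) (L : Pt n →ᵃ[ℝ] Pt n)
    (hL : ∀ x ∈ D, ∀ y, R x y → y = L x) : IsPiecewiseAffineRel R D :=
  ⟨{D}, countable_singleton D, by simp, by rintro C rfl; exact ⟨hD, L, hL⟩⟩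

lemma iUnion {ι : Type*} [Countable ι] {D : ι → Set (Pt n)}
    (hD : ∀ k, IsPiecewiseAffineRel R (D k)) : IsPiecewiseAffineRel R (⋃ k, D k) := by
  choose Fam hc hD hF using hD
  refine ⟨⋃ k, Fam k, countable_iUnion hc, ?_, fun C hC => ?_⟩
  · rw [sUnion_iUnion]
    exact iUnion_congr hD
  · obtain ⟨k, hk⟩ := mem_iUnion.1 hC
    exact hF k C hk

/-- Restriction to a polyhedral set followed by an affine map. -/
lemma inter_preimage (hD : IsPiecewiseAffineRel R D) {X : Set (Pt n)} (hX : IsConvexPolyhedral X)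
    (L : Pt n →ᵃ[ℝ] Pt n) (hR : ∀ x ∈ X, L x ∈ D → ∀ y, R x y → R (L x) y) :
    IsPiecewiseAffineRel R (X ∩ L ⁻¹' D) := by
  obtain ⟨Fam, hc, rfl, hF⟩ := hD
  refine ⟨(fun C => X ∩ L ⁻¹' C) '' Fam, hc.image _, ?_, ?_⟩
  · rw [sUnion_image, sUnion_eq_biUnion, preimage_iUnion₂, inter_iUnion₂]
  · rintro _ ⟨C, hC, rfl⟩
    obtain ⟨h1, L', hL'⟩ := hF C hC
    exact ⟨hX.inter (h1.preimage L), L'.comp L, fun x hx y hy =>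
      hL' _ hx.2 y (hR x hx.1 ⟨C, hC, hx.2⟩ y hy)⟩

end IsPiecewiseAffineRel

/-! ### Signs of affine functions along lines -/

lemma sign_eq_or_eq_zero_of_abs_eq {s : SignType} {a : ℝ} (h : |a| = s * a) :
    SignType.sign a = s ∨ a = 0 := by
  rcases lt_trichotomy a 0 with ha | ha | ha
  · left
    rw [abs_of_neg ha] at h
    cases s <;> simp at h <;> simp [ha] <;> linarith
  · exact Or.inr ha
  · left
    rw [abs_of_pos ha] at h
    cases s <;> simp at h <;> simp [ha] <;> linarith

/-- A sign that is constant on an open interval can only change to zero at its ends. -/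
lemma sign_eq_or_eq_zero_of_Ioo {f : ℝ → ℝ} {a b : ℝ} {s : SignType} (hf : ContinuousOn f (Icc a b))
    (hab : a < b) (h : ∀ u ∈ Ioo a b, SignType.sign (f u) = s) {t : ℝ} (ht : t ∈ Icc a b) :
    SignType.sign (f t) = s ∨ f t = 0 := by
  -- An equation between continuous functions, which therefore extends to the end points.
  have h1 : EqOn (fun u => |f u|) (fun u => s * f u) (Ioo a b) := fun u hu => by
    simp only [← h u hu]
    exact (sign_mul_self _).symm
  have h2 : EqOn (fun u => |f u|) (fun u => s * f u) (Icc a b) :=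
    h1.of_subset_closure hf.abs (continuousOn_const.mul hf) Ioo_subset_Icc_self
      (by rw [closure_Ioo hab.ne])
  exact sign_eq_or_eq_zero_of_abs_eq (h2 ht)

lemma exists_eventually_sign_eq (a b : ℝ) :
    ∃ s, ∀ᶠ u in nhdsWithin 0 (Ioi 0), SignType.sign (a + u * b) = s := by
  have hc : Filter.Tendsto (fun u : ℝ => a + u * b) (nhdsWithin 0 (Ioi 0)) (nhds a) := by
    have : Continuous fun u : ℝ => a + u * b := by fun_prop
    have h := this.tendsto 0
    rw [zero_mul, add_zero] at h
    exact h.mono_left nhdsWithin_le_nhds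
  rcases lt_trichotomy a 0 with ha | rfl | ha
  · exact ⟨-1, by filter_upwards [hc.eventually (gt_mem_nhds ha)] with u hu using sign_neg hu⟩
  · refine ⟨SignType.sign b, ?_⟩
    filter_upwards [self_mem_nhdsWithin] with u hu
    rw [zero_add, sign_mul, sign_pos hu, one_mul]
  · exact ⟨1, by filter_upwards [hc.eventually (lt_mem_nhds ha)] with u hu using sign_pos hu⟩

/-- The signs of the affine functions `h k` at `x`. -/
noncomputable def signs {ι : Type*} (h : ι → Pt n →ᵃ[ℝ] ℝ) (x : Pt n) (k : ι) : SignType :=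
  SignType.sign (h k x)

lemma affine_add_smul (f : Pt n →ᵃ[ℝ] ℝ) (x z : Pt n) (u : ℝ) :
    f (x + u • z) = f x + u * f.linear z := by
  rw [add_comm, ← vadd_eq_add, f.map_vadd, map_smul, vadd_eq_add, smul_eq_mul, add_comm]

section

variable {ι : Type*} [Finite ι] (h : ι → Pt n →ᵃ[ℝ] ℝ)

lemma isConvexPolyhedral_signs_eq (a : ι → SignType) :
    IsConvexPolyhedral {x | signs h x = a} := by
  have : {x | signs h x = a} = ⋂ k, {x | SignType.sign (h k x) = a k} := by
    ext x; simp [funext_iff, signs]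
  rw [this]
  exact .iInter fun k => .sign_eq _ _

lemma exists_signs_add_smul_eq (x z : Pt n) :
    ∃ a, ∃ ε > (0 : ℝ), ∀ u ∈ Ioo 0 ε, signs h (x + u • z) = a := by
  choose a ha using fun k => exists_eventually_sign_eq (h k x) ((h k).linear z)
  obtain ⟨ε, hε, hs⟩ := (mem_nhdsGT_iff_exists_Ioo_subset).1 (Filter.eventually_all.2 ha)
  exact ⟨a, ε, hε, fun u hu => funext fun k => by
    rw [signs, affine_add_smul]; exact hs hu k⟩

end

/-! ### First return maps of flows governed by the signs of affine functions -/

/-- A forward flow in `S` along the field `w`, with one-sided linear orbits, such that membership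
in `S` and the value of `w` depend only on the signs of the affine functions `h k`. -/
structure IsSignFlow {ι : Type*} (S : Set (Pt n)) (w : Pt n → Pt n) (fwd : ℝ → Pt n → Pt n)
    (h : ι → Pt n →ᵃ[ℝ] ℝ) : Prop where
  flow : IsForwardFlow S w fwd
  field : IsTranslationField S w
  mem : ∀ x ∈ S, ∀ y, signs h x = signs h y → y ∈ S
  vel : ∀ x ∈ S, ∀ y, signs h x = signs h y → w x = w y
  left : ∀ x ∈ S, ∀ t > 0, ∃ ε > 0, ε ≤ t ∧ ∃ z, ∀ u ∈ Icc 0 ε, fwd (t - u) x = fwd t x + u • z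

/-- On the orbit of `x`, the signs are `a` at time `0`, `b` on `(0, r)` and `c` at time `r`. -/
structure IsStep {ι : Type*} (fwd : ℝ → Pt n → Pt n) (h : ι → Pt n →ᵃ[ℝ] ℝ) (x : Pt n) (r : ℝ)
    (a b c : ι → SignType) : Prop where
  start : signs h x = a
  between : ∀ u ∈ Ioo 0 r, signs h (fwd u x) = b
  finish : signs h (fwd r x) = c

/-- `t` is the first positive time at which `g` vanishes on the orbit of `x`. -/
def IsFirstZero (fwd : ℝ → Pt n → Pt n) (g : Pt n →ᵃ[ℝ] ℝ) (x : Pt n) (t : ℝ) : Prop :=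
  0 < t ∧ g (fwd t x) = 0 ∧ ∀ s, 0 < s → s < t → g (fwd s x) ≠ 0

lemma IsFirstZero.unique {fwd : ℝ → Pt n → Pt n} {g : Pt n →ᵃ[ℝ] ℝ} {x : Pt n} {t u : ℝ}
    (ht : IsFirstZero fwd g x t) (hu : IsFirstZero fwd g x u) : t = u := by
  rcases lt_trichotomy t u with h | h | h
  · exact absurd ht.2.1 (hu.2.2 t ht.1 h)
  · exact h
  · exact absurd hu.2.1 (ht.2.2 u hu.1 h)

/-- `x` and the tuple `(a, b, c, k)` describe a step of length `r`, at the end of which `h k`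
changes its sign to zero, and during which `h k₀` does not vanish. -/
structure IsEvent {ι : Type*} (S : Set (Pt n)) (fwd : ℝ → Pt n → Pt n) (h : ι → Pt n →ᵃ[ℝ] ℝ)
    (k₀ : ι) (x : Pt n) (r : ℝ) (a b c : ι → SignType) (k : ι) : Prop where
  mem : x ∈ S
  pos : 0 < r
  step : IsStep fwd h x r a b c
  ne_zero : b k ≠ 0
  eq_zero : c k = 0
  ne_zero' : b k₀ ≠ 0

/-- The points from which `h k₀` is made to vanish within `m` steps. -/
def hitSet {ι : Type*} (S : Set (Pt n)) (fwd : ℝ → Pt n → Pt n) (h : ι → Pt n →ᵃ[ℝ] ℝ) (k₀ : ι) :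
    ℕ → Set (Pt n)
  | 0 => ∅
  | m + 1 => {x | ∃ r a b c k, IsEvent S fwd h k₀ x r a b c k ∧
      (c k₀ = 0 ∨ fwd r x ∈ hitSet S fwd h k₀ m)}

lemma signs_eq_zero_iff {ι : Type*} (h : ι → Pt n →ᵃ[ℝ] ℝ) (x : Pt n) (k : ι) :
    signs h x k = 0 ↔ h k x = 0 := sign_eq_zero_iff

/-- For an affine function, the sign at the midpoint together with the signs at the ends, up to
zeros, fixes the sign on the open segment. So a step is controlled by finitely many sign conditions.
-/
lemma sign_add_mul_eq {α β r : ℝ} {b : SignType}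
    (h0 : SignType.sign α = b ∨ α = 0) (h1 : SignType.sign (α + r / 2 * β) = b)
    (h2 : SignType.sign (α + r * β) = b ∨ α + r * β = 0) {u : ℝ} (hu : u ∈ Ioo 0 r) :
    SignType.sign (α + u * β) = b := by
  have hr : 0 < r := hu.1.trans hu.2
  have hpos : ∀ α β : ℝ, 0 ≤ α → 0 < α + r / 2 * β → 0 ≤ α + r * β → 0 < α + u * β := by
    intro α β h0 h1 h2
    rcases lt_trichotomy β 0 with hβ | rfl | hβ
    · have := mul_lt_mul_of_neg_right hu.2 hβ
      linarith
    · simpa using h1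
    · have := mul_pos hu.1 hβ
      linarith
  cases b
  · have h0' : α = 0 := h0.elim sign_eq_zero_iff.1 id
    have h2' : α + r * β = 0 := h2.elim sign_eq_zero_iff.1 id
    rw [h0', zero_add] at h2'
    have hβ : β = 0 := (mul_eq_zero.1 h2').resolve_left hr.ne'
    simp [h0', hβ]
  · have h0' : α ≤ 0 := h0.elim (fun h => (sign_eq_neg_one_iff.1 h).le) fun h => h.le
    have h1' := sign_eq_neg_one_iff.1 h1
    have h2' : α + r * β ≤ 0 := h2.elim (fun h => (sign_eq_neg_one_iff.1 h).le) fun h => h.le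
    refine sign_eq_neg_one_iff.2 ?_
    have := hpos (-α) (-β) (by linarith) (by linarith) (by linarith)
    linarith
  · have h0' : 0 ≤ α := h0.elim (fun h => (sign_eq_one_iff.1 h).le) fun h => h.ge
    have h1' := sign_eq_one_iff.1 h1
    have h2' : 0 ≤ α + r * β := h2.elim (fun h => (sign_eq_one_iff.1 h).le) fun h => h.ge
    exact sign_eq_one_iff.2 (hpos α β h0' h1' h2')

namespace IsSignFlow

variable {ι : Type*} {S : Set (Pt n)} {w : Pt n → Pt n} {fwd : ℝ → Pt n → Pt n}
  {h : ι → Pt n →ᵃ[ℝ] ℝ} {x : Pt n} {r s t : ℝ} {a b c a' b' c' : ι → SignType} {k k₀ : ι} {m : ℕ}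

/-- The field is constant while the signs are, and its value is `w x` because a short translation
from `x` keeps `w`. -/
lemma eq_add_smul (H : IsSignFlow S w fwd h) (hx : x ∈ S)
    (hb : ∀ u ∈ Ioo 0 r, signs h (fwd u x) = b) :
    (∀ u ∈ Ioo 0 r, w (fwd u x) = w x) ∧ ∀ u ∈ Icc 0 r, fwd u x = x + u • w x := by
  have hw : ∀ u ∈ Ioo 0 r, w (fwd u x) = w x := by
    intro u hu
    obtain ⟨ε, hε, h1⟩ := H.flow.exists_eq_add_smul hx
    obtain ⟨ε', hε', h2⟩ := H.field x hx
    set v := min (min ε ε') u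
    have hv0 : 0 < v := lt_min (lt_min hε hε') hu.1
    have hvε : v ≤ ε := (min_le_left _ _).trans (min_le_left _ _)
    have hvε' : v ≤ ε' := (min_le_left _ _).trans (min_le_right _ _)
    have hvr : v < r := (min_le_right _ _).trans_lt hu.2
    rw [H.vel _ (H.flow.mem hx hu.1.le) (fwd v x) (by rw [hb u hu, hb v ⟨hv0, hvr⟩]),
      h1 v ⟨hv0.le, hvε⟩, (h2 v ⟨hv0.le, hvε'⟩).2]
  refine ⟨hw, fun u hu => ?_⟩
  have ho := (H.flow x hx).2 r
  have hcont : ContinuousOn (fun u => fwd u x - u • w x) (Icc 0 r) :=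
    ho.cont.sub (by fun_prop)
  have hd : ∀ u ∈ Ico 0 r, HasDerivWithinAt (fun u => fwd u x - u • w x) 0 (Ici u) u := by
    intro u hu
    have h1 := ho.hasDerivWithinAt hu
    have h2 : w (fwd u x) = w x := by
      rcases hu.1.eq_or_lt with rfl | hu0
      · rw [(H.flow x hx).1]
      · exact hw u ⟨hu0, hu.2⟩
    rw [h2] at h1
    have h3 := h1.sub ((hasDerivAt_id u).smul_const (w x)).hasDerivWithinAt
    rwa [one_smul, sub_self] at h3
  have h4 := constant_of_has_deriv_right_zero hcont hd u hu
  rw [zero_smul, sub_zero, (H.flow x hx).1] at h4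
  exact sub_eq_iff_eq_add.1 h4

lemma continuousOn_apply (H : IsSignFlow S w fwd h) (hx : x ∈ S) (f : Pt n →ᵃ[ℝ] ℝ) :
    ContinuousOn (fun u => f (fwd u x)) (Icc 0 r) :=
  (AffineMap.continuous_of_finiteDimensional f).comp_continuousOn ((H.flow x hx).2 r).cont

/-- A step can be extended backwards along a piece of the orbit with constant signs. -/
lemma isStep_extend (H : IsSignFlow S w fwd h) (hx : x ∈ S) (hs : 0 < s)
    (hb : ∀ u ∈ Ioc 0 s, signs h (fwd u x) = b) (hr : 0 < r)
    (hstep : IsStep fwd h (fwd s x) r a' b' c') : IsStep fwd h x (s + r) (signs h x) b' c' := by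
  have hy := H.flow.mem hx hs.le
  obtain ⟨hw, heq⟩ := H.eq_add_smul hx fun u hu => hb u (Ioo_subset_Ioc_self hu)
  have hwy : w (fwd s x) = w x := by
    rw [← hw (s / 2) ⟨by linarith, by linarith⟩]
    exact H.vel _ hy _ (by rw [hb s ⟨hs, le_rfl⟩, hb (s / 2) ⟨by linarith, by linarith⟩])
  have heq' := (H.eq_add_smul hy hstep.between).2
  rw [hwy] at heq'
  -- At the junction a sign could differ only by being zero there, but a function that vanishes
  -- along the first piece has slope zero and remains zero.
  have hbb : b = b' := by
    funext k
    have h1 := sign_eq_or_eq_zero_of_Ioo (H.continuousOn_apply hy (h k)) hr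
      (fun u hu => congrFun (hstep.between u hu) k) (t := 0) ⟨le_rfl, hr.le⟩
    rw [(H.flow _ hy).1, ← signs, hb s ⟨hs, le_rfl⟩] at h1
    rcases h1 with h1 | h1
    · exact h1
    have hbk : b k = 0 := by rw [← hb s ⟨hs, le_rfl⟩]; exact (signs_eq_zero_iff h _ k).2 h1
    have h2 := hb (s / 2) ⟨by linarith, by linarith⟩
    have h3 := (signs_eq_zero_iff h _ k).1 (congrFun h2 k |>.trans hbk)
    rw [heq _ ⟨by linarith, by linarith⟩, affine_add_smul] at h3
    have h4 := h1
    rw [heq _ ⟨hs.le, le_rfl⟩, affine_add_smul] at h4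
    have hsl : (h k).linear (w x) = 0 := by
      have : s / 2 * (h k).linear (w x) = 0 := by linarith
      exact (mul_eq_zero.1 this).resolve_left (by linarith)
    rw [hbk, ← hstep.between (r / 2) ⟨by linarith, by linarith⟩]
    refine ((signs_eq_zero_iff h _ k).2 ?_).symm
    rw [heq' _ ⟨by linarith, by linarith⟩, affine_add_smul, h1, hsl]
    simp
  refine ⟨rfl, fun u hu => ?_, ?_⟩
  · rcases le_or_gt u s with hus | hus
    · rw [hb u ⟨hu.1, hus⟩, hbb]
    · have h1 := hstep.between (u - s) ⟨by linarith, by linarith [hu.2]⟩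
      rwa [← H.flow.add hx hs.le (by linarith), add_sub_cancel] at h1
  · rw [H.flow.add hx hs.le hr.le]
    exact hstep.finish

/-- A constant-sign piece in front lengthens the first step instead of adding one, so `m` is
unchanged. -/
lemma mem_hitSet_of_extend (H : IsSignFlow S w fwd h) (hx : x ∈ S) (hs : 0 < s)
    (hb : ∀ u ∈ Ioc 0 s, signs h (fwd u x) = b) (hm : fwd s x ∈ hitSet S fwd h k₀ m) :
    x ∈ hitSet S fwd h k₀ m := by
  cases m with
  | zero => exact absurd hm (notMem_empty _)
  | succ m =>
    obtain ⟨r, a', b', c', k, he, h'⟩ := hm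
    refine ⟨s + r, _, b', c', k, ⟨hx, add_pos hs he.pos, H.isStep_extend hx hs hb he.pos he.step,
      he.ne_zero, he.eq_zero, he.ne_zero'⟩, ?_⟩
    rwa [H.flow.add hx hs.le he.pos.le]

lemma _root_.HamGame.IsEvent.apply_ne_zero (he : IsEvent S fwd h k₀ x r a b c k) :
    ∀ s, 0 < s → s < r → h k₀ (fwd s x) ≠ 0 := fun s hs hsr h0 =>
  he.ne_zero' (by rw [← he.step.between s ⟨hs, hsr⟩]; exact (signs_eq_zero_iff h _ _).2 h0)

lemma _root_.HamGame.IsEvent.isFirstZero (he : IsEvent S fwd h k₀ x r a b c k) (hc : c k₀ = 0) :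
    IsFirstZero fwd (h k₀) x r :=
  ⟨he.pos, (signs_eq_zero_iff h _ _).1 (by rw [he.step.finish, hc]), he.apply_ne_zero⟩

/-- The condition `b k₀ ≠ 0` excludes zeros inside steps, and `c k₀ ≠ 0` excludes them at the joints
before the last. -/
lemma exists_isFirstZero_of_mem_hitSet (H : IsSignFlow S w fwd h)
    (hx : x ∈ hitSet S fwd h k₀ m) : x ∈ S ∧ ∃ t, IsFirstZero fwd (h k₀) x t := by
  induction m generalizing x with
  | zero => exact absurd hx (notMem_empty _)
  | succ m ih =>
    obtain ⟨r, a, b, c, k, he, h'⟩ := hx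
    refine ⟨he.mem, ?_⟩
    by_cases hc : c k₀ = 0
    · exact ⟨r, he.isFirstZero hc⟩
    obtain ⟨-, t, ht0, ht, hts⟩ := ih (h'.resolve_left hc)
    refine ⟨r + t, add_pos he.pos ht0, ?_, fun s hs hst => ?_⟩
    · rwa [H.flow.add he.mem he.pos.le ht0.le]
    · rcases lt_trichotomy s r with hsr | rfl | hsr
      · exact he.apply_ne_zero s hs hsr
      · exact fun h0 => hc (by rw [← he.step.finish]; exact (signs_eq_zero_iff h _ _).2 h0)
      · have h1 := hts (s - r) (by linarith) (by linarith)
        rwa [← H.flow.add he.mem he.pos.le (by linarith), add_sub_cancel] at h1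

variable [Finite ι]

/-- Work backwards from `t`, with `s₀` the infimum of the times after which every orbit point before
`t` reaches the target in finitely many steps. The right germ at `s₀` includes `s₀` itself if `s₀ <
t`, and the left germ passes below `s₀` at the cost of at most one more step. Hence `s₀ = 0`. -/
lemma exists_mem_hitSet (H : IsSignFlow S w fwd h) (hx : x ∈ S)
    (ht : IsFirstZero fwd (h k₀) x t) : ∃ m, x ∈ hitSet S fwd h k₀ m := by
  obtain ⟨ht0, hgt, hgs⟩ := ht
  set B : Set ℝ := {s | s ∈ Icc 0 t ∧ ∀ u ∈ Ico s t, ∃ m, fwd u x ∈ hitSet S fwd h k₀ m} with hB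
  have hBt : t ∈ B := ⟨⟨ht0.le, le_rfl⟩, fun u hu => absurd hu.1 (not_le.2 hu.2)⟩
  have hbdd : BddBelow B := ⟨0, fun s hs => hs.1.1⟩
  set s₀ := sInf B with hs₀
  have hs0 : 0 ≤ s₀ := le_csInf ⟨t, hBt⟩ fun s hs => hs.1.1
  have hst : s₀ ≤ t := csInf_le hbdd hBt
  have hA : ∀ u ∈ Ioo s₀ t, ∃ m, fwd u x ∈ hitSet S fwd h k₀ m := fun u hu => by
    obtain ⟨s, hs, hsu⟩ := exists_lt_of_csInf_lt ⟨t, hBt⟩ hu.1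
    exact hs.2 u ⟨hsu.le, hu.2⟩
  have hA0 : s₀ < t → ∃ m, fwd s₀ x ∈ hitSet S fwd h k₀ m := fun hlt => by
    have hy := H.flow.mem hx hs0
    obtain ⟨ε, hε, h1⟩ := H.flow.exists_eq_add_smul hy
    obtain ⟨a, ε', hε', h2⟩ := exists_signs_add_smul_eq h (fwd s₀ x) (w (fwd s₀ x))
    set v := min (min ε ε') (t - s₀) / 2 with hv
    have hmin : 0 < min (min ε ε') (t - s₀) := lt_min (lt_min hε hε') (by linarith)
    have hv1 : v < ε := by
      linarith [(min_le_left (min ε ε') (t - s₀)).trans (min_le_left _ _)]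
    have hv2 : v < ε' := by
      linarith [(min_le_left (min ε ε') (t - s₀)).trans (min_le_right _ _)]
    have hv3 : v < t - s₀ := by linarith [min_le_right (min ε ε') (t - s₀)]
    obtain ⟨m, hm⟩ := hA (s₀ + v) ⟨by linarith, by linarith⟩
    rw [H.flow.add hx hs0 (by linarith)] at hm
    refine ⟨m, H.mem_hitSet_of_extend (b := a) hy (by linarith) (fun u hu => ?_) hm⟩
    rw [h1 u ⟨hu.1.le, by linarith [hu.2]⟩]
    exact h2 u ⟨hu.1, by linarith [hu.2]⟩
  rcases hs0.eq_or_lt with h0 | hpos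
  · obtain ⟨m, hm⟩ := hA0 (by linarith)
    rw [← h0, (H.flow x hx).1] at hm
    exact ⟨m, hm⟩
  exfalso
  obtain ⟨ε, hε, hεs, z, hz⟩ := H.left x hx s₀ hpos
  obtain ⟨b, ε', hε', hb⟩ := exists_signs_add_smul_eq h (fwd s₀ x) z
  have hδ : 0 < min ε ε' := lt_min hε hε'
  have claim : ∀ v ∈ Ioo 0 (min ε ε'), ∃ m, fwd (s₀ - v) x ∈ hitSet S fwd h k₀ m := by
    intro v hv
    have hvε : v < ε := hv.2.trans_le (min_le_left _ _)
    have hvε' : v < ε' := hv.2.trans_le (min_le_right _ _)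
    have hu : 0 ≤ s₀ - v := by linarith
    have hy := H.flow.mem hx hu
    have hbt : ∀ v' ∈ Ioo 0 v, signs h (fwd v' (fwd (s₀ - v) x)) = b := fun v' hv' => by
      rw [← H.flow.add hx hu hv'.1.le, show s₀ - v + v' = s₀ - (v - v') by ring,
        hz _ ⟨by linarith [hv'.2], by linarith [hv'.1]⟩]
      exact hb _ ⟨by linarith [hv'.2], by linarith [hv'.1]⟩
    have hfinish : fwd v (fwd (s₀ - v) x) = fwd s₀ x := by
      rw [← H.flow.add hx hu hv.1.le, sub_add_cancel]
    have hb0 : b k₀ ≠ 0 := fun h0 => by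
      have h1 := hbt (v / 2) ⟨by linarith [hv.1], by linarith [hv.1]⟩
      rw [← H.flow.add hx hu (by linarith [hv.1])] at h1
      refine hgs (s₀ - v + v / 2) (by linarith [hv.1]) (by linarith [hv.1]) ?_
      exact (signs_eq_zero_iff h _ _).1 (by rw [h1, h0])
    rcases hst.eq_or_lt with heq | hlt
    · refine ⟨1, v, _, b, _, k₀, ⟨hy, hv.1, ⟨rfl, hbt, rfl⟩, hb0, ?_, hb0⟩, Or.inl ?_⟩ <;>
      · rw [hfinish, signs_eq_zero_iff, heq]
        exact hgt
    · obtain ⟨m, hm⟩ := hA0 hlt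
      rw [← hfinish] at hm
      by_cases hsb : signs h (fwd s₀ x) = b
      · refine ⟨m, H.mem_hitSet_of_extend (b := b) hy hv.1 (fun v' hv' => ?_) hm⟩
        rcases hv'.2.eq_or_lt with rfl | hlt'
        · rw [hfinish, hsb]
        · exact hbt v' ⟨hv'.1, hlt'⟩
      -- Some sign changes at `s₀`. By continuity it can only become zero, so `h k` marks the end of
      -- a new step.
      · obtain ⟨k, hk⟩ := Function.ne_iff.1 hsb
        have h1 := (sign_eq_or_eq_zero_of_Ioo (H.continuousOn_apply hy (h k)) hv.1
          (fun u hu => congrFun (hbt u hu) k) (t := v) ⟨hv.1.le, le_rfl⟩).resolve_left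
          (by rw [hfinish]; exact hk)
        have h2 : signs h (fwd v (fwd (s₀ - v) x)) k = 0 := (signs_eq_zero_iff h _ _).2 h1
        refine ⟨m + 1, v, _, b, _, k, ⟨hy, hv.1, ⟨rfl, hbt, rfl⟩, fun h0 => hk ?_, h2, hb0⟩,
          Or.inr hm⟩
        rw [h0, ← hfinish, h2]
  have hlt : s₀ - min ε ε' / 2 ∈ B := by
    have hle : min ε ε' ≤ s₀ := (min_le_left _ _).trans hεs
    refine ⟨⟨by linarith, by linarith⟩, fun u hu => ?_⟩
    rcases lt_trichotomy u s₀ with h1 | rfl | h1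
    · have := claim (s₀ - u) ⟨by linarith, by linarith [hu.1]⟩
      rwa [sub_sub_cancel] at this
    · exact hA0 hu.2
    · exact hA u ⟨h1, hu.2⟩
  linarith [csInf_le hbdd hlt]

end IsSignFlow

/-! ### Piecewise affine first return maps -/

/-- The time at which `f` vanishes on the line through `x` in the direction `v`. -/
noncomputable def zeroTime (f : Pt n →ᵃ[ℝ] ℝ) (v : Pt n) : Pt n →ᵃ[ℝ] ℝ :=
  (-(f.linear v)⁻¹) • f

lemma zeroTime_apply (f : Pt n →ᵃ[ℝ] ℝ) (v x : Pt n) :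
    zeroTime f v x = -(f.linear v)⁻¹ * f x := rfl

/-- Translation by the multiple `s` of the time at which `f` vanishes. -/
noncomputable def moveTo (f : Pt n →ᵃ[ℝ] ℝ) (v : Pt n) (s : ℝ) : Pt n →ᵃ[ℝ] Pt n :=
  AffineMap.id ℝ (Pt n) +
    ((LinearMap.toSpanSingleton ℝ (Pt n) (s • v)).toAffineMap.comp (zeroTime f v))

lemma moveTo_apply (f : Pt n →ᵃ[ℝ] ℝ) (v : Pt n) (s : ℝ) (x : Pt n) :
    moveTo f v s x = x + (s * zeroTime f v x) • v := by
  simp [moveTo, smul_smul, mul_comm]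

namespace IsSignFlow

variable {ι : Type*} {S : Set (Pt n)} {w : Pt n → Pt n} {fwd : ℝ → Pt n → Pt n}
  {h : ι → Pt n →ᵃ[ℝ] ℝ} {x x₀ : Pt n} {r r₀ : ℝ} {a b c : ι → SignType} {k k₀ : ι} {m : ℕ}

lemma slope_ne_zero (H : IsSignFlow S w fwd h) (he : IsEvent S fwd h k₀ x r a b c k) :
    (h k).linear (w x) ≠ 0 := by
  intro h0
  have heq := (H.eq_add_smul he.mem he.step.between).2
  have h1 : h k (fwd r x) = 0 := (signs_eq_zero_iff h _ _).1 (by rw [he.step.finish, he.eq_zero])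
  have h2 : h k (fwd (r / 2) x) ≠ 0 := fun h' => he.ne_zero (by
    rw [← he.step.between (r / 2) ⟨by linarith [he.pos], by linarith [he.pos]⟩]
    exact (signs_eq_zero_iff h _ _).2 h')
  rw [heq r ⟨he.pos.le, le_rfl⟩, affine_add_smul, h0] at h1
  rw [heq (r / 2) ⟨by linarith [he.pos], by linarith [he.pos]⟩, affine_add_smul, h0] at h2
  exact h2 (by linarith)

/-- The length of a step is thus affine in its starting point; this is why an event records a
function that becomes zero at its end. -/
lemma zeroTime_eq (H : IsSignFlow S w fwd h) (he : IsEvent S fwd h k₀ x r a b c k) :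
    zeroTime (h k) (w x) x = r := by
  have hsl := H.slope_ne_zero he
  have h1 : h k (fwd r x) = 0 := (signs_eq_zero_iff h _ _).1 (by rw [he.step.finish, he.eq_zero])
  rw [(H.eq_add_smul he.mem he.step.between).2 r ⟨he.pos.le, le_rfl⟩, affine_add_smul] at h1
  rw [zeroTime_apply, eq_neg_of_add_eq_zero_left h1]
  field_simp

lemma signs_or (H : IsSignFlow S w fwd h) (he : IsEvent S fwd h k₀ x r a b c k) (l : ι) :
    (a l = b l ∨ a l = 0) ∧ (c l = b l ∨ c l = 0) := by
  have h1 := fun t ht => sign_eq_or_eq_zero_of_Ioo (H.continuousOn_apply he.mem (h l)) he.pos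
    (fun u hu => congrFun (he.step.between u hu) l) (t := t) ht
  have h2 := h1 0 ⟨le_rfl, he.pos.le⟩
  have h3 := h1 r ⟨he.pos.le, le_rfl⟩
  rw [← sign_eq_zero_iff] at h2 h3
  rw [(H.flow x he.mem).1] at h2
  rw [← he.step.start, ← he.step.finish]
  exact ⟨h2, h3⟩

/-- The points whose next event is of the same kind as a given one are described by the signs at
the beginning, in the middle and at the end of a line segment. -/
lemma isEvent_iff (H : IsSignFlow S w fwd h) (he : IsEvent S fwd h k₀ x₀ r₀ a b c k) :
    (∃ r, IsEvent S fwd h k₀ x r a b c k ∧ fwd r x = moveTo (h k) (w x₀) 1 x) ↔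
      signs h x = a ∧ signs h (moveTo (h k) (w x₀) (1 / 2) x) = b ∧
        signs h (moveTo (h k) (w x₀) 1 x) = c := by
  set v := w x₀
  simp only [moveTo_apply, one_mul]
  constructor
  · rintro ⟨r, hr, -⟩
    have hv : w x = v := H.vel _ hr.mem _ (by rw [hr.step.start, he.step.start])
    have heq := (H.eq_add_smul hr.mem hr.step.between).2
    have hz := H.zeroTime_eq hr
    rw [hv] at heq hz
    have hpos := hr.pos
    rw [hz, ← heq _ ⟨by linarith, by linarith⟩, ← heq _ ⟨hr.pos.le, le_rfl⟩]
    exact ⟨hr.step.start, hr.step.between _ ⟨by linarith, by linarith⟩, hr.step.finish⟩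
  · rintro ⟨h0, h1, h2⟩
    have hxS : x ∈ S := H.mem _ he.mem _ (by rw [h0, he.step.start])
    have hv : w x = v := H.vel _ hxS _ (by rw [h0, he.step.start])
    set r := zeroTime (h k) v x with hrdef
    -- The slope along `v` is common to `x` and `x₀`, so the sign of the zero time depends only on
    -- that of `h k x`.
    have hr : 0 < r := by
      have h3 : 0 < zeroTime (h k) v x₀ := by rw [H.zeroTime_eq he]; exact he.pos
      have h4 : SignType.sign (h k x) = SignType.sign (h k x₀) := by
        have := congrFun (h0.trans he.step.start.symm) k
        exact this
      rw [hrdef, zeroTime_apply, ← sign_eq_one_iff, sign_mul, h4, ← sign_mul, ← zeroTime_apply]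
      exact sign_pos h3
    have hsg : ∀ u ∈ Ioo 0 r, signs h (x + u • v) = b := fun u hu => by
      funext l
      obtain ⟨h5, h6⟩ := H.signs_or he l
      have h7 := congrFun h0 l
      have h8 := congrFun h1 l
      have h9 := congrFun h2 l
      rw [signs, affine_add_smul] at h8 h9 ⊢
      rw [signs] at h7
      refine sign_add_mul_eq (r := r) ?_ ?_ ?_ hu
      · rw [← sign_eq_zero_iff, h7]; exact h5
      · rw [← h8]; congr 3; ring
      · rw [← sign_eq_zero_iff, h9]; exact h6
    have hmid : r₀ / 2 ∈ Ioo 0 r₀ := ⟨by linarith [he.pos], by linarith [he.pos]⟩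
    have hw0 := (H.eq_add_smul he.mem he.step.between).1 _ hmid
    have hmidS := H.flow.mem he.mem hmid.1.le
    have hx0 : x + (0 : ℝ) • v = x := by simp
    -- The straight segment has the sign pattern of the model step, so it is an orbit, and
    -- uniqueness makes it the flow.
    have ho : IsOrbit S w (fun u => x + u • v) r := by
      refine IsOrbit.of_germ (by fun_prop) (fun u hu => ?_) fun u hu => ⟨1, one_pos, fun s _ _ => ?_⟩
      · rcases hu.1.eq_or_lt with rfl | hu0
        · rwa [hx0]
        rcases hu.2.eq_or_lt with rfl | hur
        · exact H.mem _ (H.flow.mem he.mem he.pos.le) _ (by rw [h2, he.step.finish])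
        · exact H.mem _ hmidS _ (by rw [hsg u ⟨hu0, hur⟩, he.step.between _ hmid])
      · have : w (x + u • v) = v := by
          rcases hu.1.eq_or_lt with rfl | hu0
          · rwa [hx0]
          · refine (H.vel _ hmidS _ ?_).symm.trans hw0
            rw [hsg u ⟨hu0, hu.2⟩, he.step.between _ hmid]
        change x + (u + s) • v = x + u • v + s • w (x + u • v)
        rw [this]
        module
    have hφ : ∀ u ∈ Icc 0 r, fwd u x = x + u • v := fun u hu =>
      (H.flow.eq_of_isOrbit hxS ho hx0 hu).symm
    refine ⟨r, ⟨hxS, hr, ⟨h0, fun u hu => ?_, ?_⟩, he.ne_zero, he.eq_zero, he.ne_zero'⟩, ?_⟩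
    · rw [hφ u (Ioo_subset_Icc_self hu)]
      exact hsg u hu
    · rw [hφ r ⟨hr.le, le_rfl⟩]
      exact h2
    · exact hφ r ⟨hr.le, le_rfl⟩

lemma fwd_eq_moveTo (H : IsSignFlow S w fwd h) (he : IsEvent S fwd h k₀ x₀ r₀ a b c k)
    (hr : IsEvent S fwd h k₀ x r a b c k) : fwd r x = moveTo (h k) (w x₀) 1 x := by
  have hv : w x = w x₀ := H.vel _ hr.mem _ (by rw [hr.step.start, he.step.start])
  rw [moveTo_apply, one_mul, ← hv, H.zeroTime_eq hr]
  exact (H.eq_add_smul hr.mem hr.step.between).2 r ⟨hr.pos.le, le_rfl⟩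

variable [Finite ι]

/-- On the points which reach `{h k₀ = 0}` within `m` steps, the first hit is piecewise affine. -/
lemma isPiecewiseAffineRel_hitSet (H : IsSignFlow S w fwd h) (m : ℕ) :
    IsPiecewiseAffineRel (fun x y => ∃ t, IsFirstZero fwd (h k₀) x t ∧ fwd t x = y)
      (hitSet S fwd h k₀ m) := by
  induction m with
  | zero => exact .empty
  | succ m ih =>
    have hU : hitSet S fwd h k₀ (m + 1) = ⋃ e : (ι → SignType) × (ι → SignType) ×
        (ι → SignType) × ι, {x | ∃ r, IsEvent S fwd h k₀ x r e.1 e.2.1 e.2.2.1 e.2.2.2 ∧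
          (e.2.2.1 k₀ = 0 ∨ fwd r x ∈ hitSet S fwd h k₀ m)} := by
      ext x
      simp only [hitSet, mem_ofPred_eq, mem_iUnion, Prod.exists]
      constructor
      · rintro ⟨r, a, b, c, k, hx⟩
        exact ⟨a, b, c, k, r, hx⟩
      · rintro ⟨a, b, c, k, r, hx⟩
        exact ⟨r, a, b, c, k, hx⟩
    rw [hU]
    refine .iUnion fun ⟨a, b, c, k⟩ => ?_
    simp only
    -- If this type of step occurs, one sample `x₀` provides the direction shared by all points of
    -- the type.
    by_cases hex : ∃ x₀ r₀, IsEvent S fwd h k₀ x₀ r₀ a b c k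
    swap
    · convert IsPiecewiseAffineRel.empty
      ext x
      simp only [mem_ofPred_eq, mem_empty_iff_false, iff_false]
      rintro ⟨r, hr, -⟩
      exact hex ⟨x, r, hr⟩
    obtain ⟨x₀, r₀, he⟩ := hex
    set X : Set (Pt n) := {x | signs h x = a} ∩
      (moveTo (h k) (w x₀) (1 / 2) ⁻¹' {x | signs h x = b} ∩
        moveTo (h k) (w x₀) 1 ⁻¹' {x | signs h x = c}) with hX
    have hXp : IsConvexPolyhedral X := (isConvexPolyhedral_signs_eq h a).inter
      (((isConvexPolyhedral_signs_eq h b).preimage _).inter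
        ((isConvexPolyhedral_signs_eq h c).preimage _))
    have hXiff : ∀ x, x ∈ X ↔ ∃ r, IsEvent S fwd h k₀ x r a b c k := fun x => by
      rw [hX]
      refine (H.isEvent_iff he).symm.trans ⟨?_, ?_⟩
      · rintro ⟨r, hr, -⟩
        exact ⟨r, hr⟩
      · rintro ⟨r, hr⟩
        exact ⟨r, hr, H.fwd_eq_moveTo he hr⟩
    by_cases hc : c k₀ = 0
    · have hD : {x | ∃ r, IsEvent S fwd h k₀ x r a b c k ∧
          (c k₀ = 0 ∨ fwd r x ∈ hitSet S fwd h k₀ m)} = X := by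
        ext x
        simp [hXiff, hc]
      rw [hD]
      refine .of_isConvexPolyhedral hXp (moveTo (h k) (w x₀) 1) ?_
      rintro x hx y ⟨t, ht, rfl⟩
      obtain ⟨r, hr⟩ := (hXiff x).1 hx
      rw [ht.unique (hr.isFirstZero hc), H.fwd_eq_moveTo he hr]
    · have hD : {x | ∃ r, IsEvent S fwd h k₀ x r a b c k ∧
          (c k₀ = 0 ∨ fwd r x ∈ hitSet S fwd h k₀ m)} =
          X ∩ moveTo (h k) (w x₀) 1 ⁻¹' hitSet S fwd h k₀ m := by
        ext x
        simp only [hc, false_or, mem_ofPred_eq, mem_inter_iff, hXiff, mem_preimage]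
        constructor
        · rintro ⟨r, hr, hm⟩
          exact ⟨⟨r, hr⟩, by rwa [← H.fwd_eq_moveTo he hr]⟩
        · rintro ⟨⟨r, hr⟩, hm⟩
          exact ⟨r, hr, by rwa [H.fwd_eq_moveTo he hr]⟩
      rw [hD]
      refine ih.inter_preimage hXp _ ?_
      rintro x hx - y ⟨t, ht, rfl⟩
      obtain ⟨r, hr⟩ := (hXiff x).1 hx
      rw [← H.fwd_eq_moveTo he hr]
      have hrt : r < t := by
        by_contra hle
        rcases (not_lt.1 hle).eq_or_lt with rfl | hlt
        · exact hc (by rw [← hr.step.finish]; exact (signs_eq_zero_iff h _ _).2 ht.2.1)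
        · exact hr.apply_ne_zero t ht.1 hlt ht.2.1
      have hadd : ∀ s, 0 ≤ s → fwd s (fwd r x) = fwd (r + s) x := fun s hs =>
        (H.flow.add hr.mem hr.pos.le hs).symm
      refine ⟨t - r, ⟨by linarith, ?_, fun s hs hst => ?_⟩, ?_⟩
      · rw [hadd _ (by linarith), add_sub_cancel]
        exact ht.2.1
      · rw [hadd _ hs.le]
        exact ht.2.2 _ (by linarith [hr.pos]) (by linarith)
      · rw [hadd _ (by linarith), add_sub_cancel]

lemma iUnion_hitSet (H : IsSignFlow S w fwd h) :
    ⋃ m, hitSet S fwd h k₀ m = {x | x ∈ S ∧ ∃ t, IsFirstZero fwd (h k₀) x t} := by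
  ext x
  simp only [mem_iUnion, mem_ofPred_eq]
  constructor
  · rintro ⟨m, hm⟩
    exact H.exists_isFirstZero_of_mem_hitSet hm
  · rintro ⟨hx, t, ht⟩
    exact H.exists_mem_hitSet hx ht

/-- First return maps between hyperplanes are piecewise affine. -/
lemma returnPiecewiseAffine (H : IsSignFlow S w fwd h) (φ : Flow ℝ S)
    (hφ : ∀ t, 0 ≤ t → ∀ x : S, (φ t x : Pt n) = fwd t x) (k₀ : ι) (f : Pt n →ᵃ[ℝ] ℝ) :
    ReturnPiecewiseAffine φ {x | f x = 0} {x | h k₀ x = 0} := by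
  have hhit : ∀ (x : S) t, IsFirstHit φ {x | h k₀ x = 0} x t ↔ IsFirstZero fwd (h k₀) x t := by
    intro x t
    simp only [IsFirstHit, IsFirstZero, mem_ofPred_eq]
    constructor
    · rintro ⟨h1, h2, h3⟩
      refine ⟨h1, by rwa [← hφ t h1.le], fun s hs hst => ?_⟩
      rw [← hφ s hs.le]
      exact h3 s hs hst
    · rintro ⟨h1, h2, h3⟩
      refine ⟨h1, by rwa [hφ t h1.le], fun s hs hst => ?_⟩
      rw [hφ s hs.le]
      exact h3 s hs hst
  have hP : IsConvexPolyhedral {x | f x = 0} := by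
    have h1 := IsConvexPolyhedral.sign_eq f 0
    simp only [sign_eq_zero_iff] at h1
    exact h1
  -- The union over all numbers of steps makes the family countable; the identity map serves only to
  -- intersect with the hyperplane `{f = 0}`.
  obtain ⟨Fam, hc, hU, hF⟩ := (IsPiecewiseAffineRel.iUnion
    (H.isPiecewiseAffineRel_hitSet (k₀ := k₀))).inter_preimage hP (AffineMap.id ℝ (Pt n))
      (fun x _ _ y hy => hy)
  refine ⟨Fam, hc, ?_, fun C hC => ⟨(hF C hC).1, ?_⟩⟩
  · rw [← hU, H.iUnion_hitSet]
    ext y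
    constructor
    · rintro ⟨hy, x, rfl, t, ht⟩
      exact ⟨hy, x.2, t, (hhit x t).1 ht⟩
    · rintro ⟨hy, hyS, t, ht⟩
      exact ⟨hy, ⟨y, hyS⟩, rfl, t, (hhit ⟨y, hyS⟩ t).2 ht⟩
  · obtain ⟨L, hL⟩ := (hF C hC).2
    refine ⟨L, fun x t hx ht => ?_⟩
    rw [hφ t ht.1.le]
    exact hL x hx _ ⟨t, (hhit x t).1 ht, rfl⟩

end IsSignFlow

/-! ### The flow of the game -/

/-- A finite family of affine functions whose signs determine a half-space intersection. -/
lemma IsHalfspaceInter.exists_finset {C : Set (Pt n)} (hC : IsHalfspaceInter C) :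
    ∃ F : Finset (Pt n →ᵃ[ℝ] ℝ), ∀ x y, (∀ f ∈ F, SignType.sign (f x) = SignType.sign (f y)) →
      (x ∈ C ↔ y ∈ C) := by
  obtain ⟨F, rfl⟩ := hC
  refine ⟨F, fun x y h => forall₂_congr fun f hf => ?_⟩
  rw [← sign_nonneg_iff, h f hf, sign_nonneg_iff]

section

variable [Nonempty (Fin n)]

/-- A finite family of affine functions whose signs determine membership in a level set and the
cell of a point. -/
lemma exists_finset_signs (M : Mat n) (ρ : ℝ) : ∃ F : Finset (Pt n →ᵃ[ℝ] ℝ), ∀ x ∈ levelSet M ρ,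
    ∀ y, (∀ f ∈ F, SignType.sign (f x) = SignType.sign (f y)) →
      y ∈ levelSet M ρ ∧ topRows M x.2 = topRows M y.2 ∧ bottomCols M x.1 = bottomCols M y.1 := by
  classical
  obtain ⟨F, hF⟩ := (isHalfspaceInter_simplexProd (n := n)).exists_finset
  choose G hG using fun i => (isHalfspaceInter_topRows M i).exists_finset
  choose G' hG' using fun j => (isHalfspaceInter_bottomCols M j).exists_finset
  let P : Finset (Pt n →ᵃ[ℝ] ℝ) :=
    Finset.univ.image fun k : Fin n × Fin n => affSub (payDiff M k.1 k.2) ρ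
  refine ⟨F ∪ Finset.univ.biUnion G ∪ Finset.univ.biUnion G' ∪ P, fun x hx y h => ?_⟩
  simp only [Finset.mem_union, or_imp, forall_and] at h
  obtain ⟨⟨⟨h1, h2⟩, h3⟩, h4⟩ := h
  have htop : topRows M x.2 = topRows M y.2 := Set.ext fun i =>
    hG i x y fun f hf => h2 f (Finset.mem_biUnion.2 ⟨i, Finset.mem_univ i, hf⟩)
  have hbot : bottomCols M x.1 = bottomCols M y.1 := Set.ext fun j =>
    hG' j x y fun f hf => h3 f (Finset.mem_biUnion.2 ⟨j, Finset.mem_univ j, hf⟩)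
  refine ⟨⟨(hF x y h1).1 hx.1, ?_⟩, htop, hbot⟩
  obtain ⟨i, hi⟩ := topRows_nonempty M x.2
  obtain ⟨j, hj⟩ := bottomCols_nonempty M x.1
  -- For an active pair this affine function is zero at `x`, hence also at `y`, which puts `y` on
  -- the same level.
  have h5 := h4 _ (Finset.mem_image_of_mem _ (Finset.mem_univ (i, j)))
  have h6 := ham_eq_of_mem M x hi hj
  rw [htop] at hi
  rw [hbot] at hj
  rw [ham_eq_of_mem M y hi hj]
  rw [affSub_apply, affSub_apply, payDiff_apply, payDiff_apply, ← h6, hx.2, sub_self, sign_zero]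
    at h5
  exact sub_eq_zero.1 (sign_eq_zero_iff.1 h5.symm)

variable {M A : Mat n} {p q : Fin n → ℝ} {μ ρ : ℝ} {fwd bwd : ℝ → Pt n → Pt n}

/-- The target function `g` is adjoined so that reaching its zero set counts as a sign change. The
left germs come from the backward flow through `reverse`. -/
lemma IsSmall.exists_isSignFlow (hρ : IsSmall M p q ρ) (h : IsEquil M p q μ) (hG : Good M A)
    (hf : IsForwardFlow (levelSet M ρ) (dir M A) fwd)
    (hb : IsForwardFlow (levelSet M ρ) (dir M (-A)) bwd) (g : Pt n →ᵃ[ℝ] ℝ) :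
    ∃ F : Finset (Pt n →ᵃ[ℝ] ℝ), g ∈ F ∧
      IsSignFlow (levelSet M ρ) (dir M A) fwd (fun f : F => (f : Pt n →ᵃ[ℝ] ℝ)) := by
  classical
  obtain ⟨F, hF⟩ := exists_finset_signs M ρ
  have hF' : ∀ x ∈ levelSet M ρ, ∀ y, signs (fun f : ↥(insert g F) => (f : Pt n →ᵃ[ℝ] ℝ)) x =
      signs (fun f : ↥(insert g F) => (f : Pt n →ᵃ[ℝ] ℝ)) y → _ := fun x hx y hxy =>
    hF x hx y fun f hf => congrFun hxy ⟨f, Finset.mem_insert_of_mem hf⟩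
  refine ⟨insert g F, Finset.mem_insert_self g F, hf,
    hρ.isTranslationField h hG.nondeg hG.invSum_ne_zero, fun x hx y hxy => (hF' x hx y hxy).1,
    fun x hx y hxy => ?_, fun x hx t ht => ?_⟩
  · obtain ⟨-, h1, h2⟩ := hF' x hx y hxy
    rw [dir, dir, h1, h2]
  · obtain ⟨ε, hε, h1⟩ := hb.exists_eq_add_smul (hf.mem hx ht.le)
    refine ⟨min ε t, lt_min hε ht, min_le_right _ _, dir M (-A) (fwd t x), fun u hu => ?_⟩
    rw [← h1 u ⟨hu.1, hu.2.trans (min_le_left _ _)⟩,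
      hf.reverse hb hG hx hu.1 (hu.2.trans (min_le_right _ _))]

/-- The flow on a small level set. -/
lemma IsSmall.exists_flow (hρ : IsSmall M p q ρ) (h : IsEquil M p q μ) (hG : Good M A) :
    ∃ φ : Flow ℝ (levelSet M ρ), IsUniqueFlow M A ρ φ ∧ IsPiecewiseTranslation M ρ φ ∧
      (∀ x : levelSet M ρ, (0 : Pt n) ∉ hamField M A x ∧ ∃ t, φ t x ≠ x) ∧
      ∀ f g : Pt n →ᵃ[ℝ] ℝ, ReturnPiecewiseAffine φ {x | f x = 0} {x | g x = 0} := by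
  have hforward : ∀ B : Mat n, Good M B →
      ∃ fwd, IsForwardFlow (levelSet M ρ) (dir M B) fwd := fun B hB => by
    obtain ⟨C, hC⟩ := exists_norm_dir_le M B
    exact exists_forward_flow (isCompact_levelSet M ρ).isClosed
      (hρ.isTranslationField h hB.nondeg hB.invSum_ne_zero) fun x _ => hC x
  obtain ⟨fwd, hf⟩ := hforward A hG
  obtain ⟨bwd, hb⟩ := hforward (-A) hG.neg
  refine ⟨levelFlow hf hb hG, isUniqueFlow_levelFlow hf hb hG,
    isPiecewiseTranslation_levelFlow hf hb hG,
    fun x => ⟨zero_notMem_hamField h hρ.pos x.2, exists_levelFlow_ne hf hb hG h hρ.pos x⟩,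
    fun f g => ?_⟩
  obtain ⟨F, hg, H⟩ := hρ.exists_isSignFlow h hG hf hb g
  exact H.returnPiecewiseAffine (levelFlow hf hb hG)
    (fun t ht x => twoSided_of_nonneg (x : Pt n) ht) ⟨g, hg⟩ f

lemma exists_hamField_eq_on_cell (hG : Good M A) (I J : Set (Fin n)) :
    ∃ K : Set (Pt n), K.Nonempty ∧ ∀ x ∈ cell M I J, hamField M A x = K := by
  by_cases hne : (cell M I J).Nonempty
  · obtain ⟨y, hy⟩ := hne
    refine ⟨hamField M A y, ⟨_, dir_mem_hamField hG.det_ne_zero hG.invSum_ne_zero y⟩, fun x hx => ?_⟩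
    rw [hamField_eq hG.det_ne_zero hG.invSum_ne_zero, hamField_eq hG.det_ne_zero hG.invSum_ne_zero,
      hx.2.1, hx.2.2, hy.2.1, hy.2.2]
  -- For an empty piece any nonempty set will do.
  · exact ⟨Set.univ, univ_nonempty, fun x hx => absurd ⟨x, hx⟩ hne⟩

end

end HamGame

theorem mainTheorem1 (n : ℕ) (hn : 2 ≤ n) :
    ∃ V : Set (HamGame.Mat n × HamGame.Mat n),
      V ⊆ HamGame.LI n ×ˢ univ ∧ IsOpen V ∧ HamGame.LI n ×ˢ univ ⊆ closure V ∧
      volume {B : (Fin n → Fin n → ℝ) × (Fin n → Fin n → ℝ) |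
        (Matrix.of B.1, Matrix.of B.2) ∈ (HamGame.LI n ×ˢ univ) \ V} = 0 ∧
      ∀ M A : HamGame.Mat n, (M, A) ∈ V →
        -- the two-form is symplectic on `Σ × Σ`
        HamGame.IsSymplectic A ∧
        -- `X_H` is piecewise constant
        (∀ I J : Set (Fin n), ∃ K : Set (HamGame.Pt n), K.Nonempty ∧
          ∀ x ∈ HamGame.cell M I J, HamGame.hamField M A x = K) ∧
        -- on the open pieces `H` is differentiable and `X_H` is its usual Hamiltonian vector field
        (∀ (i j : Fin n), ∀ x ∈ HamGame.cell M {i} {j}, ∃ v ∈ HamGame.tangentProd n,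
          HamGame.hamField M A x = {v} ∧
          ∃ L : HamGame.Pt n →L[ℝ] ℝ, HasFDerivAt (HamGame.ham M) L x ∧
            ∀ Y ∈ HamGame.tangentProd n, HamGame.symp A v Y = L Y) ∧
        -- `X_H` is multivalued exactly on a polyhedral set of codimension one in `Σ × Σ`
        HamGame.IsPolyhedralOfDim (2 * n - 3)
          {x | x ∈ HamGame.simplexProd n ∧ (HamGame.hamField M A x).Nontrivial} ∧
        -- the explicit form of the right-hand side of the differential inclusion
        (IsUnit A.det ∧ ∑ i, (A⁻¹ *ᵥ 1) i ≠ 0 ∧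
          ∀ x ∈ HamGame.simplexProd n, HamGame.hamField M A x = HamGame.brField M A x) ∧
        ∃ ρ₀ > 0, ∀ ρ : ℝ, 0 < ρ → ρ < ρ₀ →
          -- small level sets are spheres made up of pieces of hyperplanes
          Nonempty (HamGame.levelSet M ρ ≃ₜ
            Metric.sphere (0 : EuclideanSpace ℝ (Fin (2 * n - 2))) 1) ∧
          HamGame.IsPolyhedralOfDim (2 * n - 3) (HamGame.levelSet M ρ) ∧
          -- the differential inclusion induces a unique continuous flow
          ∃ φ : Flow ℝ (HamGame.levelSet M ρ),
            HamGame.IsUniqueFlow M A ρ φ ∧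
            HamGame.IsPiecewiseTranslation M ρ φ ∧
            (∀ x : HamGame.levelSet M ρ,
              (0 : HamGame.Pt n) ∉ HamGame.hamField M A x ∧ ∃ t, φ t x ≠ x) ∧
            -- first return maps between hyperplanes `{f = 0}` and `{g = 0}`
            ∀ f g : HamGame.Pt n →ᵃ[ℝ] ℝ,
              HamGame.ReturnPiecewiseAffine φ {x | f x = 0} {x | g x = 0} := by
  have : Nonempty (Fin n) := ⟨⟨0, by omega⟩⟩
  refine ⟨HamGame.genericSet n, fun B hB => ⟨hB.1, mem_univ _⟩, HamGame.isOpen_genericSet hn,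
    HamGame.subset_closure_genericSet hn, HamGame.volume_compl_genericSet hn, fun M A hMA => ?_⟩
  have hG : HamGame.Good M A := HamGame.good_of_minorPoly hMA.1 hMA.2
  obtain ⟨p, q, μ, h⟩ := HamGame.exists_equil hG.mem_LI
  have hA := hG.det_ne_zero
  have hs := hG.invSum_ne_zero
  obtain ⟨ρ₀, hρ₀, hsmall⟩ := h.exists_threshold
  refine ⟨HamGame.isSymplectic hA hs, HamGame.exists_hamField_eq_on_cell hG,
    fun i j x hx => HamGame.exists_hasFDerivAt hA hs i j hx,
    h.isPolyhedralOfDim_nontrivial hA hs,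
    ⟨hA.isUnit, hs, fun x _ => by rw [HamGame.hamField_eq hA hs, HamGame.brField_eq]⟩,
    ρ₀, hρ₀, fun ρ hpos hlt => ?_⟩
  have hρ : HamGame.IsSmall M p q ρ := ⟨hpos, fun Y hY hYρ => hsmall Y hY (hYρ ▸ hlt)⟩
  exact ⟨hρ.nonempty_homeomorph h, hρ.isPolyhedralOfDim hn h, hρ.exists_flow h hG⟩
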